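/- **Setting.** Let $\mathbb K=\mathbb R$ (real case) or $\mathbb K=\mathbb C$ (complex case). For each $n$ let $X_n$ be a deterministic self-adjoint $n\times n$ matrix with entries in $\mathbb K$ (real symmetric in the real case, Hermitian in the complex case), with eigenvalues $\lambda_1^n\le\dots\le\lambda_n^n$ and spectral measure $\mu_n=\frac1n\sum_{l=1}^n\delta_{\lambda_l^n}$. Assume that $\mu_n$ converges weakly to a compactly supported probability measure $\mu_X$ and that $\lambda_1^n\to a$, $\lambda_n^n\to b$, where $a=\min\operatorname{supp}\mu_X$, $b=\max\operatorname{supp}\mu_X$. Fix $r$ and real non-zero numbers $\theta_1\le\dots\le\theta_r$ independent of $n$. Let $\nu$ be a probability measure on $\mathbb K$ that is centred, has variance one ($\int|x|^2d\nu=1$) and satisfies a logarithmic Sobolev inequality: for some $c>0$, $\int f^2\log\frac{f^2}{\int f^2d\nu}\,d\nu\le 2c\int|\nabla f|^2d\nu$ for all differentiable $f\in L^2(\nu)$; in the complex case assume also that the real and imaginary parts are independent and identically distributed under $\nu$. Let $v_1^n,\dots,v_r^n$ be the column vectors in $\mathbb K^n$ whose $rn$ entries are $n^{-1/2}$ times i.i.d.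 variables with law $\nu$. Either $u_i^n=v_i^n$ for all $i$ (i.i.d. model), or $(u_i^n)_{i\le r}$ is the Gram–Schmidt orthonormalisation of $(v_i^n)_{i\le r}$ (orthonormalised model; it is defined with probability tending to one, and vectors left undefined are set to $0$). Let $\widetilde\lambda_1^n\le\dots\le\widetilde\lambda_n^n$ be the eigenvalues of $\widetilde X_n=X_n+\sum_{i=1}^r\theta_iu_i^n(u_i^n)^*$. For a measure $\mu$ let $G_\mu(z)=\int\frac{d\mu(x)}{z-x}$, and put $\overline\theta=1/\lim_{z\downarrow b}G_{\mu_X}(z)\ge0$, $\underline\theta=1/\lim_{z\uparrow a}G_{\mu_X}(z)\le0$ (with $1/\pm\infty=0$). For $\theta\ne0$ let $\rho_\theta$ be the unique $z\in(-\infty,a)\cup(b,\infty)$ with $G_{\mu_X}(z)=1/\theta$ if $\theta\notin[\underline\theta,\overline\theta]$, $\rho_\theta=a$ if $\theta\in[\underline\theta,0)$, and $\rho_\theta=b$ if $\theta\in(0,\overline\theta]$. Let $p_-$ (resp. $p_+$) be the number of $i$ with $\rho_{\theta_i}<a$ (resp. $\rho_{\theta_i}>b$), let $\alpha_1<\dots<\alpha_q$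 be the different values of those $\theta_i$ for which $\rho_{\theta_i}\notin\{a,b\}$, and let $k_j$ be the number of $i$ with $\theta_i=\alpha_j$. Put $$\gamma_i^n=\begin{cases}\sqrt n\,(\widetilde\lambda_i^n-\rho_{\theta_i}),&1\le i\le p_-,\\ \sqrt n\,(\widetilde\lambda^n_{n-(p_-+p_+)+i}-\rho_{\theta_{r-(p_-+p_+)+i}}),&p_-<i\le p_-+p_+.\end{cases}$$ **Theorem.** Assume in addition that $\sqrt n\,(G_{\mu_n}(z)-G_{\mu_X}(z))\to0$ for every $z\in\{\rho_{\alpha_1},\dots,\rho_{\alpha_q}\}$, and that $\kappa_4(\nu)=0$, where $\kappa_4(\nu)=\int x^4d\nu-3$ in the real case and $\int|z|^4d\nu-2$ in the complex case. Then, in both models, the random vector $\big(\gamma^n_{k_1+\dots+k_{j-1}+i},\ 1\le i\le k_j\big)_{1\le j\le q}$ converges in law, as $n\to\infty$, to $(\lambda_{i,j},\ 1\le i\le k_j)_{1\le j\le q}$, where $\lambda_{i,j}$ is the $i$-th smallest eigenvalue of $c_{\alpha_j}M_j$, and $M_1,\dots,M_q$ are independent random matrices, $M_j$ having the $\mathrm{GOE}(k_j)$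 law in the real case and the $\mathrm{GUE}(k_j)$ law in the complex case. Here $\mathrm{GOE}(k)$ (resp. $\mathrm{GUE}(k)$) is the law of a $k\times k$ real symmetric (resp. Hermitian) matrix $[g_{i,j}]$ such that the variables $\frac1{\sqrt2}g_{i,i}$ and $g_{i,j}$, $i<j$ (resp. $g_{i,i}$ and $\sqrt2\,\Re g_{i,j}$, $\sqrt2\,\Im g_{i,j}$, $i<j$) are independent standard Gaussian. The constant $c_\alpha\ge0$ is given by $$c_\alpha^2=\begin{cases}\dfrac1{\int(\rho_\alpha-x)^{-2}d\mu_X(x)}&\text{in the i.i.d. model},\\[3mm]\dfrac{\int(\rho_\alpha-x)^{-2}d\mu_X(x)-\alpha^{-2}}{\left(\int(\rho_\alpha-x)^{-2}d\mu_X(x)\right)^2}&\text{in the orthonormalised model}.\end{cases}$$ -/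

import Mathlib

open MeasureTheory ProbabilityTheory Filter Topology

noncomputable section

namespace FiniteRankDeformation

/-- The Borel (product) `σ`-algebra on a space of matrices. -/
instance instMeasurableSpaceMatrix {m n α : Type*} [MeasurableSpace α] :
    MeasurableSpace (Matrix m n α) :=
  inferInstanceAs (MeasurableSpace (m → n → α))

/-! ### Eigenvalues in increasing order -/

section Eigenvalues

variable {𝕜 : Type*} [RCLike 𝕜]

open Classical in
/-- `eig A i` is the `(i + 1)`-th smallest eigenvalue (with multiplicity) of the Hermitian matrix
`A`, so that `eig A 0 ≤ eig A 1 ≤ ⋯`.  Mathlib's `eigenvalues₀` is the decreasing enumeration.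
The value is `0` if `A` is not Hermitian or `i` is out of range. -/
def eig {ι : Type*} [Fintype ι] (A : Matrix ι ι 𝕜) (i : ℕ) : ℝ :=
  if h : A.IsHermitian ∧ i < Fintype.card ι then
    h.1.eigenvalues₀ ⟨Fintype.card ι - 1 - i, by omega⟩
  else 0

/-- The spectral measure `n⁻¹ ∑ₗ δ_{λₗ}` of an `n × n` Hermitian matrix. -/
def spectralMeasure {n : ℕ} (A : Matrix (Fin n) (Fin n) 𝕜) : Measure ℝ :=
  (n : ENNReal)⁻¹ • ∑ l ∈ Finset.range n, Measure.dirac (eig A l)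

end Eigenvalues

/-! ### The limiting spectral measure and its Cauchy-Stieltjes transform -/

/-- The lower bound `a` of the support. -/
def lowerEdge (μ : Measure ℝ) : ℝ := sInf μ.support

/-- The upper bound `b` of the support. -/
def upperEdge (μ : Measure ℝ) : ℝ := sSup μ.support

/-- The Cauchy-Stieltjes transform `G_μ(z) = ∫ (z - x)⁻¹ dμ(x)`, at real points `z`. -/
def cauchyTransform (μ : Measure ℝ) (z : ℝ) : ℝ := ∫ x, 1 / (z - x) ∂μ

/-- `θ̲ = 1 / lim_{z ↑ a} G_μ(z)`, written as the limit of `1 / G_μ(z)` so that it is `0` when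
`G_μ(z)` tends to `-∞`. -/
def lowerThreshold (μ : Measure ℝ) : ℝ :=
  limUnder (𝓝[<] (lowerEdge μ)) fun z ↦ 1 / cauchyTransform μ z

/-- `θ̅ = 1 / lim_{z ↓ b} G_μ(z)`, written as the limit of `1 / G_μ(z)` so that it is `0` when
`G_μ(z)` tends to `+∞`. -/
def upperThreshold (μ : Measure ℝ) : ℝ :=
  limUnder (𝓝[>] (upperEdge μ)) fun z ↦ 1 / cauchyTransform μ z

open Classical in
/-- The limit `ρ_θ` of the extreme eigenvalue created by a nonzero `θ`: the preimage of `1 / θ` by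
`G_μ`, viewed as an (injective) function on `(-∞, a) ∪ (b, ∞)`, if `θ < θ̲` or `θ̅ < θ`; otherwise
`a` if `θ < 0` and `b` if `0 < θ`. -/
def rho (μ : Measure ℝ) (θ : ℝ) : ℝ :=
  if θ < lowerThreshold μ ∨ upperThreshold μ < θ then
    Function.invFunOn (cauchyTransform μ) {z | z < lowerEdge μ ∨ upperEdge μ < z} (1 / θ)
  else if θ < 0 then lowerEdge μ
  else upperEdge μ

/-! ### The law of the entries -/

/-- `ν` satisfies a logarithmic Sobolev inequality with constant `c`:
`∫ f² log (f² / ∫ f² dν) dν ≤ 2 c ∫ |∇f|² dν` for every differentiable `f ∈ L²(ν)`.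
When the right-hand side is infinite nothing is claimed; when it is finite, the left-hand side
(whose integrand is bounded below) has to be finite.  On `ℂ`, seen as the Euclidean plane, the
norm of the real derivative is the Euclidean norm of the gradient. -/
def LogSobolev {E : Type*} [NormedAddCommGroup E] [NormedSpace ℝ E] [MeasurableSpace E]
    (ν : Measure E) (c : ℝ) : Prop :=
  ∀ f : E → ℝ, Differentiable ℝ f → MemLp f 2 ν → MemLp (fun x ↦ ‖fderiv ℝ f x‖) 2 ν →
    Integrable (fun x ↦ f x ^ 2 * Real.log (f x ^ 2 / ∫ y, f y ^ 2 ∂ν)) ν ∧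
      ∫ x, f x ^ 2 * Real.log (f x ^ 2 / ∫ y, f y ^ 2 ∂ν) ∂ν ≤
        2 * c * ∫ x, ‖fderiv ℝ f x‖ ^ 2 ∂ν

section Entries

variable {𝕜 : Type*} [RCLike 𝕜]

/-- The law `ν` of the entries satisfies a logarithmic Sobolev inequality, is centred with variance
one and, in the complex case, has independent and identically distributed real and imaginary
parts.  (`RCLike.I` is `0` when `𝕜` is `ℝ` and `i` when `𝕜` is `ℂ`.) -/
structure AdmissibleLaw (ν : Measure 𝕜) : Prop where
  logSobolev : ∃ c > 0, LogSobolev ν c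
  centred : ∫ x, x ∂ν = 0
  variance_one : ∫ x, ‖x‖ ^ 2 ∂ν = 1
  re_im : (RCLike.I : 𝕜) ≠ 0 →
    IndepFun (fun x : 𝕜 ↦ RCLike.re x) (fun x : 𝕜 ↦ RCLike.im x) ν ∧
      IdentDistrib (fun x : 𝕜 ↦ RCLike.re x) (fun x : 𝕜 ↦ RCLike.im x) ν ν

open Classical in
/-- The fourth cumulant: `∫ x⁴ dν - 3` in the real case, `∫ |z|⁴ dν - 2` in the complex case. -/
def fourthCumulant (ν : Measure 𝕜) : ℝ :=
  ∫ x, ‖x‖ ^ 4 ∂ν - if (RCLike.I : 𝕜) = 0 then 3 else 2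

end Entries

/-! ### The two models for the perturbation -/

/-- The i.i.d. model and the orthonormalised model. -/
inductive Model
  | iid
  | orthonormalised

section Perturbation

variable {𝕜 : Type*} [RCLike 𝕜] {n r : ℕ}

/-- The column vectors `v_s = n^{-1/2} (g_{s,1}, …, g_{s,n})ᵀ`. -/
def rescaledVectors (g : Fin r → Fin n → 𝕜) (s : Fin r) : EuclideanSpace 𝕜 (Fin n) :=
  WithLp.toLp 2 fun i ↦ ((1 / √(n : ℝ) : ℝ) : 𝕜) * g s i

/-- The vectors `u_1, …, u_r`: either the `v_s` themselves, or the result of the Gram-Schmidt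
orthonormalisation of `(v_1, …, v_r)`.  (If the `v_s` are linearly dependent, an event whose
probability tends to `0`, the vectors that Gram-Schmidt does not define are `0`.) -/
def perturbationVectors (model : Model) (g : Fin r → Fin n → 𝕜) :
    Fin r → EuclideanSpace 𝕜 (Fin n) :=
  match model with
  | .iid => rescaledVectors g
  | .orthonormalised => InnerProductSpace.gramSchmidtNormed 𝕜 (rescaledVectors g)

/-- The perturbed matrix `X + ∑ₛ θₛ uₛ uₛ*`. -/
def perturbedMatrix (X : Matrix (Fin n) (Fin n) 𝕜) (θ : Fin r → ℝ)
    (u : Fin r → EuclideanSpace 𝕜 (Fin n)) : Matrix (Fin n) (Fin n) 𝕜 :=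
  X + ∑ s, (θ s : 𝕜) • Matrix.vecMulVec (u s).ofLp (star (u s).ofLp)

end Perturbation

/-! ### The outliers -/

section Outliers

variable {r : ℕ} (μ : Measure ℝ) (θ : Fin r → ℝ)

open Classical in
/-- `p₋`, the number of indices `i` with `ρ_{θ_i} < a`. -/
def numBelow : ℕ := (Finset.univ.filter fun i ↦ rho μ (θ i) < lowerEdge μ).card

open Classical in
/-- `p₊`, the number of indices `i` with `ρ_{θ_i} > b`. -/
def numAbove : ℕ := (Finset.univ.filter fun i ↦ upperEdge μ < rho μ (θ i)).card

open Classical in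
/-- The set `{α_1, …, α_q}` of the values of the `θ_i` such that `ρ_{θ_i} ∉ {a, b}`. -/
def outlierValues : Finset ℝ :=
  (Finset.univ.filter fun i ↦ rho μ (θ i) ≠ lowerEdge μ ∧ rho μ (θ i) ≠ upperEdge μ).image θ

/-- The number `q` of different values `α_j`. -/
def numValues : ℕ := (outlierValues μ θ).card

/-- The increasing enumeration `α_1 < ⋯ < α_q`. -/
def alpha (j : Fin (numValues μ θ)) : ℝ := (outlierValues μ θ).orderEmbOfFin rfl j

open Classical in
/-- The multiplicity `k_j`, the number of indices `i` with `θ_i = α_j`. -/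
def mult (j : Fin (numValues μ θ)) : ℕ := (Finset.univ.filter fun i ↦ θ i = alpha μ θ j).card

/-- `θ_{i+1}` for an index `i < r` given as a natural number (and `0` out of range). -/
def thetaAt (i : ℕ) : ℝ := if h : i < r then θ ⟨i, h⟩ else 0

/-- The rescaled difference `γ_{m+1}` between an outlier of the perturbed `n × n` matrix `A` and
its limit, for `0 ≤ m < p₋ + p₊`: it is `√n (λ_{m+1} - ρ_{θ_{m+1}})` for `m < p₋`, and otherwise
`√n (λ_{n-(p₋+p₊)+m+1} - ρ_{θ_{r-(p₋+p₊)+m+1}})`. -/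
def rescaledOutlier {𝕜 : Type*} [RCLike 𝕜] {n : ℕ} (A : Matrix (Fin n) (Fin n) 𝕜) (m : ℕ) : ℝ :=
  if m < numBelow μ θ then √(n : ℝ) * (eig A m - rho μ (thetaAt θ m))
  else √(n : ℝ) * (eig A (n - (numBelow μ θ + numAbove μ θ) + m) -
    rho μ (thetaAt θ (r - (numBelow μ θ + numAbove μ θ) + m)))

end Outliers

/-- The constant `c_α ≥ 0` of the limiting law. -/
def fluctuationConstant (model : Model) (μ : Measure ℝ) (α : ℝ) : ℝ :=
  match model with
  | .iid => √(1 / ∫ x, 1 / (rho μ α - x) ^ 2 ∂μ)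
  | .orthonormalised =>
      √((∫ x, 1 / (rho μ α - x) ^ 2 ∂μ - 1 / α ^ 2) / (∫ x, 1 / (rho μ α - x) ^ 2 ∂μ) ^ 2)

/-! ### The Gaussian orthogonal and unitary ensembles -/

section GaussianEnsembles

variable (𝕜 : Type*) [RCLike 𝕜]

open Classical in
/-- The Dyson index `β`: `1` in the real case and `2` in the complex case. -/
def dysonIndex : ℝ := if (RCLike.I : 𝕜) = 0 then 1 else 2

open Classical in
/-- The Hermitian matrix `[g_{ij}]` built from the real numbers `ξ_{ij}` as follows.
Real case (`β = 1`, `I = 0`): `g_{ii} / √2 = ξ_{ii}` and `g_{ij} = ξ_{ij}` for `i < j`.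
Complex case (`β = 2`, `I = i`): `g_{ii} = ξ_{ii}` and `√2 Re g_{ij} = ξ_{ij}`,
`√2 Im g_{ij} = ξ_{ji}` for `i < j`. -/
def gaussianMatrix {k : ℕ} (ξ : Fin k × Fin k → ℝ) : Matrix (Fin k) (Fin k) 𝕜 :=
  Matrix.of fun i j ↦
    if i = j then ((√(2 / dysonIndex 𝕜) * ξ (i, i) : ℝ) : 𝕜)
    else if i < j then
      ((1 / √(dysonIndex 𝕜) : ℝ) : 𝕜) * ((ξ (i, j) : 𝕜) + RCLike.I * (ξ (j, i) : 𝕜))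
    else
      ((1 / √(dysonIndex 𝕜) : ℝ) : 𝕜) * ((ξ (j, i) : 𝕜) - RCLike.I * (ξ (i, j) : 𝕜))

/-- The law `GOE(k)` when `𝕜 = ℝ` and `GUE(k)` when `𝕜 = ℂ`: the law of the above matrix when the
`ξ_{ij}` are independent standard Gaussian variables. -/
def gaussianEnsemble (k : ℕ) : Measure (Matrix (Fin k) (Fin k) 𝕜) :=
  (Measure.pi fun _ : Fin k × Fin k ↦ gaussianReal 0 1).map (gaussianMatrix 𝕜)

end GaussianEnsembles

/-! ### Hypotheses on the unperturbed matrices -/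

section Hypotheses

variable {𝕜 : Type*} [RCLike 𝕜]

/-- The limit `μ` has compact support, the spectral measures converge weakly to `μ`, and the
smallest and largest eigenvalues converge to the bounds `a` and `b` of the support of `μ`. -/
structure SpectralConvergence (X : (n : ℕ) → Matrix (Fin n) (Fin n) 𝕜) (μ : Measure ℝ) :
    Prop where
  compact_support : IsCompact μ.support
  tendsto_spectralMeasure : ∀ f : BoundedContinuousFunction ℝ ℝ,
    Tendsto (fun n ↦ ∫ x, f x ∂(spectralMeasure (X n))) atTop (𝓝 (∫ x, f x ∂μ))
  tendsto_smallest : Tendsto (fun n ↦ eig (X n) 0) atTop (𝓝 (lowerEdge μ))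
  tendsto_largest : Tendsto (fun n ↦ eig (X n) (n - 1)) atTop (𝓝 (upperEdge μ))

/-- `√n (G_{μ_n}(z) - G_μ(z)) → 0` at each `z ∈ {ρ_{α_1}, …, ρ_{α_q}}`. -/
def FastStieltjesConvergence {r : ℕ} (X : (n : ℕ) → Matrix (Fin n) (Fin n) 𝕜) (μ : Measure ℝ)
    (θ : Fin r → ℝ) : Prop :=
  ∀ j : Fin (numValues μ θ), Tendsto
    (fun n : ℕ ↦ √(n : ℝ) * (cauchyTransform (spectralMeasure (X n)) (rho μ (alpha μ θ j)) -
      cauchyTransform μ (rho μ (alpha μ θ j)))) atTop (𝓝 0)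

end Hypotheses

end FiniteRankDeformation

end

open MeasureTheory ProbabilityTheory Filter Topology

noncomputable section

namespace FiniteRankDeformation

/-! ### Inertia of Hermitian forms and Schur complements. -/

section Inertia

open Matrix Module

variable {𝕜 : Type*} [RCLike 𝕜] {ι ι' : Type*} [Fintype ι] [Fintype ι']

/-! The proof counts eigenvalues by inertia. The number of eigenvalues of `A` below `z` is the
positive index of inertia of `z - A` (`eig_lt_iff`), so an inequality between an outlier and the
level `z = ρ_α + x/√n` is a statement about `npos`. Let `U` have the perturbation vectors as columns
and let `Θ = diag(θ)`. The block matrix with diagonal blocks `z - X` and `Θ⁻¹` and off-diagonal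
block `U` has two Schur complements (`npos_schur`); comparing them gives, in `npos_perturbedMatrix`,
npos(z - X̃) + #{θ > 0} = npos(z - X) + npos(Θ⁻¹ - U*(z - X)⁻¹U). As `z` stays away from the
spectrum of `X`, npos(z - X) is `0` or `n`, and only an `r × r` matrix is left to study.

The deterministic part of U*(z - X)⁻¹U is close to `G_μ(ρ_α) = 1/α`. Hence the diagonal entries with
`θ_a ≠ α` remain near `1/θ_a - 1/α ≠ 0`, while the block `θ_a = α` has order `n^{-1/2}`. Multiply
the rows and the columns of this block by `n^{1/4}`. The fast convergence of the Stieltjes transform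
and a first-order expansion in `x/√n` (`tendsto_resolvent`) turn it into `x s - W`. Here `s = ∫ (ρ_α
- y)⁻² dμ(y)`, and `W` consists of the centred forms `n^{-1/2}(g_a* B g_b - δ_ab tr B)` with `B =
(ρ_α - X)⁻¹ - β`. The mixed blocks tend to zero. By stability of the inertia (`npos_block_bounds`),
the `i`-th outlier of the group is below `x` exactly when the `i`-th eigenvalue of `W/s` is, up to a
small margin and outside an event of small probability. Finitely many levels together with tightness
upgrade this to convergence in probability of the difference to zero
(`tendstoZero_rescaledOutlier_sub`).

In the i.i.d. model `β = 0`. For Gram–Schmidt write `V = U R` with `R` upper triangular: congruence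
by `R` replaces `U` by `V` and `Θ⁻¹` by `R*Θ⁻¹R`. Since `R` is close to `1` and `R*R = 1 + E`, the
correction inside the `α` block is `E/α` to first order (`exists_correction`). This is again a
quadratic form in the entries and amounts to `β = 1/α`, which explains the second formula for the
constant (`fluctuationConstant_eq`).

The joint central limit theorem for the matrices `W` (`tendstoInDistribution_bil`) is reduced by
Cramér–Wold to a single quadratic form `x*Ax - tr A` with small operator norm and convergent
Frobenius norm. Its characteristic function satisfies `φ' ≈ -t v φ`, by an expansion leaving out one
coordinate at a time (`norm_deriv_add_le`); this is integrated in `norm_charFun_quad_sub_le`. The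
vanishing fourth cumulant makes `v` a multiple of the squared Frobenius norm, with no separate
weight on the diagonal, and this is the variance of the Gaussian ensemble. The variances of the
groups add up without cross terms, which gives the independence of the `M_j`. -/

/-- The real part `Re (x* A x)` of the sesquilinear form of a matrix. -/
def hform (A : Matrix ι ι 𝕜) (x : ι → 𝕜) : ℝ := RCLike.re (star x ⬝ᵥ A *ᵥ x)

/-- The form of `A` is positive definite on the subspace `S`. -/
def IsPosOn (A : Matrix ι ι 𝕜) (S : Submodule 𝕜 (ι → 𝕜)) : Prop := ∀ x ∈ S, x ≠ 0 → 0 < hform A x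

/-- The positive index of inertia. -/
def npos (A : Matrix ι ι 𝕜) : ℕ := sSup {k | ∃ S : Submodule 𝕜 (ι → 𝕜), finrank 𝕜 S = k ∧ IsPosOn A S}

lemma bddAbove_posOn (A : Matrix ι ι 𝕜) :
    BddAbove {k | ∃ S : Submodule 𝕜 (ι → 𝕜), finrank 𝕜 S = k ∧ IsPosOn A S} := by
  refine ⟨finrank 𝕜 (ι → 𝕜), ?_⟩
  rintro k ⟨S, rfl, -⟩
  exact Submodule.finrank_le S

lemma IsPosOn.finrank_le_npos {A : Matrix ι ι 𝕜} {S : Submodule 𝕜 (ι → 𝕜)} (h : IsPosOn A S) :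
    finrank 𝕜 S ≤ npos A := le_csSup (bddAbove_posOn A) ⟨S, rfl, h⟩

lemma exists_isPosOn (A : Matrix ι ι 𝕜) :
    ∃ S : Submodule 𝕜 (ι → 𝕜), finrank 𝕜 S = npos A ∧ IsPosOn A S :=
  Nat.sSup_mem (s := {k | ∃ S : Submodule 𝕜 (ι → 𝕜), finrank 𝕜 S = k ∧ IsPosOn A S})
    ⟨0, ⊥, by simp, fun x hx h ↦ absurd ((Submodule.mem_bot 𝕜).1 hx) h⟩ (bddAbove_posOn A)

/-- Sylvester's argument: a subspace where the form is positive meets one where it is nonpositive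
only in `0`, so `T` limits the dimension of every competitor of `S`. -/
lemma npos_eq_finrank {A : Matrix ι ι 𝕜} {S T : Submodule 𝕜 (ι → 𝕜)} (hS : IsPosOn A S)
    (hT : ∀ x ∈ T, hform A x ≤ 0) (hST : Fintype.card ι ≤ finrank 𝕜 S + finrank 𝕜 T) :
    npos A = finrank 𝕜 S := by
  refine le_antisymm ?_ hS.finrank_le_npos
  obtain ⟨S', h1, h2⟩ := exists_isPosOn A
  have hd : S' ⊓ T = ⊥ := by
    rw [eq_bot_iff]
    rintro x ⟨hx, hx'⟩
    by_contra hne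
    exact absurd (h2 x hx (by simpa using hne)) (not_lt.2 (hT x hx'))
  have := Submodule.finrank_sup_add_finrank_inf_eq S' T
  have h3 := Submodule.finrank_le (S' ⊔ T)
  rw [hd] at this
  simp at this h3
  omega

/-- An injective map carries a maximal positive subspace to a positive subspace of the same
dimension. Monotonicity, congruence and reindexing are all special cases. -/
lemma npos_le_of_injective {A : Matrix ι ι 𝕜} {B : Matrix ι' ι' 𝕜}
    (f : (ι → 𝕜) →ₗ[𝕜] (ι' → 𝕜)) (hf : Function.Injective f)
    (h : ∀ x, hform A x ≤ hform B (f x)) : npos A ≤ npos B := by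
  obtain ⟨S, h1, h2⟩ := exists_isPosOn A
  have h3 : IsPosOn B (S.map f) := by
    rintro _ ⟨x, hx, rfl⟩ hne
    exact (h2 x hx (by rintro rfl; simp at hne)).trans_le (h x)
  have := h3.finrank_le_npos
  rwa [(Submodule.equivMapOfInjective f hf S).finrank_eq.symm, h1] at this

lemma npos_mono {A B : Matrix ι ι 𝕜} (h : ∀ x, hform A x ≤ hform B x) : npos A ≤ npos B :=
  npos_le_of_injective LinearMap.id Function.injective_id h

lemma npos_eq_of_equiv {A : Matrix ι ι 𝕜} {B : Matrix ι' ι' 𝕜}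
    (e : (ι → 𝕜) ≃ₗ[𝕜] (ι' → 𝕜)) (h : ∀ x, hform B (e x) = hform A x) : npos A = npos B :=
  le_antisymm (npos_le_of_injective e.toLinearMap e.injective fun x ↦ (h x).ge)
    (npos_le_of_injective e.symm.toLinearMap e.symm.injective fun x ↦ by
      rw [LinearEquiv.coe_coe, ← h]; simp)

lemma hform_conj (C : Matrix ι ι' 𝕜) (B : Matrix ι ι 𝕜) (x : ι' → 𝕜) :
    hform (Cᴴ * B * C) x = hform B (C *ᵥ x) := by
  simp only [hform, star_mulVec, ← mulVec_mulVec, ← dotProduct_mulVec]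

lemma npos_conj [DecidableEq ι] {C : Matrix ι ι 𝕜} (hC : IsUnit C) (B : Matrix ι ι 𝕜) :
    npos (Cᴴ * B * C) = npos B := by
  have hb : Function.Bijective C.mulVecLin := by
    have h := mulVec_injective_iff_isUnit.2 hC
    exact ⟨h, LinearMap.injective_iff_surjective.1 h⟩
  refine npos_eq_of_equiv (LinearEquiv.ofBijective C.mulVecLin hb) fun x ↦ ?_
  simp [hform_conj]

lemma npos_reindex (e : ι ≃ ι') (A : Matrix ι ι 𝕜) : npos (A.submatrix e.symm e.symm) = npos A := by
  refine (npos_eq_of_equiv (LinearEquiv.funCongrLeft 𝕜 𝕜 e.symm) fun x ↦ ?_).symm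
  simp only [hform, dotProduct, mulVec, submatrix_apply]
  congr 1
  refine Fintype.sum_equiv e.symm _ _ fun i ↦ ?_
  congr 1
  exact Fintype.sum_equiv e.symm _ _ fun j ↦ rfl

lemma hform_diagonal [DecidableEq ι] (d : ι → ℝ) (x : ι → 𝕜) :
    hform (diagonal fun i ↦ (d i : 𝕜)) x = ∑ i, d i * ‖x i‖ ^ 2 := by
  simp only [hform, dotProduct, mulVec_diagonal, map_sum, Pi.star_apply]
  refine Finset.sum_congr rfl fun i _ ↦ ?_
  rw [mul_left_comm, RCLike.star_def, RCLike.conj_mul, ← RCLike.ofReal_pow, ← RCLike.ofReal_mul,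
    RCLike.ofReal_re]

lemma finrank_extendByZero (p : ι → Prop) :
    finrank 𝕜 (LinearMap.range (Function.ExtendByZero.linearMap 𝕜 (Subtype.val : {i // p i} → ι)))
      = Nat.card {i // p i} := by
  classical
  rw [LinearMap.finrank_range_of_inj]
  · simp
  · intro x y h
    funext i
    have := congrFun h i.1
    simp only [Function.ExtendByZero.linearMap_apply] at this
    simpa only [Subtype.val_injective.extend_apply] using this

omit [Fintype ι] in
lemma mem_range_extendByZero {p : ι → Prop} {x : ι → 𝕜}
    (hx : x ∈ LinearMap.range (Function.ExtendByZero.linearMap 𝕜 (Subtype.val : {i // p i} → ι)))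
    {i : ι} (hi : ¬ p i) : x i = 0 := by
  obtain ⟨y, rfl⟩ := hx
  simp only [Function.ExtendByZero.linearMap_apply]
  rw [Function.extend_apply']
  · rfl
  · rintro ⟨a, rfl⟩
    exact hi a.2

/-- The coordinate subspaces of the indices with `0 < d i` and of the other indices form the
complementary pair needed in `npos_eq_finrank`. -/
lemma npos_diagonal [DecidableEq ι] (d : ι → ℝ) :
    npos (diagonal fun i ↦ (d i : 𝕜)) = (Finset.univ.filter fun i ↦ 0 < d i).card := by
  classical
  rw [npos_eq_finrank
    (S := LinearMap.range (Function.ExtendByZero.linearMap 𝕜 (Subtype.val : {i // 0 < d i} → ι)))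
    (T := LinearMap.range (Function.ExtendByZero.linearMap 𝕜 (Subtype.val : {i // ¬ 0 < d i} → ι)))]
  · rw [finrank_extendByZero, Nat.card_eq_fintype_card, Fintype.card_subtype]
  · intro x hx hne
    rw [hform_diagonal]
    obtain ⟨i, hi⟩ := Function.ne_iff.1 hne
    have hdi : 0 < d i := by
      by_contra h
      exact hi (mem_range_extendByZero hx h)
    refine Finset.sum_pos' (fun j _ ↦ ?_) ⟨i, Finset.mem_univ _, ?_⟩
    · by_cases hj : 0 < d j
      · positivity
      · simp [mem_range_extendByZero hx hj]
    · have : 0 < ‖x i‖ := norm_pos_iff.2 hi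
      positivity
  · intro x hx
    rw [hform_diagonal]
    refine Finset.sum_nonpos fun j _ ↦ ?_
    by_cases hj : 0 < d j
    · simp [mem_range_extendByZero hx (not_not.2 hj)]
    · exact mul_nonpos_of_nonpos_of_nonneg (not_lt.1 hj) (by positivity)
  · rw [finrank_extendByZero, finrank_extendByZero, Nat.card_eq_fintype_card,
      Nat.card_eq_fintype_card, Fintype.card_subtype_compl]
    omega

/-- The function `f` applied to the Hermitian matrix `A` by functional calculus. -/
def specFun [DecidableEq ι] {A : Matrix ι ι 𝕜} (hA : A.IsHermitian) (f : ℝ → ℝ) : Matrix ι ι 𝕜 :=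
  (hA.eigenvectorUnitary : Matrix ι ι 𝕜) * diagonal (fun i ↦ ((f (hA.eigenvalues i) : ℝ) : 𝕜)) *
    (hA.eigenvectorUnitary : Matrix ι ι 𝕜)ᴴ

section SpecFun

variable [DecidableEq ι] {A : Matrix ι ι 𝕜} (hA : A.IsHermitian)

lemma unitary_conjTranspose_mul :
    (hA.eigenvectorUnitary : Matrix ι ι 𝕜)ᴴ * (hA.eigenvectorUnitary : Matrix ι ι 𝕜) = 1 := by
  rw [← star_eq_conjTranspose]; exact Unitary.coe_star_mul_self _

lemma unitary_mul_conjTranspose :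
    (hA.eigenvectorUnitary : Matrix ι ι 𝕜) * (hA.eigenvectorUnitary : Matrix ι ι 𝕜)ᴴ = 1 := by
  rw [← star_eq_conjTranspose]; exact Unitary.coe_mul_star_self _

lemma specFun_id : specFun hA (fun x ↦ x) = A := by
  conv_rhs => rw [hA.spectral_theorem, Unitary.conjStarAlgAut_apply]
  rfl

lemma specFun_mul (f g : ℝ → ℝ) :
    specFun hA f * specFun hA g = specFun hA fun x ↦ f x * g x := by
  simp only [specFun]
  rw [show ∀ U D V D' : Matrix ι ι 𝕜, U * D * V * (U * D' * V) = U * D * (V * U) * D' * V by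
    intros; simp only [Matrix.mul_assoc], unitary_conjTranspose_mul]
  simp [Matrix.mul_assoc]

lemma specFun_const (c : ℝ) : specFun hA (fun _ ↦ c) = (c : 𝕜) • 1 := by
  simp only [specFun]
  rw [show (diagonal fun _ : ι ↦ (c : 𝕜)) = (c : 𝕜) • 1 by rw [smul_one_eq_diagonal]]
  simp [unitary_mul_conjTranspose]

lemma specFun_sub (f g : ℝ → ℝ) :
    specFun hA (fun x ↦ f x - g x) = specFun hA f - specFun hA g := by
  simp only [specFun, ← Matrix.sub_mul, ← Matrix.mul_sub, diagonal_sub]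
  simp

lemma specFun_isHermitian (f : ℝ → ℝ) : (specFun hA f).IsHermitian := by
  rw [IsHermitian, specFun, conjTranspose_mul, conjTranspose_mul, conjTranspose_conjTranspose,
    diagonal_conjTranspose, Matrix.mul_assoc]
  congr 3
  ext i
  simp

lemma specFun_congr {f g : ℝ → ℝ} (h : ∀ i, f (hA.eigenvalues i) = g (hA.eigenvalues i)) :
    specFun hA f = specFun hA g := by simp only [specFun, h]

lemma npos_specFun (f : ℝ → ℝ) :
    npos (specFun hA f) = (Finset.univ.filter fun i ↦ 0 < f (hA.eigenvalues i)).card := by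
  have h := npos_conj (C := (hA.eigenvectorUnitary : Matrix ι ι 𝕜)ᴴ)
    (IsUnit.of_mul_eq_one _ (unitary_conjTranspose_mul hA))
    (diagonal (fun i ↦ ((f (hA.eigenvalues i) : ℝ) : 𝕜)))
  rw [conjTranspose_conjTranspose] at h
  rw [specFun, h, npos_diagonal]

lemma trace_specFun (f : ℝ → ℝ) :
    (specFun hA f).trace = ((∑ i, f (hA.eigenvalues i) : ℝ) : 𝕜) := by
  rw [specFun, trace_mul_comm, ← Matrix.mul_assoc, unitary_conjTranspose_mul, Matrix.one_mul,
    trace_diagonal]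
  simp

/-- For a Hermitian matrix the squared Frobenius norm is the trace of the square. This turns
variances of quadratic forms into linear statistics of the spectrum. -/
lemma sum_norm_sq_specFun (f : ℝ → ℝ) :
    ∑ i, ∑ j, ‖specFun hA f i j‖ ^ 2 = ∑ i, f (hA.eigenvalues i) ^ 2 := by
  have h := trace_specFun hA fun x ↦ f x * f x
  rw [← specFun_mul] at h
  have h2 : (specFun hA f * specFun hA f).trace =
      ((∑ i, ∑ j, ‖specFun hA f i j‖ ^ 2 : ℝ) : 𝕜) := by
    simp only [trace, diag_apply, mul_apply]
    push_cast
    refine Finset.sum_congr rfl fun i _ ↦ Finset.sum_congr rfl fun j _ ↦ ?_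
    rw [← RCLike.mul_conj]
    congr 1
    exact ((specFun_isHermitian hA f).apply j i).symm
  rw [h2] at h
  simpa [sq] using RCLike.ofReal_injective h

lemma sum_norm_sq_mulVec_unitary (x : ι → 𝕜) {U : Matrix ι ι 𝕜} (hU : Uᴴ * U = 1) :
    ∑ i, ‖(U *ᵥ x) i‖ ^ 2 = ∑ i, ‖x i‖ ^ 2 := by
  have h1 := hform_conj U 1 x
  rw [Matrix.mul_one, hU] at h1
  have h := fun y : ι → 𝕜 ↦ hform_diagonal (fun _ ↦ 1) y
  simp only [RCLike.ofReal_one, diagonal_one, one_mul] at h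
  rw [h, h] at h1
  exact h1.symm

lemma sum_norm_sq_specFun_mulVec_le {f : ℝ → ℝ} {C : ℝ} (hf : ∀ i, |f (hA.eigenvalues i)| ≤ C)
    (x : ι → 𝕜) : ∑ i, ‖(specFun hA f *ᵥ x) i‖ ^ 2 ≤ C ^ 2 * ∑ i, ‖x i‖ ^ 2 := by
  rw [specFun, ← mulVec_mulVec, ← mulVec_mulVec,
    sum_norm_sq_mulVec_unitary _ (unitary_conjTranspose_mul hA),
    ← sum_norm_sq_mulVec_unitary x (U := (hA.eigenvectorUnitary : Matrix ι ι 𝕜)ᴴ)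
      (by rw [conjTranspose_conjTranspose]; exact unitary_mul_conjTranspose hA), Finset.mul_sum]
  refine Finset.sum_le_sum fun i _ ↦ ?_
  rw [mulVec_diagonal, norm_mul, mul_pow, RCLike.norm_ofReal]
  gcongr
  exact hf i

end SpecFun

lemma npos_eq_card [DecidableEq ι] {A : Matrix ι ι 𝕜} (hA : A.IsHermitian) :
    npos A = (Finset.univ.filter fun i ↦ 0 < hA.eigenvalues i).card := by
  have := npos_specFun hA fun x ↦ x
  rwa [specFun_id] at this

/-- This is the eigenvalue counting function; the statements on ordered eigenvalues are read off
from it. -/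
lemma npos_smul_one_sub [DecidableEq ι] {A : Matrix ι ι 𝕜} (hA : A.IsHermitian) (z : ℝ) :
    npos ((z : 𝕜) • 1 - A) = (Finset.univ.filter fun i ↦ hA.eigenvalues i < z).card := by
  have := npos_specFun hA fun x ↦ z - x
  rw [specFun_sub, specFun_const, specFun_id] at this
  simpa using this

/-- A block diagonal unitary diagonalises both blocks at once, so the positive entries of the two
diagonals are counted together. -/
lemma npos_fromBlocks {A : Matrix ι ι 𝕜} {B : Matrix ι' ι' 𝕜} (hA : A.IsHermitian)
    (hB : B.IsHermitian) : npos (fromBlocks A 0 0 B) = npos A + npos B := by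
  classical
  have h1 := specFun_id hA
  have h2 := specFun_id hB
  have h := npos_conj
    (C := (fromBlocks (hA.eigenvectorUnitary : Matrix ι ι 𝕜) 0 0
      (hB.eigenvectorUnitary : Matrix ι' ι' 𝕜))ᴴ)
    (IsUnit.of_mul_eq_one (fromBlocks (hA.eigenvectorUnitary : Matrix ι ι 𝕜) 0 0
      (hB.eigenvectorUnitary : Matrix ι' ι' 𝕜)) (by
        simp [fromBlocks_conjTranspose, fromBlocks_multiply, unitary_conjTranspose_mul]))
    (diagonal fun i ↦ ((Sum.elim hA.eigenvalues hB.eigenvalues i : ℝ) : 𝕜))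
  rw [npos_diagonal, conjTranspose_conjTranspose] at h
  have h3 : (diagonal fun i ↦ ((Sum.elim hA.eigenvalues hB.eigenvalues i : ℝ) : 𝕜)) =
      fromBlocks (diagonal fun i ↦ ((hA.eigenvalues i : ℝ) : 𝕜)) 0 0
        (diagonal fun i ↦ ((hB.eigenvalues i : ℝ) : 𝕜)) := by
    rw [fromBlocks_diagonal]
    congr 1
    ext i
    cases i <;> rfl
  rw [h3] at h
  simp only [fromBlocks_conjTranspose, fromBlocks_multiply, conjTranspose_zero, Matrix.zero_mul,
    Matrix.mul_zero, add_zero, zero_add] at h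
  rw [specFun] at h1 h2
  rw [h1, h2] at h
  rw [h, npos_eq_card hA, npos_eq_card hB, ← Fintype.card_subtype, ← Fintype.card_subtype,
    ← Fintype.card_subtype, ← Fintype.card_sum]
  exact Fintype.card_congr Equiv.subtypeSum

/-- Both Schur complements of a Hermitian block matrix give its inertia. -/
lemma npos_schur [DecidableEq ι] [DecidableEq ι'] {P : Matrix ι ι 𝕜} {T : Matrix ι' ι' 𝕜}
    (hP : P.IsHermitian) (hT : T.IsHermitian) {P' : Matrix ι ι 𝕜} {T' : Matrix ι' ι' 𝕜}
    (hPP' : P * P' = 1) (hTT' : T * T' = 1) (U : Matrix ι ι' 𝕜) :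
    npos P + npos (T - Uᴴ * P' * U) = npos T + npos (P - U * T' * Uᴴ) := by
  have hP'P := mul_eq_one_comm.1 hPP'
  have hT'T := mul_eq_one_comm.1 hTT'
  have hP' : P'ᴴ = P' := by
    have : P'ᴴ * P = 1 := by
      have := congrArg conjTranspose hPP'
      rwa [conjTranspose_mul, hP.eq, conjTranspose_one] at this
    calc P'ᴴ = P'ᴴ * (P * P') := by rw [hPP', Matrix.mul_one]
      _ = P' := by rw [← Matrix.mul_assoc, this, Matrix.one_mul]
  have hT' : T'ᴴ = T' := by
    have : T'ᴴ * T = 1 := by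
      have := congrArg conjTranspose hTT'
      rwa [conjTranspose_mul, hT.eq, conjTranspose_one] at this
    calc T'ᴴ = T'ᴴ * (T * T') := by rw [hTT', Matrix.mul_one]
      _ = T' := by rw [← Matrix.mul_assoc, this, Matrix.one_mul]
  -- One block matrix is reduced by two unitriangular congruences, eliminating through `P` here and
  -- through `T` in `e2`. Equating the two inertias is the claim.
  have e1 : fromBlocks P U Uᴴ T =
      (fromBlocks 1 (P' * U) 0 1)ᴴ * fromBlocks P 0 0 (T - Uᴴ * P' * U) *
        fromBlocks 1 (P' * U) 0 1 := by
    simp only [fromBlocks_conjTranspose, fromBlocks_multiply, conjTranspose_zero, Matrix.zero_mul,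
      Matrix.mul_zero, add_zero, zero_add, conjTranspose_one, Matrix.one_mul, Matrix.mul_one,
      conjTranspose_mul, hP', ← Matrix.mul_assoc, hPP']
    simp [Matrix.mul_assoc, hP'P]
  have e2 : fromBlocks P U Uᴴ T =
      (fromBlocks 1 0 (T' * Uᴴ) 1)ᴴ * fromBlocks (P - U * T' * Uᴴ) 0 0 T *
        fromBlocks 1 0 (T' * Uᴴ) 1 := by
    simp only [fromBlocks_conjTranspose, fromBlocks_multiply, conjTranspose_zero, Matrix.zero_mul,
      Matrix.mul_zero, add_zero, zero_add, conjTranspose_one, Matrix.one_mul, Matrix.mul_one,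
      conjTranspose_mul, hT', ← Matrix.mul_assoc, hTT', conjTranspose_conjTranspose]
    simp [Matrix.mul_assoc, hT'T]
  have u1 : IsUnit (fromBlocks (1 : Matrix ι ι 𝕜) (P' * U) 0 (1 : Matrix ι' ι' 𝕜)) := by
    rw [isUnit_fromBlocks_zero₂₁]; simp
  have u2 : IsUnit (fromBlocks (1 : Matrix ι ι 𝕜) 0 (T' * Uᴴ) (1 : Matrix ι' ι' 𝕜)) := by
    rw [isUnit_fromBlocks_zero₁₂]; simp
  have h1 := npos_conj u1 (fromBlocks P 0 0 (T - Uᴴ * P' * U))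
  have h2 := npos_conj u2 (fromBlocks (P - U * T' * Uᴴ) 0 0 T)
  rw [← e1] at h1
  rw [← e2] at h2
  rw [h1, npos_fromBlocks hP, npos_fromBlocks _ hT] at h2
  · rw [h2, add_comm]
  · refine hP.sub ?_
    rw [IsHermitian]
    simp [conjTranspose_mul, hT', Matrix.mul_assoc]
  · refine hT.sub ?_
    rw [IsHermitian]
    simp [conjTranspose_mul, hP', Matrix.mul_assoc]

end Inertia

/-! ### Ordered eigenvalues as jumps of the counting function. -/

section EigenvaluesOrder

open Matrix Module

variable {𝕜 : Type*} [RCLike 𝕜] {ι : Type*} [Fintype ι]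

lemma eig_eq [DecidableEq ι] {A : Matrix ι ι 𝕜} (hA : A.IsHermitian) {i : ℕ}
    (hi : i < Fintype.card ι) : eig A i = hA.eigenvalues₀ ⟨Fintype.card ι - 1 - i, by omega⟩ := by
  have : ‹DecidableEq ι› = fun a b ↦ Classical.propDecidable _ := Subsingleton.elim _ _
  subst this
  rw [eig, dif_pos ⟨hA, hi⟩]

/-- The eigenvalues below `z` form a final segment of the decreasing enumeration, and the inertia is
the length of this segment. -/
lemma eig_lt_iff [DecidableEq ι] {A : Matrix ι ι 𝕜} (hA : A.IsHermitian) {i : ℕ}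
    (hi : i < Fintype.card ι) (z : ℝ) : eig A i < z ↔ i < npos ((z : 𝕜) • 1 - A) := by
  have hc : (Finset.univ.filter fun j ↦ hA.eigenvalues j < z).card =
      (Finset.univ.filter fun l ↦ hA.eigenvalues₀ l < z).card := by
    rw [← Fintype.card_subtype, ← Fintype.card_subtype]
    exact Fintype.card_congr ((Fintype.equivOfCardEq (Fintype.card_fin _)).symm.subtypeEquiv
      fun _ ↦ Iff.rfl)
  rw [npos_smul_one_sub hA, eig_eq hA hi, hc]
  constructor
  · intro h
    have : Finset.Ici (⟨Fintype.card ι - 1 - i, by omega⟩ : Fin (Fintype.card ι)) ⊆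
        Finset.univ.filter fun l ↦ hA.eigenvalues₀ l < z := fun l hl ↦ by
      simp only [Finset.mem_filter, Finset.mem_univ, true_and]
      exact (hA.eigenvalues₀_antitone (Finset.mem_Ici.1 hl)).trans_lt h
    have := Finset.card_le_card this
    rw [Fin.card_Ici] at this
    simp only at this
    omega
  · intro h
    by_contra h'
    have : (Finset.univ.filter fun l ↦ hA.eigenvalues₀ l < z) ⊆
        Finset.Ioi (⟨Fintype.card ι - 1 - i, by omega⟩ : Fin (Fintype.card ι)) := fun l hl ↦ by
      simp only [Finset.mem_filter, Finset.mem_univ, true_and] at hl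
      rw [Finset.mem_Ioi]
      by_contra h''
      exact h' ((hA.eigenvalues₀_antitone (not_lt.1 h'')).trans_lt hl)
    have := Finset.card_le_card this
    rw [Fin.card_Ioi] at this
    simp only at this
    omega

lemma eigenvalues_eq_eig [DecidableEq ι] {A : Matrix ι ι 𝕜} (hA : A.IsHermitian) (j : ι) :
    ∃ i < Fintype.card ι, hA.eigenvalues j = eig A i := by
  refine ⟨Fintype.card ι - 1 - ((Fintype.equivOfCardEq (Fintype.card_fin _)).symm j :
    Fin (Fintype.card ι)), ?_, ?_⟩
  · have := ((Fintype.equivOfCardEq (Fintype.card_fin _)).symm j : Fin (Fintype.card ι)).2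
    omega
  · have := ((Fintype.equivOfCardEq (Fintype.card_fin _)).symm j : Fin (Fintype.card ι)).2
    rw [eig_eq hA (by omega), IsHermitian.eigenvalues]
    congr 1
    ext
    simp only
    omega

lemma eig_mono {A : Matrix ι ι 𝕜} (hA : A.IsHermitian) {i j : ℕ} (hij : i ≤ j)
    (hj : j < Fintype.card ι) : eig A i ≤ eig A j := by
  classical
  rw [eig_eq hA hj, eig_eq hA (hij.trans_lt hj)]
  exact hA.eigenvalues₀_antitone (by simp only [Fin.mk_le_mk]; omega)

lemma eig_zero_le_eigenvalues [DecidableEq ι] {A : Matrix ι ι 𝕜} (hA : A.IsHermitian) (j : ι) :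
    eig A 0 ≤ hA.eigenvalues j := by
  obtain ⟨i, hi, h⟩ := eigenvalues_eq_eig hA j
  rw [h]
  exact eig_mono hA (Nat.zero_le _) hi

lemma eigenvalues_le_eig_last [DecidableEq ι] {A : Matrix ι ι 𝕜} (hA : A.IsHermitian) (j : ι) :
    hA.eigenvalues j ≤ eig A (Fintype.card ι - 1) := by
  obtain ⟨i, hi, h⟩ := eigenvalues_eq_eig hA j
  rw [h]
  exact eig_mono hA (by omega) (by omega)

lemma sum_eig {n : ℕ} {A : Matrix (Fin n) (Fin n) 𝕜} (hA : A.IsHermitian) (φ : ℝ → ℝ) :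
    ∑ l ∈ Finset.range n, φ (eig A l) = ∑ i, φ (hA.eigenvalues i) := by
  have h1 : ∑ i, φ (hA.eigenvalues i) = ∑ l, φ (hA.eigenvalues₀ l) :=
    Fintype.sum_equiv (Fintype.equivOfCardEq (Fintype.card_fin _)).symm _ _ fun _ ↦ rfl
  rw [h1, Finset.sum_range, ← Equiv.sum_comp Fin.revPerm]
  refine Fintype.sum_equiv (finCongr (by simp)) _ _ fun i ↦ ?_
  have := i.2
  rw [eig_eq hA (by simpa using lt_of_le_of_lt (Nat.zero_le _) this)]
  congr 2
  ext
  simp [Fin.revPerm]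
  omega

/-- A crude bound on the operator norm; quantitatively it is only needed for matrices of fixed size.
-/
lemma abs_hform_le (A : Matrix ι ι 𝕜) (x : ι → 𝕜) :
    |hform A x| ≤ (∑ i, ∑ j, ‖A i j‖) * ∑ i, ‖x i‖ ^ 2 := by
  have hx (i : ι) : ‖x i‖ ^ 2 ≤ ∑ i, ‖x i‖ ^ 2 :=
    Finset.single_le_sum (f := fun i ↦ ‖x i‖ ^ 2) (fun _ _ ↦ by positivity) (Finset.mem_univ i)
  calc |hform A x| ≤ ‖star x ⬝ᵥ A *ᵥ x‖ := RCLike.abs_re_le_norm _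
    _ = ‖∑ i, ∑ j, star (x i) * (A i j * x j)‖ := by
      simp only [dotProduct, mulVec, Finset.mul_sum, Pi.star_apply]
    _ ≤ ∑ i, ∑ j, ‖A i j‖ * ∑ i, ‖x i‖ ^ 2 := by
      refine (norm_sum_le _ _).trans (Finset.sum_le_sum fun i _ ↦ (norm_sum_le _ _).trans
        (Finset.sum_le_sum fun j _ ↦ ?_))
      rw [norm_mul, norm_mul, norm_star]
      have : ‖x i‖ * ‖x j‖ ≤ ∑ i, ‖x i‖ ^ 2 := by
        nlinarith [hx i, hx j, sq_nonneg (‖x i‖ - ‖x j‖)]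
      calc ‖x i‖ * (‖A i j‖ * ‖x j‖) = ‖A i j‖ * (‖x i‖ * ‖x j‖) := by ring
        _ ≤ _ := by gcongr
    _ = _ := by simp only [Finset.sum_mul]

lemma hform_sub (A B : Matrix ι ι 𝕜) (x : ι → 𝕜) : hform (A - B) x = hform A x - hform B x := by
  simp [hform, sub_mulVec, dotProduct_sub]

lemma hform_smul (c : ℝ) (A : Matrix ι ι 𝕜) (x : ι → 𝕜) :
    hform ((c : 𝕜) • A) x = c * hform A x := by
  rw [hform, smul_mulVec, dotProduct_smul, smul_eq_mul, RCLike.re_ofReal_mul, hform]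

lemma hform_one [DecidableEq ι] (x : ι → 𝕜) : hform 1 x = ∑ i, ‖x i‖ ^ 2 := by
  have := hform_diagonal (fun _ ↦ 1) x
  simpa using this

lemma npos_smul {c : ℝ} (hc : 0 < c) (A : Matrix ι ι 𝕜) : npos ((c : 𝕜) • A) = npos A := by
  have key : ∀ {A : Matrix ι ι 𝕜} {c : ℝ}, 0 < c → npos A ≤ npos ((c : 𝕜) • A) := by
    intro A c hc
    obtain ⟨S, h1, h2⟩ := exists_isPosOn A
    rw [← h1]
    refine IsPosOn.finrank_le_npos fun x hx hne ↦ ?_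
    rw [hform_smul]
    exact mul_pos hc (h2 x hx hne)
  refine le_antisymm ?_ (key hc)
  have := key (A := (c : 𝕜) • A) (inv_pos.2 hc)
  rwa [smul_smul, ← RCLike.ofReal_mul, inv_mul_cancel₀ hc.ne', RCLike.ofReal_one, one_smul] at this

/-- Weyl's inequality by counting: the inequality between the forms shifts the level by `δ`. -/
lemma eig_le_eig_add {A B : Matrix ι ι 𝕜} (hA : A.IsHermitian) (hB : B.IsHermitian) {δ : ℝ}
    (h : ∀ x, hform A x ≤ hform B x + δ * ∑ i, ‖x i‖ ^ 2) {i : ℕ} (hi : i < Fintype.card ι) :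
    eig A i ≤ eig B i + δ := by
  classical
  refine le_of_forall_gt fun z hz ↦ ?_
  have h1 : eig B i < z - δ := by linarith
  rw [eig_lt_iff hB hi] at h1
  rw [eig_lt_iff hA hi]
  refine h1.trans_le (npos_mono fun x ↦ ?_)
  rw [hform_sub, hform_sub, hform_smul, hform_smul, hform_one]
  linarith [h x]

/-- The Hermitian part `(M + M*) / 2`. -/
def hermPart (M : Matrix ι ι 𝕜) : Matrix ι ι 𝕜 := ((1 / 2 : ℝ) : 𝕜) • (M + Mᴴ)

omit [Fintype ι] in
lemma hermPart_isHermitian (M : Matrix ι ι 𝕜) : (hermPart M).IsHermitian := by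
  rw [IsHermitian, hermPart, conjTranspose_smul, conjTranspose_add, conjTranspose_conjTranspose,
    add_comm, RCLike.star_def, RCLike.conj_ofReal]

omit [Fintype ι] in
lemma hermPart_of_isHermitian {M : Matrix ι ι 𝕜} (h : M.IsHermitian) : hermPart M = M := by
  rw [hermPart, h.eq, ← two_smul 𝕜, smul_smul]
  have : ((1 / 2 : ℝ) : 𝕜) * 2 = 1 := by
    rw [RCLike.ofReal_div, RCLike.ofReal_one, RCLike.ofReal_ofNat]
    norm_num
  rw [this, one_smul]

lemma abs_eig_sub_le {A B : Matrix ι ι 𝕜} (hA : A.IsHermitian) (hB : B.IsHermitian) (i : ℕ) :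
    |eig A i - eig B i| ≤ ∑ k, ∑ l, ‖(A - B) k l‖ := by
  by_cases hi : i < Fintype.card ι
  · rw [abs_sub_le_iff]
    constructor
    · rw [sub_le_iff_le_add']
      refine eig_le_eig_add hA hB (fun x ↦ ?_) hi
      have := (abs_le.1 (abs_hform_le (A - B) x)).2
      rw [hform_sub] at this
      linarith
    · rw [sub_le_iff_le_add']
      refine eig_le_eig_add hB hA (fun x ↦ ?_) hi
      have := (abs_le.1 (abs_hform_le (A - B) x)).1
      rw [hform_sub] at this
      linarith
  · rw [eig, eig, dif_neg (fun h ↦ hi h.2), dif_neg (fun h ↦ hi h.2)]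
    simp only [sub_self, abs_zero]
    positivity

/-- `eig` has a default value off the Hermitian matrices and need not be continuous on the whole
matrix space. Composition with the Hermitian part gives a globally continuous function, to which
continuous mapping and measurability arguments apply. -/
lemma continuous_eig_hermPart (i : ℕ) : Continuous fun M : Matrix ι ι 𝕜 ↦ eig (hermPart M) i := by
  rw [continuous_iff_continuousAt]
  intro B
  have hc : Continuous fun M : Matrix ι ι 𝕜 ↦ ∑ k, ∑ l, ‖(hermPart M - hermPart B) k l‖ := by
    unfold hermPart
    fun_prop
  have h0 := hc.tendsto B
  simp only [sub_self, Matrix.zero_apply, norm_zero, Finset.sum_const_zero] at h0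
  rw [ContinuousAt, tendsto_iff_dist_tendsto_zero]
  exact squeeze_zero (fun _ ↦ dist_nonneg)
    (fun M ↦ abs_eig_sub_le (hermPart_isHermitian M) (hermPart_isHermitian B) i) h0

instance instBorelSpaceMatrix {m n : Type*} [Finite m] [Finite n] :
    BorelSpace (Matrix m n 𝕜) := inferInstanceAs (BorelSpace (m → n → 𝕜))

lemma measurable_eig_hermPart (i : ℕ) : Measurable fun M : Matrix ι ι 𝕜 ↦ eig (hermPart M) i :=
  (continuous_eig_hermPart i).measurable

end EigenvaluesOrder

/-! ### Centred quadratic forms in independent variables and their moments. -/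

section QuadraticForms

open Matrix

variable {𝕜 : Type*} [RCLike 𝕜]

instance instHolderTripleFourFourTwo : ENNReal.HolderTriple 4 4 2 where
  inv_add_inv_eq_inv := by
    rw [← ENNReal.toReal_eq_toReal_iff' (by simp) (by simp), ENNReal.toReal_add (by simp) (by simp)]
    simp only [ENNReal.toReal_inv, ENNReal.toReal_ofNat]
    norm_num

/-- The first four moments of a law on `𝕜` agree with those of a standard Gaussian law: `κ` is `2`
in the real case and `1` in the complex case. -/
structure GaussianMoments (ν : Measure 𝕜) (κ : ℝ) : Prop where
  memLp_four : MemLp (fun x : 𝕜 ↦ x) 4 ν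
  mean : ∫ x, x ∂ν = 0
  variance : ∫ x, ‖x‖ ^ 2 ∂ν = 1
  fourth : ∫ x, ‖x‖ ^ 4 ∂ν = 1 + κ
  proj : ∀ y : 𝕜, ∫ x, (RCLike.re (star x * y)) ^ 2 ∂ν = κ / 2 * ‖y‖ ^ 2

lemma MemLp.sq_norm_of_four {α : Type*} [MeasurableSpace α] {μ : Measure α} {f : α → 𝕜}
    (hf : MemLp f 4 μ) : MemLp (fun x ↦ ‖f x‖ ^ 2) 2 μ := by
  have := hf.norm.mul (r := 2) hf.norm
  refine this.congr_norm (by have := hf.1; fun_prop) (ae_of_all _ fun x ↦ ?_)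
  simp [sq]

lemma MemLp.star_mul_of_four {α : Type*} [MeasurableSpace α] {μ : Measure α} {f g : α → 𝕜}
    (hf : MemLp f 4 μ) (hg : MemLp g 4 μ) : MemLp (fun x ↦ star (f x) * g x) 2 μ :=
  hg.mul (r := 2) hf.star

lemma integral_add_add {α : Type*} [MeasurableSpace α] {μ : Measure α} {f g k : α → ℝ}
    (hf : Integrable f μ) (hg : Integrable g μ) (hk : Integrable k μ) :
    ∫ x, (f x + g x + k x) ∂μ = ∫ x, f x ∂μ + ∫ x, g x ∂μ + ∫ x, k x ∂μ := by
  have h : Integrable (fun x ↦ f x + g x) μ := hf.add hg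
  rw [integral_add h hk, integral_add hf hg]

section OneVariable

variable {ν : Measure 𝕜} [IsProbabilityMeasure ν] {κ : ℝ}

lemma GaussianMoments.memLp_sub_one (h : GaussianMoments ν κ) :
    MemLp (fun x : 𝕜 ↦ ‖x‖ ^ 2 - 1) 2 ν := (MemLp.sq_norm_of_four h.memLp_four).sub (memLp_const 1)

lemma GaussianMoments.memLp_mul (h : GaussianMoments ν κ) (Y : 𝕜) :
    MemLp (fun x : 𝕜 ↦ star x * Y) 2 ν := MemLp.star_mul_of_four h.memLp_four (memLp_const Y)

lemma GaussianMoments.integral_sub_one (h : GaussianMoments ν κ) : ∫ x : 𝕜, (‖x‖ ^ 2 - 1) ∂ν = 0 := by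
  rw [integral_sub ((MemLp.sq_norm_of_four h.memLp_four).integrable one_le_two)
    (integrable_const _), h.variance]
  simp

lemma GaussianMoments.integral_sub_one_sq (h : GaussianMoments ν κ) :
    ∫ x : 𝕜, (‖x‖ ^ 2 - 1) ^ 2 ∂ν = κ := by
  have h2 := MemLp.sq_norm_of_four h.memLp_four
  have h4 : Integrable (fun x : 𝕜 ↦ ‖x‖ ^ 4) ν := by
    have := h2.integrable_sq
    simpa [← pow_mul] using this
  have : ∀ x : 𝕜, (‖x‖ ^ 2 - 1) ^ 2 = ‖x‖ ^ 4 + (-2) * ‖x‖ ^ 2 + 1 := fun x ↦ by ring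
  simp only [this]
  rw [integral_add_add h4 ((h2.integrable one_le_two).const_mul _) (integrable_const _),
    integral_const_mul, h.variance, h.fourth]
  simp
  ring

lemma GaussianMoments.nonneg (h : GaussianMoments ν κ) : 0 ≤ κ := by
  rw [← h.integral_sub_one_sq]
  positivity

/-- A third moment of `ν`. -/
def skewness (ν : Measure 𝕜) : 𝕜 := ∫ x, ((‖x‖ ^ 2 - 1 : ℝ) : 𝕜) * star x ∂ν

omit [IsProbabilityMeasure ν] in
lemma GaussianMoments.integral_star (h : GaussianMoments ν κ) : ∫ x : 𝕜, star x ∂ν = 0 := by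
  have := integral_conj (μ := ν) (f := fun x : 𝕜 ↦ x)
  rw [h.mean, map_zero] at this
  exact this

lemma GaussianMoments.integral_half (h : GaussianMoments ν κ) (a : ℝ) (Y : 𝕜) :
    ∫ y : 𝕜, (a * (‖y‖ ^ 2 - 1) + RCLike.re (star y * Y)) ∂ν = 0 := by
  have h1 := (h.memLp_mul Y).integrable one_le_two
  rw [integral_add ((h.memLp_sub_one.integrable one_le_two).const_mul a) h1.re,
    integral_const_mul, h.integral_sub_one, integral_re h1, integral_mul_const,
    h.integral_star]
  simp

/-- The variance of `‖y‖²` and twice the second moment of a projection both carry the constant `κ`.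
Thus the diagonal and the off-diagonal entries of the matrix receive the same weight. Only the cross
term keeps a third moment. -/
lemma GaussianMoments.integral_half_mul (h : GaussianMoments ν κ) (a : ℝ) (Y : 𝕜) :
    ∫ y : 𝕜, (a * (‖y‖ ^ 2 - 1) + RCLike.re (star y * Y)) *
      (a * (‖y‖ ^ 2 - 1) + 2 * RCLike.re (star y * Y)) ∂ν =
      κ * a ^ 2 + 3 * a * RCLike.re (skewness ν * Y) + κ * ‖Y‖ ^ 2 := by
  have e : ∀ y : 𝕜, (a * (‖y‖ ^ 2 - 1) + RCLike.re (star y * Y)) *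
      (a * (‖y‖ ^ 2 - 1) + 2 * RCLike.re (star y * Y)) = (a ^ 2 * (‖y‖ ^ 2 - 1) ^ 2 +
        3 * a * RCLike.re (((‖y‖ ^ 2 - 1 : ℝ) : 𝕜) * star y * Y)) +
          2 * RCLike.re (star y * Y) ^ 2 := fun y ↦ by
    rw [mul_assoc ((‖y‖ ^ 2 - 1 : ℝ) : 𝕜), RCLike.re_ofReal_mul]; ring
  have i1 := h.memLp_sub_one.integrable_sq
  have i3 := (h.memLp_mul Y).re.integrable_sq
  have i2 : Integrable (fun y : 𝕜 ↦ ((‖y‖ ^ 2 - 1 : ℝ) : 𝕜) * star y) ν :=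
    MemLp.integrable_mul (p := 2) (q := 2) h.memLp_sub_one.ofReal
      (h.memLp_four.star.mono_exponent (by norm_num))
  simp only [e]
  rw [integral_add_add (i1.const_mul _) ((i2.mul_const Y).re.const_mul _) (i3.const_mul _), integral_const_mul,
    integral_const_mul, integral_const_mul, integral_re (i2.mul_const Y), integral_mul_const,
    h.integral_sub_one_sq, h.proj, skewness]
  ring

end OneVariable

variable {ι : Type*} [Fintype ι] [DecidableEq ι]

section Update

variable (ν : Measure 𝕜) [IsProbabilityMeasure ν]

-- Resampling one coordinate preserves a product measure; in `integral_eq_integral_update` this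
-- plays the part of conditioning on the other coordinates.
omit [RCLike 𝕜] in
lemma measurePreserving_update [MeasurableSpace 𝕜] (ν : Measure 𝕜) [IsProbabilityMeasure ν] (b : ι) :
    MeasurePreserving (fun p : (ι → 𝕜) × 𝕜 ↦ Function.update p.1 b p.2)
      ((Measure.pi fun _ : ι ↦ ν).prod ν) (Measure.pi fun _ : ι ↦ ν) := by
  refine ⟨measurable_update', ?_⟩
  symm
  refine Measure.pi_eq fun s hs ↦ ?_
  rw [Measure.map_apply measurable_update' (MeasurableSet.univ_pi hs)]
  have : (fun p : (ι → 𝕜) × 𝕜 ↦ Function.update p.1 b p.2) ⁻¹' Set.univ.pi s =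
      (Set.univ.pi (Function.update s b Set.univ)) ×ˢ s b := by
    ext p
    simp only [Set.mem_preimage, Set.mem_univ_pi, Set.mem_prod]
    constructor
    · intro h
      refine ⟨fun i ↦ ?_, by simpa using h b⟩
      by_cases hi : i = b
      · subst hi; simp
      · simpa [hi] using h i
    · rintro ⟨h, h'⟩ i
      by_cases hi : i = b
      · subst hi; simpa using h'
      · simpa [hi] using h i
  rw [this, Measure.prod_prod, Measure.pi_pi, ← Finset.prod_erase_mul _ _ (Finset.mem_univ b),
    ← Finset.prod_erase_mul _ (fun i ↦ ν (s i)) (Finset.mem_univ b)]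
  simp only [Function.update_self, measure_univ, mul_one]
  congr 1
  exact Finset.prod_congr rfl fun i hi ↦ by rw [Function.update_of_ne (Finset.ne_of_mem_erase hi)]

variable {ν}

lemma integral_eq_integral_update {E : Type*} [NormedAddCommGroup E] [NormedSpace ℝ E] (b : ι)
    {f : (ι → 𝕜) → E} (hf : Integrable f (Measure.pi fun _ : ι ↦ ν)) :
    ∫ x, f x ∂(Measure.pi fun _ : ι ↦ ν) =
      ∫ x, ∫ y, f (Function.update x b y) ∂ν ∂(Measure.pi fun _ : ι ↦ ν) := by
  have hm := measurePreserving_update ν b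
  have hf' := (hm.integrable_comp hf.1).2 hf
  rw [← integral_prod (fun p : (ι → 𝕜) × 𝕜 ↦ f (Function.update p.1 b p.2)) hf']
  conv_lhs => rw [← hm.map_eq]
  rw [integral_map hm.measurable.aemeasurable (by rw [hm.map_eq]; exact hf.1)]

end Update

/-- The centred quadratic form `x* A x - tr A`. -/
def quad (A : Matrix ι ι 𝕜) (x : ι → 𝕜) : ℝ := hform A x - RCLike.re A.trace

/-- The sum `∑ A b c * x c` over `c ≠ b`. -/
def res (A : Matrix ι ι 𝕜) (b : ι) (x : ι → 𝕜) : 𝕜 := (A *ᵥ Function.update x b 0) b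

/-- The terms of a decomposition of `quad A x` as a sum over the coordinates `b`. -/
def half (A : Matrix ι ι 𝕜) (b : ι) (x : ι → 𝕜) : ℝ :=
  RCLike.re (A b b) * (‖x b‖ ^ 2 - 1) + RCLike.re (star (x b) * res A b x)

/-- The part of `quad A x` that involves the coordinate `x b`. -/
def incr (A : Matrix ι ι 𝕜) (b : ι) (x : ι → 𝕜) : ℝ :=
  RCLike.re (A b b) * (‖x b‖ ^ 2 - 1) + 2 * RCLike.re (star (x b) * res A b x)

/-- The integral of `half A b * incr A b` with respect to the coordinate `b`. -/
def condVar (ν : Measure 𝕜) (κ : ℝ) (A : Matrix ι ι 𝕜) (b : ι) (x : ι → 𝕜) : ℝ :=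
  κ * RCLike.re (A b b) ^ 2 + 3 * RCLike.re (A b b) * RCLike.re (skewness ν * res A b x) +
    κ * ‖res A b x‖ ^ 2

lemma res_update (A : Matrix ι ι 𝕜) (b : ι) (x : ι → 𝕜) (y : 𝕜) :
    res A b (Function.update x b y) = res A b x := by simp [res]

lemma res_eq_dotProduct (A : Matrix ι ι 𝕜) (b : ι) (x : ι → 𝕜) :
    res A b x = Function.update (A b) b 0 ⬝ᵥ x := by
  simp only [res, mulVec, dotProduct]
  refine Finset.sum_congr rfl fun c _ ↦ ?_
  by_cases hc : c = b
  · subst hc; simp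
  · simp [hc]

lemma mulVec_apply_eq (A : Matrix ι ι 𝕜) (b : ι) (x : ι → 𝕜) :
    (A *ᵥ x) b = A b b * x b + res A b x := by
  rw [res_eq_dotProduct, mulVec, dotProduct, dotProduct, ← Finset.add_sum_erase _ _ (Finset.mem_univ b),
    ← Finset.add_sum_erase _ (fun i ↦ Function.update (A b) b 0 i * x i) (Finset.mem_univ b)]
  simp only [Function.update_self, zero_mul, zero_add]
  congr 1
  exact Finset.sum_congr rfl fun c hc ↦ by rw [Function.update_of_ne (Finset.ne_of_mem_erase hc)]

lemma re_star_mul_mul_self (a x : 𝕜) : RCLike.re (star x * (a * x)) = RCLike.re a * ‖x‖ ^ 2 := by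
  rw [mul_left_comm, RCLike.star_def, RCLike.conj_mul, ← RCLike.ofReal_pow, RCLike.re_mul_ofReal]

/-- Splitting by rows assigns each off-diagonal pair of coordinates to two terms; hence the factor
`2` in `incr` and its absence in `half`. -/
lemma sum_half (A : Matrix ι ι 𝕜) (x : ι → 𝕜) : ∑ b, half A b x = quad A x := by
  simp only [half, quad, hform, dotProduct, Pi.star_apply, mulVec_apply_eq, trace, diag_apply,
    map_sum, mul_add, map_add, re_star_mul_mul_self]
  rw [← Finset.sum_sub_distrib]
  exact Finset.sum_congr rfl fun b _ ↦ by ring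

/-- The right-hand side does not involve `x b`: it is the part of the form left after removal of one
coordinate. -/
lemma quad_sub_incr {A : Matrix ι ι 𝕜} (hA : A.IsHermitian) (b : ι) (x : ι → 𝕜) :
    quad A x - incr A b x =
      hform A (Function.update x b 0) - RCLike.re A.trace + RCLike.re (A b b) := by
  have hx : x = Function.update x b 0 + Pi.single b (x b) := by
    ext i
    by_cases hi : i = b
    · subst hi; simp
    · simp [hi]
  have h1 : hform A x = hform A (Function.update x b 0) + 2 * RCLike.re (star (x b) * res A b x)
      + RCLike.re (A b b) * ‖x b‖ ^ 2 := by
    set u := Function.update x b 0 with hu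
    conv_lhs => rw [hx]
    simp only [hform, mulVec_add, dotProduct_add, star_add, add_dotProduct, map_add]
    have e1 : star (Pi.single b (x b)) ⬝ᵥ A *ᵥ u = star (x b) * res A b x := by
      rw [← Pi.single_star, single_dotProduct]
      rfl
    have e2 : RCLike.re (star u ⬝ᵥ A *ᵥ Pi.single b (x b)) = RCLike.re (star (x b) * res A b x) := by
      rw [← e1, ← RCLike.conj_re, ← RCLike.star_def, star_dotProduct, star_mulVec,
        ← dotProduct_mulVec, hA.eq, star_star]
    have e3 : RCLike.re (star (Pi.single b (x b)) ⬝ᵥ A *ᵥ Pi.single b (x b)) =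
        RCLike.re (A b b) * ‖x b‖ ^ 2 := by
      rw [← Pi.single_star, single_dotProduct, ← re_star_mul_mul_self, mulVec_single]
      simp
    rw [e1, e2, e3]
    ring
  rw [quad, incr, h1]
  ring

lemma quad_sub_incr_update {A : Matrix ι ι 𝕜} (hA : A.IsHermitian) (b : ι) (x : ι → 𝕜) (y : 𝕜) :
    quad A (Function.update x b y) - incr A b (Function.update x b y) =
      quad A x - incr A b x := by
  rw [quad_sub_incr hA, quad_sub_incr hA, Function.update_idem]

section Moments

variable {ν : Measure 𝕜} [IsProbabilityMeasure ν] {κ : ℝ}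

omit [DecidableEq ι] in
lemma GaussianMoments.memLp_eval (h : GaussianMoments ν κ) (i : ι) :
    MemLp (fun x : ι → 𝕜 ↦ x i) 4 (Measure.pi fun _ : ι ↦ ν) :=
  h.memLp_four.comp_measurePreserving (measurePreserving_eval (fun _ : ι ↦ ν) i)

omit [DecidableEq ι] in
lemma GaussianMoments.memLp_dotProduct (h : GaussianMoments ν κ) (w : ι → 𝕜) :
    MemLp (fun x : ι → 𝕜 ↦ w ⬝ᵥ x) 4 (Measure.pi fun _ : ι ↦ ν) :=
  memLp_finsetSum _ fun i _ ↦ (h.memLp_eval i).const_mul (w i)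

lemma GaussianMoments.memLp_res (h : GaussianMoments ν κ) (A : Matrix ι ι 𝕜) (b : ι) :
    MemLp (res A b) 4 (Measure.pi fun _ : ι ↦ ν) := by
  have := h.memLp_dotProduct (Function.update (A b) b 0)
  simpa only [← res_eq_dotProduct] using! this

lemma GaussianMoments.memLp_half (h : GaussianMoments ν κ) (A : Matrix ι ι 𝕜) (b : ι) :
    MemLp (half A b) 2 (Measure.pi fun _ : ι ↦ ν) :=
  (((MemLp.sq_norm_of_four (h.memLp_eval b)).sub (memLp_const 1)).const_mul _).add
    (MemLp.star_mul_of_four (h.memLp_eval b) (h.memLp_res A b)).re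

lemma GaussianMoments.memLp_incr (h : GaussianMoments ν κ) (A : Matrix ι ι 𝕜) (b : ι) :
    MemLp (incr A b) 2 (Measure.pi fun _ : ι ↦ ν) :=
  (((MemLp.sq_norm_of_four (h.memLp_eval b)).sub (memLp_const 1)).const_mul _).add
    ((MemLp.star_mul_of_four (h.memLp_eval b) (h.memLp_res A b)).re.const_mul 2)

lemma GaussianMoments.memLp_quad (h : GaussianMoments ν κ) (A : Matrix ι ι 𝕜) :
    MemLp (quad A) 2 (Measure.pi fun _ : ι ↦ ν) := by
  have := memLp_finsetSum Finset.univ fun b _ ↦ h.memLp_half A b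
  simpa only [sum_half] using! this

lemma GaussianMoments.memLp_condVar (h : GaussianMoments ν κ) (A : Matrix ι ι 𝕜) (b : ι) :
    MemLp (condVar ν κ A b) 2 (Measure.pi fun _ : ι ↦ ν) := by
  have h1 : MemLp (fun x ↦ RCLike.re (skewness ν * res A b x)) 2 (Measure.pi fun _ : ι ↦ ν) :=
    (((h.memLp_res A b).mono_exponent (by norm_num)).const_mul (skewness ν)).re
  have h2 := (MemLp.sq_norm_of_four (h.memLp_res A b)).const_mul κ
  have h3 := (memLp_const (p := 2) (μ := Measure.pi fun _ : ι ↦ ν) (κ * RCLike.re (A b b) ^ 2)).add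
    (h1.const_mul (3 * RCLike.re (A b b)))
  exact h3.add h2

/-- In the variable `x b` alone `half A b` has mean zero, hence it is orthogonal to all functions of
the other coordinates. -/
lemma GaussianMoments.integral_half_smul (h : GaussianMoments ν κ) {E : Type*} [NormedAddCommGroup E]
    [NormedSpace ℝ E] [CompleteSpace E] (A : Matrix ι ι 𝕜) (b : ι) {φ : (ι → 𝕜) → E}
    (hφ : ∀ x y, φ (Function.update x b y) = φ x)
    (hi : Integrable (fun x ↦ half A b x • φ x) (Measure.pi fun _ : ι ↦ ν)) :
    ∫ x, half A b x • φ x ∂(Measure.pi fun _ : ι ↦ ν) = 0 := by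
  rw [integral_eq_integral_update b hi]
  simp only [hφ, half, res_update, Function.update_self, integral_smul_const, h.integral_half]
  simp

lemma GaussianMoments.integral_half_mul_incr_smul (h : GaussianMoments ν κ) {E : Type*}
    [NormedAddCommGroup E] [NormedSpace ℝ E] [CompleteSpace E] (A : Matrix ι ι 𝕜) (b : ι)
    {φ : (ι → 𝕜) → E} (hφ : ∀ x y, φ (Function.update x b y) = φ x)
    (hi : Integrable (fun x ↦ (half A b x * incr A b x) • φ x) (Measure.pi fun _ : ι ↦ ν)) :
    ∫ x, (half A b x * incr A b x) • φ x ∂(Measure.pi fun _ : ι ↦ ν) =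
      ∫ x, condVar ν κ A b x • φ x ∂(Measure.pi fun _ : ι ↦ ν) := by
  rw [integral_eq_integral_update b hi]
  simp only [hφ, half, incr, res_update, Function.update_self, integral_smul_const,
    h.integral_half_mul, condVar]

lemma GaussianMoments.integral_star_mul (h : GaussianMoments ν κ) (i j : ι) :
    ∫ x : ι → 𝕜, star (x i) * x j ∂(Measure.pi fun _ : ι ↦ ν) = if i = j then 1 else 0 := by
  have hi := (MemLp.star_mul_of_four (h.memLp_eval i) (h.memLp_eval j)).integrable one_le_two
  rw [integral_eq_integral_update i hi]
  by_cases hij : i = j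
  · subst hij
    simp only [Function.update_self, if_true, RCLike.star_def, RCLike.conj_mul]
    have := h.variance
    simp only [← RCLike.ofReal_pow, integral_ofReal, this]
    simp
  · simp only [Function.update_self, Function.update_of_ne (Ne.symm hij), integral_mul_const, hij,
      if_false, h.integral_star, zero_mul, integral_zero]

lemma GaussianMoments.integral_eval (h : GaussianMoments ν κ) (i : ι) :
    ∫ x : ι → 𝕜, x i ∂(Measure.pi fun _ : ι ↦ ν) = 0 := by
  rw [integral_eq_integral_update i ((h.memLp_eval i).integrable (by norm_num))]
  simp [h.mean]

lemma GaussianMoments.integral_dotProduct (h : GaussianMoments ν κ) (w : ι → 𝕜) :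
    ∫ x : ι → 𝕜, w ⬝ᵥ x ∂(Measure.pi fun _ : ι ↦ ν) = 0 := by
  simp only [dotProduct]
  rw [integral_finsetSum _ fun i _ ↦ ((h.memLp_eval i).integrable (by norm_num)).const_mul _]
  simp [integral_const_mul, h.integral_eval]

lemma GaussianMoments.integral_norm_sq_dotProduct (h : GaussianMoments ν κ) (w : ι → 𝕜) :
    ∫ x : ι → 𝕜, ‖w ⬝ᵥ x‖ ^ 2 ∂(Measure.pi fun _ : ι ↦ ν) = ∑ i, ‖w i‖ ^ 2 := by
  have e (x : ι → 𝕜) : ((‖w ⬝ᵥ x‖ ^ 2 : ℝ) : 𝕜) =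
      ∑ i, ∑ j, (star (w i) * w j) * (star (x i) * x j) := by
    rw [RCLike.ofReal_pow, ← RCLike.conj_mul, ← RCLike.star_def, dotProduct, star_sum,
      Finset.sum_mul_sum]
    refine Finset.sum_congr rfl fun i _ ↦ Finset.sum_congr rfl fun j _ ↦ ?_
    rw [star_mul']
    ring
  have hi (i j : ι) := ((MemLp.star_mul_of_four (h.memLp_eval i) (h.memLp_eval j)).integrable
    one_le_two).const_mul (star (w i) * w j)
  apply RCLike.ofReal_injective (K := 𝕜)
  rw [← integral_ofReal]
  simp only [e]
  rw [integral_finsetSum _ fun i _ ↦ integrable_finsetSum _ fun j _ ↦ hi i j]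
  simp_rw [integral_finsetSum _ fun j _ ↦ hi _ j, integral_const_mul, h.integral_star_mul]
  simp [RCLike.conj_mul]

/-- The third-moment term of `condVar` is linear in the other coordinates and therefore has mean
zero. -/
lemma GaussianMoments.integral_condVar (h : GaussianMoments ν κ) (A : Matrix ι ι 𝕜) (b : ι) :
    ∫ x, condVar ν κ A b x ∂(Measure.pi fun _ : ι ↦ ν) =
      κ * RCLike.re (A b b) ^ 2 + κ * ∑ c, ‖Function.update (A b) b 0 c‖ ^ 2 := by
  have h1 := ((h.memLp_res A b).integrable (by norm_num)).const_mul (skewness ν)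
  have h2 := (MemLp.sq_norm_of_four (h.memLp_res A b)).integrable one_le_two
  simp only [condVar]
  rw [integral_add_add (integrable_const _) (h1.re.const_mul _) (h2.const_mul _), integral_const,
    integral_const_mul, integral_re h1, integral_const_mul, integral_const_mul]
  simp only [res_eq_dotProduct]
  rw [h.integral_norm_sq_dotProduct, h.integral_dotProduct]
  simp

lemma sum_condVar_eq {A : Matrix ι ι 𝕜} (hA : A.IsHermitian) :
    ∑ b, (κ * RCLike.re (A b b) ^ 2 + κ * ∑ c, ‖Function.update (A b) b 0 c‖ ^ 2) =
      κ * ∑ b, ∑ c, ‖A b c‖ ^ 2 := by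
  rw [Finset.mul_sum]
  refine Finset.sum_congr rfl fun b _ ↦ ?_
  rw [← mul_add, ← Finset.add_sum_erase _ (fun c ↦ ‖A b c‖ ^ 2) (Finset.mem_univ b),
    ← Finset.add_sum_erase _ _ (Finset.mem_univ b)]
  simp only [Function.update_self, norm_zero]
  have h1 : ‖A b b‖ ^ 2 = RCLike.re (A b b) ^ 2 := by
    rw [← RCLike.conj_eq_iff_re.1 (hA.apply b b), RCLike.norm_ofReal, sq_abs, RCLike.ofReal_re]
  rw [h1, Finset.sum_congr rfl fun c hc ↦ by rw [Function.update_of_ne (Finset.ne_of_mem_erase hc)]]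
  ring

/-- The variance of a quadratic form. -/
lemma GaussianMoments.integral_quad_sq (h : GaussianMoments ν κ) {A : Matrix ι ι 𝕜}
    (hA : A.IsHermitian) :
    ∫ x, quad A x ^ 2 ∂(Measure.pi fun _ : ι ↦ ν) = κ * ∑ b, ∑ c, ‖A b c‖ ^ 2 := by
  have i1 (b : ι) : Integrable (fun x ↦ half A b x * quad A x) (Measure.pi fun _ : ι ↦ ν) :=
    (h.memLp_half A b).integrable_mul (h.memLp_quad A)
  have i2 (b : ι) : Integrable (fun x ↦ half A b x * incr A b x) (Measure.pi fun _ : ι ↦ ν) :=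
    (h.memLp_half A b).integrable_mul (h.memLp_incr A b)
  have i3 (b : ι) : Integrable (fun x ↦ half A b x * (quad A x - incr A b x))
      (Measure.pi fun _ : ι ↦ ν) :=
    (h.memLp_half A b).integrable_mul ((h.memLp_quad A).sub (h.memLp_incr A b))
  have e (x : ι → 𝕜) : quad A x ^ 2 = ∑ b, half A b x * quad A x := by
    rw [← Finset.sum_mul, sum_half, sq]
  simp only [e]
  rw [integral_finsetSum _ fun b _ ↦ i1 b, ← sum_condVar_eq hA]
  refine Finset.sum_congr rfl fun b _ ↦ ?_
  -- The factor `quad A - incr A b` is free of `x b`, so its product with `half A b` integrates to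
  -- zero and only the product with `incr A b` survives.
  have e2 : (fun x ↦ half A b x * quad A x) = fun x ↦ half A b x * (quad A x - incr A b x) +
      half A b x * incr A b x := by
    ext x; ring
  rw [e2, integral_add (i3 b) (i2 b)]
  have h1 := h.integral_half_smul A b (φ := fun x ↦ quad A x - incr A b x)
    (fun x y ↦ quad_sub_incr_update hA b x y) (i3 b)
  have h2 := h.integral_half_mul_incr_smul A b (φ := fun _ ↦ (1 : ℝ)) (fun _ _ ↦ rfl)
    (by simpa using i2 b)
  simp only [smul_eq_mul, mul_one] at h1 h2
  rw [h1, h2, h.integral_condVar, zero_add]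

/-- `‖w ⬝ᵥ x‖²` is the quadratic form of a rank-one matrix, so its variance is already known and
yields the fourth moment. -/
lemma GaussianMoments.integral_norm_pow_four_dotProduct (h : GaussianMoments ν κ) (w : ι → 𝕜) :
    ∫ x : ι → 𝕜, ‖w ⬝ᵥ x‖ ^ 4 ∂(Measure.pi fun _ : ι ↦ ν) = (1 + κ) * (∑ i, ‖w i‖ ^ 2) ^ 2 := by
  set A : Matrix ι ι 𝕜 := vecMulVec (star w) w with hAdef
  have hA : A.IsHermitian := by
    ext i j
    simp [hAdef, vecMulVec_apply, mul_comm]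
  have hq (x : ι → 𝕜) : quad A x = ‖w ⬝ᵥ x‖ ^ 2 - ∑ i, ‖w i‖ ^ 2 := by
    rw [quad, hform, hAdef, vecMulVec_mulVec, trace_vecMulVec]
    congr 1
    · rw [op_smul_eq_smul, dotProduct_smul, smul_eq_mul, star_dotProduct_star,
        RCLike.star_def, mul_comm, RCLike.conj_mul, ← RCLike.ofReal_pow, RCLike.ofReal_re]
    · simp only [dotProduct, map_sum, Pi.star_apply, RCLike.star_def, RCLike.conj_mul,
        ← RCLike.ofReal_pow, RCLike.ofReal_re]
  have h2 := MemLp.sq_norm_of_four (h.memLp_dotProduct w)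
  have h4 : Integrable (fun x : ι → 𝕜 ↦ ‖w ⬝ᵥ x‖ ^ 4) (Measure.pi fun _ : ι ↦ ν) := by
    have := h2.integrable_sq
    simpa [← pow_mul] using this
  have h5 := h.integral_quad_sq hA
  simp only [hq] at h5
  have e (x : ι → 𝕜) : (‖w ⬝ᵥ x‖ ^ 2 - ∑ i, ‖w i‖ ^ 2) ^ 2 =
      ‖w ⬝ᵥ x‖ ^ 4 + (-2 * ∑ i, ‖w i‖ ^ 2) * ‖w ⬝ᵥ x‖ ^ 2 + (∑ i, ‖w i‖ ^ 2) ^ 2 := by ring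
  simp only [e] at h5
  rw [integral_add_add h4 ((h2.integrable one_le_two).const_mul _) (integrable_const _), integral_const_mul,
    h.integral_norm_sq_dotProduct] at h5
  have h6 : ∑ b, ∑ c, ‖A b c‖ ^ 2 = (∑ i, ‖w i‖ ^ 2) ^ 2 := by
    simp only [hAdef, vecMulVec_apply, norm_mul, Pi.star_apply, norm_star, mul_pow, sq (∑ i, _),
      Finset.sum_mul_sum]
  rw [h6] at h5
  simp at h5
  linarith

end Moments

end QuadraticForms

/-! ### The differential equation of the characteristic function. -/

section QuadraticCharFun

open Matrix

variable {𝕜 : Type*} [RCLike 𝕜] {ι : Type*} [Fintype ι] [DecidableEq ι]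

/-- The character `u ↦ exp (i u)` of the real line. -/
def eI (u : ℝ) : ℂ := Complex.exp (u * Complex.I)

lemma continuous_eI : Continuous eI := by unfold eI; fun_prop

lemma norm_eI (u : ℝ) : ‖eI u‖ = 1 := Complex.norm_exp_ofReal_mul_I u

lemma eI_add (u v : ℝ) : eI (u + v) = eI u * eI v := by
  rw [eI, Complex.ofReal_add, add_mul, Complex.exp_add]; rfl

lemma norm_eI_sub_one_le (u : ℝ) : ‖eI u - 1‖ ≤ |u| := by
  have := Real.norm_exp_I_mul_ofReal_sub_one_le (x := u)
  rwa [mul_comm] at this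

/-- The minimum keeps quadratic smallness near `0` while growing only linearly. After multiplication
by `half`, second moments then suffice for integrability. -/
lemma norm_eI_sub_one_sub_le (u : ℝ) :
    ‖eI u - 1 - (u : ℂ) * Complex.I‖ ≤ 2 * |u| * min 1 |u| := by
  have hn : ‖(u : ℂ) * Complex.I‖ = |u| := by simp
  rcases le_or_gt |u| 1 with h | h
  · have := Complex.norm_exp_sub_one_sub_id_le (x := u * Complex.I) (by rwa [hn])
    rw [hn] at this
    rw [min_eq_right h]
    refine this.trans ?_
    nlinarith [abs_nonneg u]
  · rw [min_eq_left h.le]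
    refine (norm_sub_le _ _).trans ?_
    rw [hn]
    linarith [norm_eI_sub_one_le u]

variable {ν : Measure 𝕜} [IsProbabilityMeasure ν] {κ : ℝ}

/-- The bound of the error in the comparison of the characteristic function of a quadratic form
with the one of a Gaussian variable. -/
def charError (ν : Measure 𝕜) (κ : ℝ) (A : Matrix ι ι 𝕜) : ℝ :=
  ∑ b, ∫ x, |condVar ν κ A b x| * |incr A b x| ∂(Measure.pi fun _ : ι ↦ ν) +
    ∫ x, |κ * ∑ b, ∑ c, ‖A b c‖ ^ 2 - ∑ b, condVar ν κ A b x| ∂(Measure.pi fun _ : ι ↦ ν) +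
    ∑ b, ∫ x, |half A b x| * (2 * |incr A b x| * min 1 |incr A b x|) ∂(Measure.pi fun _ : ι ↦ ν)

lemma GaussianMoments.hasDerivAt_charFun_quad (h : GaussianMoments ν κ) (A : Matrix ι ι 𝕜) (t : ℝ) :
    HasDerivAt (fun t : ℝ ↦ ∫ x, eI (t * quad A x) ∂(Measure.pi fun _ : ι ↦ ν))
      (∫ x, eI (t * quad A x) * (quad A x * Complex.I) ∂(Measure.pi fun _ : ι ↦ ν)) t := by
  have hQ := h.memLp_quad A
  have hm : AEStronglyMeasurable (quad A) (Measure.pi fun _ : ι ↦ ν) := hQ.1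
  have hc (s : ℝ) : AEStronglyMeasurable (fun x ↦ eI (s * quad A x)) (Measure.pi fun _ : ι ↦ ν) :=
    continuous_eI.comp_aestronglyMeasurable (hm.const_mul s)
  have hm' : AEStronglyMeasurable (fun x ↦ (quad A x : ℂ) * Complex.I) (Measure.pi fun _ : ι ↦ ν) :=
    (Complex.continuous_ofReal.comp_aestronglyMeasurable hm).mul_const _
  refine (hasDerivAt_integral_of_dominated_loc_of_deriv_le (s := Set.univ)
    (F := fun t x ↦ eI (t * quad A x)) (F' := fun t x ↦ eI (t * quad A x) * (quad A x * Complex.I))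
    (bound := fun x ↦ |quad A x|)
    Filter.univ_mem (.of_forall hc) ?_ ((hc t).mul hm') (ae_of_all _ ?_)
    (hQ.integrable one_le_two).abs (ae_of_all _ ?_)).2
  · exact Integrable.of_bound (hc t) 1 (ae_of_all _ fun x ↦ (norm_eI _).le)
  · intro x s _
    rw [norm_mul, norm_eI]
    simp
  · intro x s _
    have h1 : HasDerivAt (fun s : ℝ ↦ ((s * quad A x : ℝ) : ℂ)) (quad A x) s := by
      have := ((hasDerivAt_id s).mul_const (quad A x)).ofReal_comp
      simpa using this
    exact (h1.mul_const Complex.I).cexp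

/-- The derivative is the sum over `b` of the means of `i half_b eI(t Q)`. Expand the phase about
the one without the coordinate `b`. The term of order zero vanishes because `half_b` is centred in
`x b`, and the term of order one produces `-t condVar_b`. The three sums of `charError` bound, in
this order, the return to the full phase, the replacement of `∑ condVar_b` by its mean, and the
Taylor remainder. -/
lemma GaussianMoments.norm_deriv_add_le (h : GaussianMoments ν κ) {A : Matrix ι ι 𝕜}
    (hA : A.IsHermitian) {t : ℝ} (ht : t ∈ Set.Icc (0 : ℝ) 1) :
    ‖(∫ x, eI (t * quad A x) * (quad A x * Complex.I) ∂(Measure.pi fun _ : ι ↦ ν)) +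
      t * ((κ * ∑ b, ∑ c, ‖A b c‖ ^ 2 : ℝ) : ℂ) *
        ∫ x, eI (t * quad A x) ∂(Measure.pi fun _ : ι ↦ ν)‖ ≤ charError ν κ A := by
  set μ : Measure (ι → 𝕜) := Measure.pi fun _ : ι ↦ ν with hμ
  set v : ℝ := κ * ∑ b, ∑ c, ‖A b c‖ ^ 2 with hv
  have mQ : AEStronglyMeasurable (quad A) μ := (h.memLp_quad A).1
  have mD (b : ι) : AEStronglyMeasurable (incr A b) μ := (h.memLp_incr A b).1
  have mE : AEStronglyMeasurable (fun x ↦ eI (t * quad A x)) μ :=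
    continuous_eI.comp_aestronglyMeasurable (mQ.const_mul t)
  have mEb (b : ι) : AEStronglyMeasurable (fun x ↦ eI (t * (quad A x - incr A b x))) μ :=
    continuous_eI.comp_aestronglyMeasurable ((mQ.sub (mD b)).const_mul t)
  have mR (b : ι) : AEStronglyMeasurable (fun x ↦ eI (t * incr A b x) - 1 -
      ((t * incr A b x : ℝ) : ℂ) * Complex.I) μ :=
    (((continuous_eI.comp_aestronglyMeasurable ((mD b).const_mul t)).sub
      aestronglyMeasurable_const).sub ((Complex.continuous_ofReal.comp_aestronglyMeasurable
        ((mD b).const_mul t)).mul_const _))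
  have iH (b : ι) : Integrable (half A b) μ := (h.memLp_half A b).integrable one_le_two
  have iHD (b : ι) : Integrable (fun x ↦ half A b x * incr A b x) μ :=
    (h.memLp_half A b).integrable_mul (h.memLp_incr A b)
  have iV (b : ι) : Integrable (condVar ν κ A b) μ := (h.memLp_condVar A b).integrable one_le_two
  have iVD (b : ι) : Integrable (fun x ↦ condVar ν κ A b x * incr A b x) μ :=
    (h.memLp_condVar A b).integrable_mul (h.memLp_incr A b)
  have iSV : Integrable (fun x ↦ v - ∑ b, condVar ν κ A b x) μ :=
    (integrable_const v).sub (integrable_finsetSum _ fun b _ ↦ iV b)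
  have hsmul {f : (ι → 𝕜) → ℝ} {g : (ι → 𝕜) → ℂ} (hf : Integrable f μ)
      (hg : AEStronglyMeasurable g μ) (C : ℝ) (hgC : ∀ x, ‖g x‖ ≤ C) :
      Integrable (fun x ↦ f x • g x) μ := by
    refine (hf.norm.mul_const C).mono (hf.1.smul hg) (ae_of_all _ fun x ↦ ?_)
    rw [norm_smul, norm_mul, norm_norm, Real.norm_eq_abs C]
    gcongr
    exact (hgC x).trans (le_abs_self C)
  have iE : Integrable (fun x ↦ eI (t * quad A x)) μ :=
    Integrable.of_bound mE 1 (ae_of_all _ fun x ↦ (norm_eI _).le)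
  have abst : |t| ≤ 1 := by rw [abs_of_nonneg ht.1]; exact ht.2
  have j1 (b : ι) : Integrable (fun x ↦ half A b x •
      (Complex.I * eI (t * (quad A x - incr A b x)))) μ :=
    hsmul (iH b) ((mEb b).const_mul _) 1 fun x ↦ by simp [norm_eI]
  have j2 (b : ι) : Integrable (fun x ↦ (half A b x * incr A b x) •
      ((-t : ℂ) * eI (t * (quad A x - incr A b x)))) μ :=
    hsmul (iHD b) ((mEb b).const_mul _) |t| fun x ↦ by simp [norm_eI]
  have hRb (b : ι) (x : ι → 𝕜) : ‖eI (t * incr A b x) - 1 -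
      ((t * incr A b x : ℝ) : ℂ) * Complex.I‖ ≤ 2 * |incr A b x| * min 1 |incr A b x| := by
    refine (norm_eI_sub_one_sub_le _).trans ?_
    have : |t * incr A b x| ≤ |incr A b x| := by
      rw [abs_mul]
      exact mul_le_of_le_one_left (abs_nonneg _) abst
    gcongr
  have iB (b : ι) : Integrable (fun x ↦ |half A b x| * (2 * |incr A b x| * min 1 |incr A b x|)) μ := by
    have hi : Integrable (fun x ↦ 2 * |half A b x * incr A b x|) μ := (iHD b).abs.const_mul 2
    refine hi.mono ?_ (ae_of_all _ fun x ↦ ?_)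
    · have mH := (iH b).1
      have := mD b
      exact (continuous_abs.comp_aestronglyMeasurable mH).mul
        (((continuous_abs.comp_aestronglyMeasurable this).const_mul 2).mul
          ((continuous_const.min continuous_abs).comp_aestronglyMeasurable this))
    · rw [Real.norm_of_nonneg (by positivity), Real.norm_of_nonneg (by positivity), abs_mul]
      have : min 1 |incr A b x| ≤ 1 := min_le_left _ _
      have h0 : 0 ≤ |half A b x| * (2 * |incr A b x|) := by positivity
      nlinarith
  have j3 (b : ι) : Integrable (fun x ↦ half A b x • (Complex.I * eI (t * (quad A x - incr A b x)) *
      (eI (t * incr A b x) - 1 - ((t * incr A b x : ℝ) : ℂ) * Complex.I))) μ := by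
    refine (iB b).mono ((iH b).1.smul (((mEb b).const_mul _).mul (mR b))) (ae_of_all _ fun x ↦ ?_)
    have hn : 0 ≤ |half A b x| * (2 * |incr A b x| * min 1 |incr A b x|) := by positivity
    rw [norm_smul, norm_mul, norm_mul, norm_eI, Complex.norm_I, one_mul, one_mul,
      Real.norm_of_nonneg hn, Real.norm_eq_abs]
    exact mul_le_mul_of_nonneg_left (hRb b x) (abs_nonneg _)
  have j4 (b : ι) : Integrable (fun x ↦ condVar ν κ A b x •
      ((-t : ℂ) * eI (t * (quad A x - incr A b x)))) μ :=
    hsmul (iV b) ((mEb b).const_mul _) |t| fun x ↦ by simp [norm_eI]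
  have j5 (b : ι) : Integrable (fun x ↦ condVar ν κ A b x • ((t : ℂ) * eI (t * quad A x))) μ :=
    hsmul (iV b) (mE.const_mul _) |t| fun x ↦ by simp [norm_eI]
  have j6 : Integrable (fun x ↦ (v - ∑ b, condVar ν κ A b x) • ((t : ℂ) * eI (t * quad A x))) μ :=
    hsmul iSV (mE.const_mul _) |t| fun x ↦ by simp [norm_eI]
  -- First-order expansion of `eI (t * incr A b x)`, with the phase of the remaining coordinates
  -- factored out.
  have hpt (b : ι) (x : ι → 𝕜) : (half A b x : ℂ) * (eI (t * quad A x) * Complex.I) =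
      half A b x • (Complex.I * eI (t * (quad A x - incr A b x))) +
      (half A b x * incr A b x) • ((-t : ℂ) * eI (t * (quad A x - incr A b x))) +
      half A b x • (Complex.I * eI (t * (quad A x - incr A b x)) *
        (eI (t * incr A b x) - 1 - ((t * incr A b x : ℝ) : ℂ) * Complex.I)) := by
    have : eI (t * quad A x) = eI (t * (quad A x - incr A b x)) * eI (t * incr A b x) := by
      rw [← eI_add]; congr 1; ring
    rw [this]
    simp only [Complex.real_smul]
    push_cast
    linear_combination (half A b x * incr A b x * t * eI (t * (quad A x - incr A b x)) : ℂ) *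
      Complex.I_sq
  have s1 : ∫ x, eI (t * quad A x) * (quad A x * Complex.I) ∂μ =
      ∑ b, (∫ x, condVar ν κ A b x • ((-t : ℂ) * eI (t * (quad A x - incr A b x))) ∂μ +
        ∫ x, half A b x • (Complex.I * eI (t * (quad A x - incr A b x)) *
          (eI (t * incr A b x) - 1 - ((t * incr A b x : ℝ) : ℂ) * Complex.I)) ∂μ) := by
    have e (x : ι → 𝕜) : eI (t * quad A x) * (quad A x * Complex.I) =
        ∑ b, (half A b x : ℂ) * (eI (t * quad A x) * Complex.I) := by
      rw [← Finset.sum_mul, ← Complex.ofReal_sum, sum_half]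
      ring
    simp only [e, hpt]
    have j12 (b : ι) : Integrable (fun x ↦ half A b x •
      (Complex.I * eI (t * (quad A x - incr A b x))) + (half A b x * incr A b x) •
      ((-t : ℂ) * eI (t * (quad A x - incr A b x)))) μ := (j1 b).add (j2 b)
    have j123 (b : ι) : Integrable (fun x ↦ half A b x •
      (Complex.I * eI (t * (quad A x - incr A b x))) + (half A b x * incr A b x) •
      ((-t : ℂ) * eI (t * (quad A x - incr A b x))) + half A b x • (Complex.I * eI (t * (quad A x - incr A b x)) *
        (eI (t * incr A b x) - 1 - ((t * incr A b x : ℝ) : ℂ) * Complex.I))) μ := (j12 b).add (j3 b)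
    rw [integral_finsetSum _ fun b _ ↦ j123 b]
    refine Finset.sum_congr rfl fun b _ ↦ ?_
    rw [integral_add (j12 b) (j3 b), integral_add (j1 b) (j2 b),
      h.integral_half_smul A b (fun x y ↦ by rw [quad_sub_incr_update hA]) (j1 b),
      h.integral_half_mul_incr_smul A b (fun x y ↦ by rw [quad_sub_incr_update hA]) (j2 b), zero_add]
  have s2 : (t : ℂ) * (v : ℂ) * ∫ x, eI (t * quad A x) ∂μ =
      ∫ x, (v - ∑ b, condVar ν κ A b x) • ((t : ℂ) * eI (t * quad A x)) ∂μ +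
        ∑ b, ∫ x, condVar ν κ A b x • ((t : ℂ) * eI (t * quad A x)) ∂μ := by
    rw [← integral_finsetSum _ fun b _ ↦ j5 b, ← integral_add j6 (integrable_finsetSum _ fun b _ ↦ j5 b),
      ← integral_const_mul]
    congr 1
    ext x
    rw [← Finset.sum_smul, ← add_smul, sub_add_cancel, Complex.real_smul]
    ring
  rw [s1, s2, Finset.sum_add_distrib]
  have e3 : ∀ a b c d : ℂ, a + b + (c + d) = (a + d) + c + b := fun a b c d ↦ by ring
  rw [e3, ← Finset.sum_add_distrib, charError]
  refine (norm_add₃_le).trans (add_le_add (add_le_add ?_ ?_) ?_)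
  · refine (norm_sum_le _ _).trans (Finset.sum_le_sum fun b _ ↦ ?_)
    rw [← integral_add (j4 b) (j5 b)]
    refine norm_integral_le_of_norm_le ?_ (ae_of_all _ fun x ↦ ?_)
    · simpa only [abs_mul] using (iVD b).abs
    · rw [← smul_add, norm_smul, Real.norm_eq_abs]
      gcongr
      have : eI (t * quad A x) = eI (t * (quad A x - incr A b x)) * eI (t * incr A b x) := by
        rw [← eI_add]; congr 1; ring
      rw [this, show (-t : ℂ) * eI (t * (quad A x - incr A b x)) +
        t * (eI (t * (quad A x - incr A b x)) * eI (t * incr A b x)) =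
        t * eI (t * (quad A x - incr A b x)) * (eI (t * incr A b x) - 1) by ring, norm_mul, norm_mul,
        norm_eI, mul_one, Complex.norm_real, Real.norm_eq_abs]
      refine (mul_le_of_le_one_left (norm_nonneg _) abst).trans ((norm_eI_sub_one_le _).trans ?_)
      rw [abs_mul]
      exact mul_le_of_le_one_left (abs_nonneg _) abst
  · refine norm_integral_le_of_norm_le iSV.abs (ae_of_all _ fun x ↦ ?_)
    rw [norm_smul, norm_mul, norm_eI, mul_one, Complex.norm_real, Real.norm_eq_abs, Real.norm_eq_abs]
    exact mul_le_of_le_one_right (abs_nonneg _) abst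
  · refine (norm_sum_le _ _).trans (Finset.sum_le_sum fun b _ ↦ ?_)
    refine norm_integral_le_of_norm_le (iB b) (ae_of_all _ fun x ↦ ?_)
    rw [norm_smul, norm_mul, norm_mul, norm_eI, Complex.norm_I, one_mul, one_mul, Real.norm_eq_abs]
    gcongr
    exact hRb b x

/-- Comparison of the characteristic function of a quadratic form with a Gaussian one. -/
lemma GaussianMoments.norm_charFun_quad_sub_le (h : GaussianMoments ν κ) {A : Matrix ι ι 𝕜}
    (hA : A.IsHermitian) :
    ‖(∫ x, eI (quad A x) ∂(Measure.pi fun _ : ι ↦ ν)) -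
      Complex.exp (-((κ * ∑ b, ∑ c, ‖A b c‖ ^ 2 : ℝ) : ℂ) / 2)‖ ≤ charError ν κ A := by
  set v : ℝ := κ * ∑ b, ∑ c, ‖A b c‖ ^ 2 with hv
  have hv0 : 0 ≤ v := mul_nonneg h.nonneg (by positivity)
  set f : ℝ → ℂ := fun t ↦ ∫ x, eI (t * quad A x) ∂(Measure.pi fun _ : ι ↦ ν) with hf
  -- `exp(v t²/2)` is the integrating factor of `f' = -t v f`. The factor `exp(v/2)` that it costs
  -- in the bound is recovered on dividing by its value at `t = 1`.
  have hg (t : ℝ) : HasDerivAt (fun t : ℝ ↦ f t * Complex.exp (((v * t ^ 2 / 2 : ℝ) : ℂ)))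
      (((∫ x, eI (t * quad A x) * (quad A x * Complex.I) ∂(Measure.pi fun _ : ι ↦ ν)) +
        t * (v : ℂ) * f t) * Complex.exp (((v * t ^ 2 / 2 : ℝ) : ℂ))) t := by
    have h1 : HasDerivAt (fun t : ℝ ↦ v * t ^ 2 / 2) (v * t) t := by
      have := (((hasDerivAt_id t).pow 2).const_mul v).div_const 2
      convert! this using 1
      simp
      ring
    convert! (h.hasDerivAt_charFun_quad A t).mul h1.ofReal_comp.cexp using 1
    push_cast
    ring
  have hbound := norm_image_sub_le_of_norm_deriv_le_segment_01' (f := fun t : ℝ ↦ f t *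
    Complex.exp (((v * t ^ 2 / 2 : ℝ) : ℂ))) (C := charError ν κ A * Real.exp (v / 2))
    (fun t _ ↦ (hg t).hasDerivWithinAt) (fun t ht ↦ by
      rw [norm_mul, Complex.norm_exp_ofReal]
      have h1 := h.norm_deriv_add_le hA (t := t) ⟨ht.1, ht.2.le⟩
      have h2 : v * t ^ 2 / 2 ≤ v / 2 := by
        have : t ^ 2 ≤ 1 := pow_le_one₀ ht.1 ht.2.le
        nlinarith
      exact mul_le_mul h1 (Real.exp_le_exp.2 h2) (Real.exp_pos _).le ((norm_nonneg _).trans h1))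
  have hf0 : f 0 = 1 := by simp [hf, eI]
  have hf1 : f 1 = ∫ x, eI (quad A x) ∂(Measure.pi fun _ : ι ↦ ν) := by simp [hf]
  simp only [hf0, hf1] at hbound
  set F := ∫ x, eI (quad A x) ∂(Measure.pi fun _ : ι ↦ ν)
  have e : F - Complex.exp (-(v : ℂ) / 2) =
      (F * Complex.exp (((v * 1 ^ 2 / 2 : ℝ) : ℂ)) - 1 * Complex.exp (((v * 0 ^ 2 / 2 : ℝ) : ℂ))) *
        Complex.exp (((-(v / 2) : ℝ) : ℂ)) := by
    rw [sub_mul, mul_assoc, ← Complex.exp_add]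
    push_cast
    simp
    ring_nf
  rw [e, norm_mul, Complex.norm_exp_ofReal]
  calc _ ≤ charError ν κ A * Real.exp (v / 2) * Real.exp (-(v / 2)) := by gcongr
    _ = charError ν κ A := by rw [mul_assoc, ← Real.exp_add]; simp

end QuadraticCharFun

/-! ### Bounds on the error of the Gaussian comparison. -/

section CharErrorBound

open Matrix

variable {𝕜 : Type*} [RCLike 𝕜] {ι : Type*} [Fintype ι]

/-- The operator norm of `A` on the Euclidean space is at most `η`. -/
def OpBound (A : Matrix ι ι 𝕜) (η : ℝ) : Prop :=
  0 ≤ η ∧ ∀ x : ι → 𝕜, ∑ i, ‖(A *ᵥ x) i‖ ^ 2 ≤ η ^ 2 * ∑ i, ‖x i‖ ^ 2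

/-- A row of a Hermitian matrix is conjugate to the image of a basis vector. -/
lemma OpBound.sum_row_le {A : Matrix ι ι 𝕜} {η : ℝ} (hA : A.IsHermitian) (h : OpBound A η) (b : ι) :
    ∑ c, ‖A b c‖ ^ 2 ≤ η ^ 2 := by
  classical
  have := h.2 (Pi.single b 1)
  simp only [mulVec_single_one, Pi.single_apply] at this
  have e : ∑ x, ‖if x = b then (1 : 𝕜) else 0‖ ^ 2 = 1 := by
    rw [Finset.sum_eq_single b] <;> simp +contextual
  rw [e, mul_one] at this
  refine le_trans (le_of_eq (Finset.sum_congr rfl fun c _ ↦ ?_)) this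
  rw [col_apply, ← hA.apply b c, norm_star]

lemma OpBound.abs_re_diag_le {A : Matrix ι ι 𝕜} {η : ℝ} (hA : A.IsHermitian) (h : OpBound A η)
    (b : ι) : |RCLike.re (A b b)| ≤ η := by
  refine (RCLike.abs_re_le_norm _).trans (abs_le_of_sq_le_sq' ?_ h.1).2
  exact (Finset.single_le_sum (f := fun c ↦ ‖A b c‖ ^ 2) (fun _ _ ↦ by positivity)
    (Finset.mem_univ b)).trans (h.sum_row_le hA b)

variable [DecidableEq ι]

lemma OpBound.sum_update_le {A : Matrix ι ι 𝕜} {η : ℝ} (hA : A.IsHermitian) (h : OpBound A η)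
    (b : ι) : ∑ c, ‖Function.update (A b) b 0 c‖ ^ 2 ≤ η ^ 2 := by
  refine (Finset.sum_le_sum fun c _ ↦ ?_).trans (h.sum_row_le hA b)
  by_cases hc : c = b
  · subst hc; simp
  · simp [hc]

/-- The off-diagonal part of a matrix. -/
def offDiag (A : Matrix ι ι 𝕜) : Matrix ι ι 𝕜 := A - diagonal fun i ↦ A i i

lemma offDiag_mulVec (A : Matrix ι ι 𝕜) (x : ι → 𝕜) (b : ι) : (offDiag A *ᵥ x) b = res A b x := by
  rw [offDiag, sub_mulVec, Pi.sub_apply, mulVec_diagonal, mulVec_apply_eq]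
  ring

omit [Fintype ι] in
lemma offDiag_isHermitian {A : Matrix ι ι 𝕜} (hA : A.IsHermitian) : (offDiag A).IsHermitian := by
  refine hA.sub ?_
  rw [IsHermitian, diagonal_conjTranspose]
  congr 1
  ext i
  exact hA.apply i i

lemma sum_norm_sq_offDiag (A : Matrix ι ι 𝕜) (b : ι) :
    ∑ c, ‖offDiag A b c‖ ^ 2 = ∑ c, ‖Function.update (A b) b 0 c‖ ^ 2 := by
  refine Finset.sum_congr rfl fun c _ ↦ ?_
  by_cases hc : c = b
  · subst hc; simp [offDiag]
  · simp [offDiag, hc, diagonal_apply_ne' _ hc]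

lemma OpBound.offDiag {A : Matrix ι ι 𝕜} {η : ℝ} (hA : A.IsHermitian) (h : OpBound A η) :
    OpBound (offDiag A) (2 * η) := by
  refine ⟨by linarith [h.1], fun x ↦ ?_⟩
  have h1 (i : ι) : ‖(FiniteRankDeformation.offDiag A *ᵥ x) i‖ ^ 2 ≤
      2 * ‖(A *ᵥ x) i‖ ^ 2 + 2 * (η ^ 2 * ‖x i‖ ^ 2) := by
    rw [FiniteRankDeformation.offDiag, sub_mulVec, Pi.sub_apply, mulVec_diagonal]
    have h2 := norm_sub_le ((A *ᵥ x) i) (A i i * x i)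
    have h3 : ‖A i i * x i‖ ≤ η * ‖x i‖ := by
      rw [norm_mul]
      gcongr
      rw [← RCLike.conj_eq_iff_re.1 (hA.apply i i), RCLike.norm_ofReal]
      exact h.abs_re_diag_le hA i
    have h4 : ‖(A *ᵥ x) i - A i i * x i‖ ≤ ‖(A *ᵥ x) i‖ + η * ‖x i‖ := by linarith
    have h5 := pow_le_pow_left₀ (norm_nonneg _) h4 2
    nlinarith [sq_nonneg (‖(A *ᵥ x) i‖ - η * ‖x i‖)]
  refine (Finset.sum_le_sum fun i _ ↦ h1 i).trans ?_
  rw [Finset.sum_add_distrib, ← Finset.mul_sum, ← Finset.mul_sum, ← Finset.mul_sum]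
  linarith [h.2 x]

section Pointwise

/-- To be applied with `u = ‖x b‖`, `w = ‖res A b x‖ / η` and `m = ‖skewness ν‖`. The power `η³`
matters: the number of coordinates will be of order `η⁻²`, so the sum over `b` is small. -/
lemma abs_condVar_mul_incr_le {κ η u w m V D : ℝ} (hη : 0 ≤ η) (hκ : 0 ≤ κ) (hm : 0 ≤ m)
    (hV : |V| ≤ κ * η ^ 2 + 3 * η * (m * (η * w)) + κ * (η * w) ^ 2)
    (hD : |D| ≤ η * (1 + u ^ 2) + 2 * (u * (η * w))) :
    |V| * |D| ≤ (κ + 3 * m) * η ^ 3 * (3 + 2 * u ^ 4 + 3 * w ^ 4) := by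
  have h1 : |V| ≤ (κ + 3 * m) * η ^ 2 * (1 + w ^ 2) := by
    refine hV.trans ?_
    have : w ≤ 1 + w ^ 2 := by nlinarith [sq_nonneg (w - 1)]
    nlinarith [mul_le_mul_of_nonneg_left this (by positivity : 0 ≤ 3 * m * η ^ 2)]
  have h2 : |D| ≤ η * (1 + 2 * u ^ 2 + w ^ 2) := by
    refine hD.trans ?_
    nlinarith [mul_nonneg hη (sq_nonneg (u - w))]
  calc |V| * |D| ≤ ((κ + 3 * m) * η ^ 2 * (1 + w ^ 2)) * (η * (1 + 2 * u ^ 2 + w ^ 2)) := by gcongr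
    _ = (κ + 3 * m) * η ^ 3 * ((1 + w ^ 2) * (1 + 2 * u ^ 2 + w ^ 2)) := by ring
    _ ≤ _ := by
      gcongr
      nlinarith [sq_nonneg (u ^ 2 - w ^ 2), sq_nonneg (u ^ 2 - 1), sq_nonneg (w ^ 2 - 1)]

/-- Truncation at the level `L`. For `u ≤ L` the linear branch of the minimum gains a factor `η`, at
the price of a constant depending on `L`; for `L < u` the constant branch leaves only a tail of
fourth order. No moment beyond the fourth is needed. -/
lemma abs_half_mul_le {η u w L H D : ℝ} (hη : 0 ≤ η) (hu : 0 ≤ u) (hw : 0 ≤ w) (hL : 0 ≤ L)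
    (hH : |H| ≤ η * (1 + u ^ 2) + 2 * (u * (η * w)))
    (hD : |D| ≤ η * (1 + u ^ 2) + 2 * (u * (η * w))) :
    |H| * (2 * |D| * min 1 |D|) ≤ 2 * η ^ 2 * ((8 * (1 + L) ^ 6 * η) * (1 + w ^ 4)) +
      2 * η ^ 2 * (if L < u then 2 * (1 + u ^ 2) ^ 2 + 8 * (u ^ 2 * w ^ 2) else 0) := by
  set p := 1 + u ^ 2 + 2 * u * w with hp
  have hp0 : 0 ≤ p := by positivity
  have e : η * (1 + u ^ 2) + 2 * (u * (η * w)) = η * p := by rw [hp]; ring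
  rw [e] at hH hD
  split_ifs with h
  · have : |H| * (2 * |D| * min 1 |D|) ≤ (η * p) * (2 * (η * p) * 1) := by
      gcongr
      exact min_le_left _ _
    have h0 : 0 ≤ 2 * η ^ 2 * ((8 * (1 + L) ^ 6 * η) * (1 + w ^ 4)) := by positivity
    have h1 : p ^ 2 ≤ 2 * (1 + u ^ 2) ^ 2 + 8 * (u ^ 2 * w ^ 2) := by
      rw [hp]
      nlinarith [sq_nonneg (1 + u ^ 2 - 2 * u * w)]
    have h2 := mul_le_mul_of_nonneg_left h1 (by positivity : 0 ≤ 2 * η ^ 2)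
    nlinarith
  · have h1 : |H| * (2 * |D| * min 1 |D|) ≤ (η * p) * (2 * (η * p) * (η * p)) := by
      gcongr
      exact (min_le_right _ _).trans hD
    have h2 : p ≤ (1 + L) ^ 2 * (1 + w) := by
      have := not_lt.1 h
      have h3 : u ^ 2 ≤ L ^ 2 := pow_le_pow_left₀ hu this 2
      have h4 : u * w ≤ L * w := by gcongr
      rw [hp]
      nlinarith [mul_nonneg (sq_nonneg L) hw]
    have h3 : p ^ 3 ≤ (1 + L) ^ 6 * (1 + w) ^ 3 := by
      calc p ^ 3 ≤ ((1 + L) ^ 2 * (1 + w)) ^ 3 := by gcongr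
        _ = _ := by ring
    have h4 : (1 + w) ^ 3 ≤ 8 * (1 + w ^ 4) := by
      nlinarith [sq_nonneg (w ^ 2 - w), sq_nonneg (w ^ 2 - 1), sq_nonneg (w - 1)]
    have h5 : p ^ 3 ≤ (1 + L) ^ 6 * (8 * (1 + w ^ 4)) := h3.trans (by gcongr)
    have h6 := mul_le_mul_of_nonneg_left h5 (by positivity : 0 ≤ 2 * η ^ 3)
    nlinarith

end Pointwise

variable {ν : Measure 𝕜} {κ : ℝ}

/-- The tail of the fourth moment of `ν`. -/
def tailMoment (ν : Measure 𝕜) (L : ℝ) : ℝ := ∫ y, if L < ‖y‖ then (1 + ‖y‖ ^ 2) ^ 2 else 0 ∂ν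

omit [DecidableEq ι] [Fintype ι] in
lemma measurableSet_lt_norm (L : ℝ) : MeasurableSet {y : 𝕜 | L < ‖y‖} :=
  measurableSet_lt measurable_const measurable_norm

variable [IsProbabilityMeasure ν]

lemma GaussianMoments.integrable_one_add_sq (h : GaussianMoments ν κ) :
    Integrable (fun y : 𝕜 ↦ (1 + ‖y‖ ^ 2) ^ 2) ν := by
  have h1 : MemLp (fun y : 𝕜 ↦ 1 + ‖y‖ ^ 2) 2 ν :=
    (memLp_const (p := 2) (μ := ν) (1 : ℝ)).add (MemLp.sq_norm_of_four h.memLp_four)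
  exact h1.integrable_sq

lemma integrable_ite {α : Type*} [MeasurableSpace α] {μ : Measure α} {f : α → ℝ}
    (hf : Integrable f μ) {p : α → Prop} [DecidablePred p] (hp : MeasurableSet {x | p x}) :
    Integrable (fun x ↦ if p x then f x else 0) μ := by
  have := hf.indicator hp
  refine this.congr (ae_of_all _ fun x ↦ ?_)
  simp [Set.indicator_apply]

lemma GaussianMoments.tendsto_tailMoment (h : GaussianMoments ν κ) :
    Tendsto (tailMoment ν) atTop (𝓝 0) := by
  have := tendsto_integral_filter_of_dominated_convergence (μ := ν) (l := (atTop : Filter ℝ))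
    (F := fun L y ↦ if L < ‖y‖ then (1 + ‖y‖ ^ 2) ^ 2 else 0) (f := fun _ ↦ (0 : ℝ))
    (fun y : 𝕜 ↦ (1 + ‖y‖ ^ 2) ^ 2)
    (.of_forall fun L ↦ (integrable_ite h.integrable_one_add_sq (measurableSet_lt_norm L)).1)
    (.of_forall fun L ↦ ae_of_all _ fun y ↦ ?_) h.integrable_one_add_sq (ae_of_all _ fun y ↦ ?_)
  · simpa [tailMoment] using! this
  · split_ifs
    · rw [Real.norm_of_nonneg (by positivity)]
    · simp; positivity
  · refine tendsto_const_nhds.congr' ?_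
    filter_upwards [eventually_ge_atTop ‖y‖] with L hL
    rw [if_neg (not_lt.2 hL)]

section Integrals

variable (h : GaussianMoments ν κ) {A : Matrix ι ι 𝕜} (hA : A.IsHermitian) {η : ℝ}
  (hη : OpBound A η) (b : ι)

include h hA hη

lemma integral_norm_res_sq_le :
    ∫ x, ‖res A b x‖ ^ 2 ∂(Measure.pi fun _ : ι ↦ ν) ≤ η ^ 2 := by
  simp only [res_eq_dotProduct]
  rw [h.integral_norm_sq_dotProduct]
  exact hη.sum_update_le hA b

lemma integral_norm_res_pow_four_le :
    ∫ x, ‖res A b x‖ ^ 4 ∂(Measure.pi fun _ : ι ↦ ν) ≤ (1 + κ) * η ^ 4 := by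
  simp only [res_eq_dotProduct]
  rw [h.integral_norm_pow_four_dotProduct]
  have := h.nonneg
  calc (1 + κ) * (∑ c, ‖Function.update (A b) b 0 c‖ ^ 2) ^ 2 ≤ (1 + κ) * (η ^ 2) ^ 2 := by
        gcongr
        exact hη.sum_update_le hA b
    _ = _ := by ring

omit h in
lemma abs_half_le (x : ι → 𝕜) : |half A b x| ≤ η * (1 + ‖x b‖ ^ 2) + 2 * (‖x b‖ * ‖res A b x‖) := by
  have h1 := hη.abs_re_diag_le hA b
  have h2 : |RCLike.re (star (x b) * res A b x)| ≤ ‖x b‖ * ‖res A b x‖ := by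
    refine (RCLike.abs_re_le_norm _).trans ?_
    rw [norm_mul, norm_star]
  have h3 : |RCLike.re (A b b) * (‖x b‖ ^ 2 - 1)| ≤ η * (1 + ‖x b‖ ^ 2) := by
    rw [abs_mul]
    have : |‖x b‖ ^ 2 - 1| ≤ 1 + ‖x b‖ ^ 2 := by
      rw [abs_le]; constructor <;> nlinarith [sq_nonneg ‖x b‖]
    gcongr
    exact hη.1
  have h4 := abs_add_le (RCLike.re (A b b) * (‖x b‖ ^ 2 - 1)) (RCLike.re (star (x b) * res A b x))
  have h5 : 0 ≤ ‖x b‖ * ‖res A b x‖ := by positivity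
  rw [half]
  linarith

omit h in
lemma abs_incr_le (x : ι → 𝕜) : |incr A b x| ≤ η * (1 + ‖x b‖ ^ 2) + 2 * (‖x b‖ * ‖res A b x‖) := by
  have h1 := hη.abs_re_diag_le hA b
  have h2 : |RCLike.re (star (x b) * res A b x)| ≤ ‖x b‖ * ‖res A b x‖ := by
    refine (RCLike.abs_re_le_norm _).trans ?_
    rw [norm_mul, norm_star]
  have h3 : |RCLike.re (A b b) * (‖x b‖ ^ 2 - 1)| ≤ η * (1 + ‖x b‖ ^ 2) := by
    rw [abs_mul]
    have : |‖x b‖ ^ 2 - 1| ≤ 1 + ‖x b‖ ^ 2 := by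
      rw [abs_le]; constructor <;> nlinarith [sq_nonneg ‖x b‖]
    gcongr
    exact hη.1
  have h4 := abs_add_le (RCLike.re (A b b) * (‖x b‖ ^ 2 - 1))
    (2 * RCLike.re (star (x b) * res A b x))
  rw [abs_mul 2, abs_two] at h4
  rw [incr]
  linarith

lemma abs_condVar_le (x : ι → 𝕜) : |condVar ν κ A b x| ≤
    κ * η ^ 2 + 3 * η * (‖skewness ν‖ * ‖res A b x‖) + κ * ‖res A b x‖ ^ 2 := by
  have h1 := hη.abs_re_diag_le hA b
  have hκ := h.nonneg
  have h2 : |RCLike.re (skewness ν * res A b x)| ≤ ‖skewness ν‖ * ‖res A b x‖ := by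
    refine (RCLike.abs_re_le_norm _).trans ?_
    rw [norm_mul]
  have h3 : RCLike.re (A b b) ^ 2 ≤ η ^ 2 := sq_le_sq' (abs_le.1 h1).1 (abs_le.1 h1).2
  have h4 : |3 * RCLike.re (A b b) * RCLike.re (skewness ν * res A b x)| ≤
      3 * η * (‖skewness ν‖ * ‖res A b x‖) := by
    rw [abs_mul, abs_mul, abs_of_pos (by norm_num : (0 : ℝ) < 3)]
    have := hη.1
    gcongr
  rw [condVar]
  refine (abs_add_three _ _ _).trans ?_
  rw [abs_of_nonneg (by positivity : 0 ≤ κ * RCLike.re (A b b) ^ 2),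
    abs_of_nonneg (by positivity : 0 ≤ κ * ‖res A b x‖ ^ 2)]
  gcongr

lemma integral_condVar_mul_incr_le (hη0 : 0 < η) :
    ∫ x, |condVar ν κ A b x| * |incr A b x| ∂(Measure.pi fun _ : ι ↦ ν) ≤
      (κ + 3 * ‖skewness ν‖) * (8 + 5 * κ) * η ^ 3 := by
  have hκ := h.nonneg
  have i1 := (MemLp.sq_norm_of_four (h.memLp_eval b)).integrable_sq
  have i2 := (MemLp.sq_norm_of_four (h.memLp_res A b)).integrable_sq
  simp only [← pow_mul, Nat.reduceMul] at i1 i2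
  have hle (x : ι → 𝕜) : |condVar ν κ A b x| * |incr A b x| ≤
      (κ + 3 * ‖skewness ν‖) * η ^ 3 * (3 + 2 * ‖x b‖ ^ 4 + 3 * η⁻¹ ^ 4 * ‖res A b x‖ ^ 4) := by
    have hr : ‖res A b x‖ = η * (η⁻¹ * ‖res A b x‖) := by field_simp
    have h1 := abs_condVar_le h hA hη b x
    have h2 := abs_incr_le hA hη b x
    rw [hr] at h1 h2
    have := abs_condVar_mul_incr_le hη.1 hκ (norm_nonneg (skewness ν)) h1 h2
    rwa [mul_pow, ← mul_assoc] at this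
  have hi : Integrable (fun x ↦ 3 + 2 * ‖x b‖ ^ 4 + 3 * η⁻¹ ^ 4 * ‖res A b x‖ ^ 4)
      (Measure.pi fun _ : ι ↦ ν) := ((integrable_const _).add (i1.const_mul _)).add (i2.const_mul _)
  refine (integral_mono_of_nonneg (ae_of_all _ fun x ↦ by positivity) (hi.const_mul _)
    (ae_of_all _ hle)).trans ?_
  rw [integral_const_mul, integral_add_add (integrable_const _) (i1.const_mul _) (i2.const_mul _),
    integral_const_mul, integral_const_mul]
  have e1 : ∫ x : ι → 𝕜, ‖x b‖ ^ 4 ∂(Measure.pi fun _ : ι ↦ ν) = 1 + κ := by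
    rw [integral_eq_integral_update b i1]
    simp [h.fourth]
  have e2 := integral_norm_res_pow_four_le h hA hη b
  have e3 : η⁻¹ ^ 4 * ∫ x, ‖res A b x‖ ^ 4 ∂(Measure.pi fun _ : ι ↦ ν) ≤ 1 + κ := by
    calc _ ≤ η⁻¹ ^ 4 * ((1 + κ) * η ^ 4) := by gcongr
      _ = 1 + κ := by field_simp
  have hm : 0 ≤ (κ + 3 * ‖skewness ν‖) * η ^ 3 := by positivity
  calc _ ≤ (κ + 3 * ‖skewness ν‖) * η ^ 3 * (3 + 2 * (1 + κ) + 3 * (1 + κ)) := by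
        refine mul_le_mul_of_nonneg_left ?_ hm
        rw [e1, mul_assoc 3]
        simp only [integral_const, probReal_univ, one_smul]
        linarith
    _ = _ := by ring

lemma integral_half_remainder_le (hη0 : 0 < η) {L : ℝ} (hL : 0 ≤ L) :
    ∫ x, |half A b x| * (2 * |incr A b x| * min 1 |incr A b x|) ∂(Measure.pi fun _ : ι ↦ ν) ≤
      η ^ 2 * (16 * (1 + L) ^ 6 * (2 + κ) * η + 20 * tailMoment ν L) := by
  have hκ := h.nonneg
  have i1 := (MemLp.sq_norm_of_four (h.memLp_eval b))
  have i2 := (MemLp.sq_norm_of_four (h.memLp_res A b))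
  have i3 := i2.integrable_sq
  simp only [← pow_mul, Nat.reduceMul] at i3
  have hms : MeasurableSet {x : ι → 𝕜 | L < ‖x b‖} :=
    measurableSet_lt measurable_const (measurable_pi_apply b).norm
  have i4 : Integrable (fun x : ι → 𝕜 ↦ if L < ‖x b‖ then (1 + ‖x b‖ ^ 2) ^ 2 else 0)
      (Measure.pi fun _ : ι ↦ ν) := by
    have h1 : MemLp (fun x : ι → 𝕜 ↦ 1 + ‖x b‖ ^ 2) 2 (Measure.pi fun _ : ι ↦ ν) :=
      (memLp_const (p := 2) (μ := Measure.pi fun _ : ι ↦ ν) (1 : ℝ)).add i1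
    exact integrable_ite h1.integrable_sq hms
  have i5 : Integrable (fun x : ι → 𝕜 ↦ if L < ‖x b‖ then ‖x b‖ ^ 2 * ‖res A b x‖ ^ 2 else 0)
      (Measure.pi fun _ : ι ↦ ν) :=
    integrable_ite (i1.integrable_mul i2) hms
  have hle (x : ι → 𝕜) : |half A b x| * (2 * |incr A b x| * min 1 |incr A b x|) ≤
      2 * η ^ 2 * ((8 * (1 + L) ^ 6 * η) * (1 + η⁻¹ ^ 4 * ‖res A b x‖ ^ 4)) +
      (4 * η ^ 2) * (if L < ‖x b‖ then (1 + ‖x b‖ ^ 2) ^ 2 else 0) +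
      16 * (if L < ‖x b‖ then ‖x b‖ ^ 2 * ‖res A b x‖ ^ 2 else 0) := by
    have hr : ‖res A b x‖ = η * (η⁻¹ * ‖res A b x‖) := by field_simp
    have h1 := abs_half_le hA hη b x
    have h2 := abs_incr_le hA hη b x
    rw [hr] at h1 h2
    have := abs_half_mul_le hη.1 (norm_nonneg (x b))
      (by positivity : 0 ≤ η⁻¹ * ‖res A b x‖) hL h1 h2
    rw [mul_pow, mul_pow] at this
    refine this.trans (le_of_eq ?_)
    split_ifs
    · field_simp
      ring
    · ring
  have hi1 : Integrable (fun x ↦ 2 * η ^ 2 * ((8 * (1 + L) ^ 6 * η) *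
      (1 + η⁻¹ ^ 4 * ‖res A b x‖ ^ 4))) (Measure.pi fun _ : ι ↦ ν) :=
    (((integrable_const _).add (i3.const_mul _)).const_mul _).const_mul _
  refine (integral_mono_of_nonneg (ae_of_all _ fun x ↦ by positivity)
    ((hi1.add (i4.const_mul _)).add (i5.const_mul _)) (ae_of_all _ hle)).trans ?_
  have e1 : ∫ x : ι → 𝕜, (if L < ‖x b‖ then (1 + ‖x b‖ ^ 2) ^ 2 else 0)
      ∂(Measure.pi fun _ : ι ↦ ν) = tailMoment ν L := by
    rw [integral_eq_integral_update b i4]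
    simp [tailMoment]
  -- The residual does not involve `x b`, so the integral factorises into a tail of `ν` and a second
  -- moment of the residual.
  have e2 : ∫ x : ι → 𝕜, (if L < ‖x b‖ then ‖x b‖ ^ 2 * ‖res A b x‖ ^ 2 else 0)
      ∂(Measure.pi fun _ : ι ↦ ν) ≤ η ^ 2 * tailMoment ν L := by
    rw [integral_eq_integral_update b i5]
    have h0 : ∫ y : 𝕜, (if L < ‖y‖ then ‖y‖ ^ 2 else 0) ∂ν ≤ tailMoment ν L := by
      refine integral_mono_of_nonneg (ae_of_all _ fun y ↦ ?_)
        (integrable_ite h.integrable_one_add_sq (measurableSet_lt_norm L)) (ae_of_all _ fun y ↦ ?_)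
      · simp only [Pi.zero_apply]; split_ifs <;> positivity
      · simp only; split_ifs
        · nlinarith [sq_nonneg (‖y‖ ^ 2), sq_nonneg ‖y‖]
        · rfl
    have h1 (x : ι → 𝕜) (y : 𝕜) : (if L < ‖y‖ then ‖y‖ ^ 2 * ‖res A b x‖ ^ 2 else 0) =
        (if L < ‖y‖ then ‖y‖ ^ 2 else 0) * ‖res A b x‖ ^ 2 := by split_ifs <;> simp
    simp only [Function.update_self, res_update, h1, integral_mul_const]
    rw [integral_const_mul, mul_comm]
    have h2 := integral_norm_res_sq_le h hA hη b
    have h3 : 0 ≤ ∫ x, ‖res A b x‖ ^ 2 ∂(Measure.pi fun _ : ι ↦ ν) := integral_nonneg fun x ↦ by positivity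
    have h4 : 0 ≤ tailMoment ν L := integral_nonneg fun x ↦ by
      simp only [Pi.zero_apply]; split_ifs <;> positivity
    calc _ ≤ (∫ x, ‖res A b x‖ ^ 2 ∂(Measure.pi fun _ : ι ↦ ν)) * tailMoment ν L := by gcongr
      _ ≤ _ := by gcongr
  have e3 : η⁻¹ ^ 4 * ∫ x, ‖res A b x‖ ^ 4 ∂(Measure.pi fun _ : ι ↦ ν) ≤ 1 + κ := by
    calc _ ≤ η⁻¹ ^ 4 * ((1 + κ) * η ^ 4) := by
          gcongr; exact integral_norm_res_pow_four_le h hA hη b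
      _ = 1 + κ := by field_simp
  have e4 : ∫ x, (2 * η ^ 2 * ((8 * (1 + L) ^ 6 * η) *
      (1 + η⁻¹ ^ 4 * ‖res A b x‖ ^ 4))) ∂(Measure.pi fun _ : ι ↦ ν) ≤
      2 * η ^ 2 * ((8 * (1 + L) ^ 6 * η) * (2 + κ)) := by
    rw [integral_const_mul, integral_const_mul, integral_add (integrable_const _) (i3.const_mul _),
      integral_const_mul]
    simp only [integral_const, probReal_univ, one_smul]
    rw [show 2 + κ = 1 + (1 + κ) by ring]
    gcongr
  simp only [Pi.add_apply]
  rw [integral_add_add hi1 (i4.const_mul _) (i5.const_mul _), integral_const_mul (4 * η ^ 2),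
    integral_const_mul 16, e1]
  linarith

-- The fluctuation of `∑ condVar` is itself a centred quadratic form, that of the Gram matrix of the
-- off-diagonal part, plus a linear form weighted by the third moment. Its second moment is
-- therefore accessible to the formulas above.
omit hη h [IsProbabilityMeasure ν] in
lemma sum_condVar_sub_eq (x : ι → 𝕜) :
    κ * ∑ b, ∑ c, ‖A b c‖ ^ 2 - ∑ b, condVar ν κ A b x =
      -(κ * quad ((offDiag A)ᴴ * offDiag A) x +
        3 * RCLike.re (skewness ν * ((fun b ↦ ((RCLike.re (A b b) : ℝ) : 𝕜)) ᵥ* offDiag A) ⬝ᵥ x)) := by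
  have e1 : hform ((offDiag A)ᴴ * offDiag A) x = ∑ b, ‖res A b x‖ ^ 2 := by
    have := hform_conj (offDiag A) 1 x
    rw [Matrix.mul_one] at this
    rw [this, hform_one]
    simp only [offDiag_mulVec]
  have e2 : RCLike.re ((offDiag A)ᴴ * offDiag A).trace =
      ∑ b, ∑ c, ‖Function.update (A b) b 0 c‖ ^ 2 := by
    simp only [← sum_norm_sq_offDiag]
    rw [Finset.sum_comm]
    simp only [trace, diag_apply, mul_apply, map_sum, conjTranspose_apply, RCLike.star_def,
      RCLike.conj_mul, ← RCLike.ofReal_pow, RCLike.ofReal_re]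
  have e3 : skewness ν * ((fun b ↦ ((RCLike.re (A b b) : ℝ) : 𝕜)) ᵥ* offDiag A) ⬝ᵥ x =
      ∑ b, ((RCLike.re (A b b) : ℝ) : 𝕜) * (skewness ν * res A b x) := by
    rw [← dotProduct_mulVec, dotProduct, Finset.mul_sum]
    refine Finset.sum_congr rfl fun b _ ↦ ?_
    rw [offDiag_mulVec]; ring
  rw [← sum_condVar_eq hA, quad, e1, e2, e3, map_sum]
  simp only [condVar, RCLike.re_ofReal_mul, Finset.sum_add_distrib, ← Finset.mul_sum, mul_assoc]
  ring

/-- By Cauchy–Schwarz the first absolute moments are bounded by the square roots of the second ones.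
In dimension `N` these have order `√N η²`, which tends to zero when `N η²` is bounded and `η` tends
to zero. -/
lemma integral_abs_sum_condVar_sub_le :
    ∫ x, |κ * ∑ b, ∑ c, ‖A b c‖ ^ 2 - ∑ b, condVar ν κ A b x| ∂(Measure.pi fun _ : ι ↦ ν) ≤
      (4 * κ * √κ + 6 * ‖skewness ν‖) * (√(Fintype.card ι) * η ^ 2) := by
  have hκ := h.nonneg
  have hO := hη.offDiag hA
  have hOH := offDiag_isHermitian hA
  have hη0 := hη.1
  set B := (offDiag A)ᴴ * offDiag A with hB
  have hBH : B.IsHermitian := isHermitian_conjTranspose_mul_self _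
  set w : ι → 𝕜 := (fun b ↦ ((RCLike.re (A b b) : ℝ) : 𝕜)) ᵥ* offDiag A with hw
  have cs {f : (ι → 𝕜) → ℝ} (hf : MemLp f 2 (Measure.pi fun _ : ι ↦ ν)) {C : ℝ} (hC : 0 ≤ C)
      (hfC : ∫ x, f x ^ 2 ∂(Measure.pi fun _ : ι ↦ ν) ≤ C ^ 2) :
      ∫ x, |f x| ∂(Measure.pi fun _ : ι ↦ ν) ≤ C := by
    have := ProbabilityTheory.variance_nonneg (fun x ↦ |f x|) (Measure.pi fun _ : ι ↦ ν)
    rw [ProbabilityTheory.variance_eq_sub (X := fun x ↦ |f x|) hf.abs] at this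
    simp only [Pi.pow_apply, sq_abs] at this
    exact (abs_le_of_sq_le_sq' (by linarith) hC).2
  have b1 : ∫ x, |quad B x| ∂(Measure.pi fun _ : ι ↦ ν) ≤ 4 * √κ * √(Fintype.card ι) * η ^ 2 := by
    refine cs (h.memLp_quad B) (by positivity) ?_
    rw [h.integral_quad_sq hBH]
    have e : (4 * √κ * √(Fintype.card ι) * η ^ 2) ^ 2 = κ * (Fintype.card ι * (4 * η ^ 2) ^ 2) := by
      rw [mul_pow, mul_pow, mul_pow, Real.sq_sqrt hκ, Real.sq_sqrt (by positivity)]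
      ring
    rw [e]
    gcongr
    have hBop : OpBound B (4 * η ^ 2) := by
      refine ⟨by positivity, fun x ↦ ?_⟩
      rw [hB, hOH.eq]
      have h1 := hO.2 (offDiag A *ᵥ x)
      rw [mulVec_mulVec] at h1
      refine h1.trans ?_
      calc _ ≤ (2 * η) ^ 2 * ((2 * η) ^ 2 * ∑ i, ‖x i‖ ^ 2) := by gcongr; exact hO.2 x
        _ = _ := by ring
    calc ∑ b, ∑ c, ‖B b c‖ ^ 2 ≤ ∑ b : ι, (4 * η ^ 2) ^ 2 :=
          Finset.sum_le_sum fun b _ ↦ hBop.sum_row_le hBH b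
      _ = _ := by simp
  have b2 : ∫ x, ‖w ⬝ᵥ x‖ ∂(Measure.pi fun _ : ι ↦ ν) ≤ 2 * √(Fintype.card ι) * η ^ 2 := by
    have hw4 := (h.memLp_dotProduct w).mono_exponent (show (2 : ENNReal) ≤ 4 by norm_num)
    have := cs hw4.norm (C := 2 * √(Fintype.card ι) * η ^ 2) (by positivity) ?_
    · simpa using this
    rw [h.integral_norm_sq_dotProduct]
    have e : (2 * √(Fintype.card ι) * η ^ 2) ^ 2 = (2 * η) ^ 2 * (Fintype.card ι * η ^ 2) := by
      rw [mul_pow, mul_pow, Real.sq_sqrt (by positivity)]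
      ring
    rw [e]
    have h1 := hO.2 (fun b ↦ ((RCLike.re (A b b) : ℝ) : 𝕜))
    have h2 : ∑ i, ‖w i‖ ^ 2 = ∑ i, ‖(offDiag A *ᵥ fun b ↦ ((RCLike.re (A b b) : ℝ) : 𝕜)) i‖ ^ 2 := by
      refine Finset.sum_congr rfl fun i _ ↦ ?_
      congr 1
      rw [hw, ← norm_star]
      congr 1
      rw [vecMul, mulVec, dotProduct, dotProduct, star_sum]
      refine Finset.sum_congr rfl fun j _ ↦ ?_
      rw [star_mul', hOH.apply, RCLike.star_def, RCLike.conj_ofReal, mul_comm]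
    rw [h2]
    refine h1.trans ?_
    gcongr
    calc ∑ i, ‖((RCLike.re (A i i) : ℝ) : 𝕜)‖ ^ 2 ≤ ∑ i : ι, η ^ 2 := by
          refine Finset.sum_le_sum fun i _ ↦ ?_
          rw [RCLike.norm_ofReal]
          gcongr
          exact hη.abs_re_diag_le hA i
      _ = _ := by simp
  have i1 : Integrable (fun x ↦ |quad B x|) (Measure.pi fun _ : ι ↦ ν) :=
    ((h.memLp_quad B).integrable one_le_two).abs
  have i2 : Integrable (fun x : ι → 𝕜 ↦ ‖w ⬝ᵥ x‖) (Measure.pi fun _ : ι ↦ ν) :=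
    ((h.memLp_dotProduct w).integrable (by norm_num)).norm
  calc _ ≤ ∫ x, (κ * |quad B x| + 3 * ‖skewness ν‖ * ‖w ⬝ᵥ x‖) ∂(Measure.pi fun _ : ι ↦ ν) := by
        refine integral_mono_of_nonneg (ae_of_all _ fun x ↦ abs_nonneg _)
          ((i1.const_mul _).add (i2.const_mul _)) (ae_of_all _ fun x ↦ ?_)
        simp only
        rw [sum_condVar_sub_eq hA, abs_neg]
        refine (abs_add_le _ _).trans ?_
        rw [abs_mul, abs_of_nonneg hκ, abs_mul, abs_of_pos (by norm_num : (0 : ℝ) < 3), mul_assoc 3,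
          ← norm_mul]
        gcongr
        exact RCLike.abs_re_le_norm _
    _ ≤ κ * (4 * √κ * √(Fintype.card ι) * η ^ 2) +
        3 * ‖skewness ν‖ * (2 * √(Fintype.card ι) * η ^ 2) := by
        rw [integral_add (i1.const_mul _) (i2.const_mul _), integral_const_mul, integral_const_mul]
        gcongr
    _ = _ := by ring

lemma charError_le (hη0 : 0 < η) {L : ℝ} (hL : 0 ≤ L) : charError ν κ A ≤
    Fintype.card ι * η ^ 2 * ((κ + 3 * ‖skewness ν‖) * (8 + 5 * κ) * η +
      16 * (1 + L) ^ 6 * (2 + κ) * η + 20 * tailMoment ν L) +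
      (4 * κ * √κ + 6 * ‖skewness ν‖) * (√(Fintype.card ι) * η ^ 2) := by
  have h1 := Finset.sum_le_sum fun b (_ : b ∈ Finset.univ) ↦
    integral_condVar_mul_incr_le h hA hη b hη0
  have h2 := Finset.sum_le_sum fun b (_ : b ∈ Finset.univ) ↦
    integral_half_remainder_le h hA hη b hη0 hL
  have h3 := integral_abs_sum_condVar_sub_le h hA hη
  simp only [Finset.sum_const, Finset.card_univ, nsmul_eq_mul] at h1 h2
  rw [charError]
  linarith

end Integrals

end CharErrorBound

/-! ### Central limit theorem for one form, and reduction of many forms to one. -/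

section BlockForms

open Matrix

variable {𝕜 : Type*} [RCLike 𝕜] {ν : Measure 𝕜} [IsProbabilityMeasure ν] {κ : ℝ}

/-- The order of the choices matters: `L` is taken first, making the tail small against the bound
`C` on dimension times `η²`; then `η → 0` absorbs the constants depending on `L`. -/
lemma GaussianMoments.tendsto_charFun_quad (h : GaussianMoments ν κ) {ι : ℕ → Type*}
    [∀ n, Fintype (ι n)] [∀ n, DecidableEq (ι n)] (A : (n : ℕ) → Matrix (ι n) (ι n) 𝕜)
    (hA : ∀ n, (A n).IsHermitian) {η : ℕ → ℝ} (hη0 : ∀ᶠ n in atTop, 0 < η n)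
    (hη : ∀ᶠ n in atTop, OpBound (A n) (η n)) (hηt : Tendsto η atTop (𝓝 0)) {C : ℝ}
    (hC : ∀ᶠ n in atTop, Fintype.card (ι n) * η n ^ 2 ≤ C) {v : ℝ}
    (hv : Tendsto (fun n ↦ κ * ∑ b, ∑ c, ‖A n b c‖ ^ 2) atTop (𝓝 v)) :
    Tendsto (fun n ↦ ∫ x, eI (quad (A n) x) ∂(Measure.pi fun _ : ι n ↦ ν)) atTop
      (𝓝 (Complex.exp (-(v : ℂ) / 2))) := by
  have hκ := h.nonneg
  have hC0 : 0 ≤ C := by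
    obtain ⟨n, hn⟩ := hC.exists
    exact le_trans (by positivity) hn
  have herr : Tendsto (fun n ↦ charError ν κ (A n)) atTop (𝓝 0) := by
    rw [Metric.tendsto_atTop']
    suffices ∀ ε > 0, ∀ᶠ n in atTop, |charError ν κ (A n)| < ε by
      intro ε hε
      obtain ⟨N, hN⟩ := eventually_atTop.1 (this ε hε)
      exact ⟨N, fun n hn ↦ by simpa [Real.dist_eq] using hN n hn.le⟩
    intro ε hε
    have htail := h.tendsto_tailMoment.const_mul (C * 20)
    rw [mul_zero] at htail
    obtain ⟨L, hLε, hL0⟩ := ((htail.eventually_lt_const hε).and (eventually_ge_atTop 0)).exists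
    have hlim : Tendsto (fun n ↦ C * ((κ + 3 * ‖skewness ν‖) * (8 + 5 * κ) * η n +
      16 * (1 + L) ^ 6 * (2 + κ) * η n + 20 * tailMoment ν L) +
      (4 * κ * √κ + 6 * ‖skewness ν‖) * (√C * η n)) atTop (𝓝 (C * ((κ + 3 * ‖skewness ν‖) *
      (8 + 5 * κ) * 0 + 16 * (1 + L) ^ 6 * (2 + κ) * 0 + 20 * tailMoment ν L) +
      (4 * κ * √κ + 6 * ‖skewness ν‖) * (√C * 0))) := by
      exact ((((hηt.const_mul _).add (hηt.const_mul _)).add tendsto_const_nhds).const_mul _).add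
        ((hηt.const_mul _).const_mul _)
    have hlt : (C * ((κ + 3 * ‖skewness ν‖) *
      (8 + 5 * κ) * 0 + 16 * (1 + L) ^ 6 * (2 + κ) * 0 + 20 * tailMoment ν L) +
      (4 * κ * √κ + 6 * ‖skewness ν‖) * (√C * 0)) < ε := by
      simp only [mul_zero, zero_add, add_zero]
      linarith
    filter_upwards [hη0, hη, hC, hlim.eventually_lt_const hlt] with n h0 h1 h2 h3
    have hnn : 0 ≤ charError ν κ (A n) := by unfold charError; positivity
    rw [abs_of_nonneg hnn]
    refine ((charError_le h (hA n) h1 h0 hL0).trans ?_).trans_lt h3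
    have htm : 0 ≤ tailMoment ν L := integral_nonneg fun x ↦ by
      simp only [Pi.zero_apply]; split_ifs <;> positivity
    have hs : √(Fintype.card (ι n)) * η n ^ 2 ≤ √C * η n := by
      have : √(Fintype.card (ι n)) * η n ≤ √C := by
        rw [← Real.sqrt_sq h0.le, ← Real.sqrt_mul (by positivity)]
        exact Real.sqrt_le_sqrt h2
      nlinarith
    gcongr
  have hexp : Tendsto (fun n ↦ Complex.exp (-((κ * ∑ b, ∑ c, ‖A n b c‖ ^ 2 : ℝ) : ℂ) / 2)) atTop
      (𝓝 (Complex.exp (-(v : ℂ) / 2))) := by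
    refine (Complex.continuous_exp.tendsto _).comp ?_
    exact (((Complex.continuous_ofReal.tendsto v).comp hv).neg).div_const 2
  have hdiff := squeeze_zero_norm (fun n ↦ h.norm_charFun_quad_sub_le (hA n)) herr
  simpa using hdiff.add hexp

variable {K : Type*} [Fintype K] [DecidableEq K] {ι : Type*} [Fintype ι] [DecidableEq ι]

/-- The centred sesquilinear form `x_s* A x_t - δ_{st} tr A` in the blocks of the vector `x`. -/
def bil (A : Matrix ι ι 𝕜) (s t : K) (x : K × ι → 𝕜) : 𝕜 :=
  (star fun i ↦ x (s, i)) ⬝ᵥ A *ᵥ (fun i ↦ x (t, i)) - if s = t then A.trace else 0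

/-- The matrix with blocks `(1/2) (conj (T s t) + T t s) A s`. -/
def blockForm (T : Matrix K K 𝕜) (A : K → Matrix ι ι 𝕜) : Matrix (K × ι) (K × ι) 𝕜 :=
  of fun p q ↦ hermPart T q.1 p.1 * A p.1 p.2 q.2

variable {T : Matrix K K 𝕜} {A : K → Matrix ι ι 𝕜}

omit [Fintype K] [DecidableEq K] [Fintype ι] [DecidableEq ι] in
lemma hermPart_apply (s t : K) : hermPart T s t = ((1 / 2 : ℝ) : 𝕜) * (T s t + star (T t s)) := by
  simp [hermPart]

omit [Fintype K] [DecidableEq K] [Fintype ι] [DecidableEq ι] in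
lemma hermPart_mul_congr (hT : ∀ s t, T s t ≠ 0 → A s = A t) (s t : K) (i j : ι) :
    hermPart T s t * A s i j = hermPart T s t * A t i j := by
  by_cases h1 : T s t = 0
  · by_cases h2 : T t s = 0
    · simp [hermPart_apply, h1, h2]
    · rw [hT t s h2]
  · rw [hT s t h1]

omit [Fintype K] [DecidableEq K] [Fintype ι] [DecidableEq ι] in
lemma blockForm_isHermitian (hA : ∀ s, (A s).IsHermitian) (hT : ∀ s t, T s t ≠ 0 → A s = A t) :
    (blockForm T A).IsHermitian := by
  ext p q
  rw [conjTranspose_apply, blockForm, of_apply, of_apply, star_mul', (hermPart_isHermitian T).apply,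
    (hA q.1).apply, hermPart_mul_congr hT]

-- This is the Cramér–Wold device: a real linear functional of the forms between the blocks is one
-- quadratic form in the concatenated vector. Replacing `T` by its Hermitian part is harmless
-- because exchanging two blocks conjugates the form, and `hT` allows different matrices in blocks
-- that `T` does not couple.
omit [DecidableEq ι] in
lemma quad_blockForm (hA : ∀ s, (A s).IsHermitian) (hT : ∀ s t, T s t ≠ 0 → A s = A t)
    (x : K × ι → 𝕜) : quad (blockForm T A) x = ∑ s, ∑ t, RCLike.re (star (T s t) * bil (A s) s t x) := by
  set Z : K → K → 𝕜 := fun s t ↦ (star fun i ↦ x (s, i)) ⬝ᵥ A s *ᵥ (fun i ↦ x (t, i)) with hZ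
  have hZT (s t : K) : star (T s t * Z t s) = star (T s t) * Z s t := by
    by_cases h : T s t = 0
    · simp [h]
    · rw [star_mul']
      congr 1
      simp only [hZ]
      rw [← hT s t h, star_dotProduct, star_mulVec, star_star, (hA s).eq, dotProduct_mulVec]
  have e1 : hform (blockForm T A) x = ∑ s, ∑ t, RCLike.re (hermPart T t s * Z s t) := by
    simp only [hform, dotProduct, mulVec, blockForm, of_apply, Fintype.sum_prod_type, hZ, map_sum,
      Finset.mul_sum, Pi.star_apply]
    refine Finset.sum_congr rfl fun s _ ↦ ?_
    rw [Finset.sum_comm]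
    refine Finset.sum_congr rfl fun t _ ↦ Finset.sum_congr rfl fun i _ ↦
      Finset.sum_congr rfl fun j _ ↦ ?_
    congr 1
    ring
  have e2 : ∑ s, ∑ t, RCLike.re (hermPart T t s * Z s t) =
      ∑ s, ∑ t, RCLike.re (star (T s t) * Z s t) := by
    have e3 (s t : K) : RCLike.re (hermPart T t s * Z s t) = 1 / 2 * RCLike.re (T t s * Z s t) +
        1 / 2 * RCLike.re (star (T s t) * Z s t) := by
      rw [hermPart_apply, mul_assoc, RCLike.re_ofReal_mul, add_mul, map_add]
      ring
    have e4 : ∑ s, ∑ t, RCLike.re (T t s * Z s t) = ∑ s, ∑ t, RCLike.re (star (T s t) * Z s t) := by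
      rw [Finset.sum_comm]
      refine Finset.sum_congr rfl fun s _ ↦ Finset.sum_congr rfl fun t _ ↦ ?_
      rw [← hZT, RCLike.star_def, RCLike.conj_re]
    simp only [e3, Finset.sum_add_distrib, ← Finset.mul_sum, e4]
    ring
  have e5 : RCLike.re (blockForm T A).trace =
      ∑ s, ∑ t, RCLike.re (star (T s t) * if s = t then (A s).trace else 0) := by
    have htr (s : K) : (((RCLike.re (A s).trace : ℝ)) : 𝕜) = (A s).trace := by
      rw [← RCLike.conj_eq_iff_re, ← RCLike.star_def, ← trace_conjTranspose, (hA s).eq]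
    have e6 (s t : K) : RCLike.re (star (T s t) * if s = t then (A s).trace else 0) =
        if s = t then RCLike.re (hermPart T s s) * RCLike.re (A s).trace else 0 := by
      split_ifs with hst
      · subst hst
        rw [← htr s, RCLike.re_mul_ofReal, RCLike.star_def, RCLike.conj_re, hermPart_apply,
          RCLike.re_ofReal_mul, map_add, RCLike.star_def, RCLike.conj_re, RCLike.ofReal_re]
        ring
      · simp
    simp only [e6, Finset.sum_ite_eq, Finset.mem_univ, if_true]
    have hre (s : K) : (((RCLike.re (hermPart T s s) : ℝ)) : 𝕜) = hermPart T s s :=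
      RCLike.conj_eq_iff_re.1 ((hermPart_isHermitian T).apply s s)
    simp only [trace, diag_apply, blockForm, of_apply, Fintype.sum_prod_type, map_sum, Finset.mul_sum]
    refine Finset.sum_congr rfl fun s _ ↦ Finset.sum_congr rfl fun i _ ↦ ?_
    rw [← hre s, RCLike.re_ofReal_mul, RCLike.ofReal_re]
  rw [quad, e1, e2, e5, ← Finset.sum_sub_distrib]
  refine Finset.sum_congr rfl fun s _ ↦ ?_
  rw [← Finset.sum_sub_distrib]
  refine Finset.sum_congr rfl fun t _ ↦ ?_
  rw [← map_sub, ← mul_sub]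
  rfl

omit [DecidableEq K] [DecidableEq ι] in
lemma sum_norm_sq_blockForm : ∑ p, ∑ q, ‖blockForm T A p q‖ ^ 2 =
    ∑ s, (∑ t, ‖hermPart T t s‖ ^ 2) * ∑ i, ∑ j, ‖A s i j‖ ^ 2 := by
  simp only [blockForm, of_apply, Fintype.sum_prod_type, norm_mul, mul_pow]
  refine Finset.sum_congr rfl fun s _ ↦ ?_
  rw [Finset.sum_comm, Finset.sum_mul]
  simp only [Finset.mul_sum]

omit [DecidableEq K] [DecidableEq ι] in
lemma opBound_blockForm {C : ℝ} (hA : ∀ s, OpBound (A s) C) (hC : 0 ≤ C) :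
    OpBound (blockForm T A) (C * √(∑ s, ∑ t, ‖hermPart T t s‖ ^ 2)) := by
  refine ⟨by positivity, fun x ↦ ?_⟩
  rw [mul_pow, Real.sq_sqrt (by positivity)]
  simp only [Fintype.sum_prod_type]
  have e (s : K) (i : ι) : (blockForm T A *ᵥ x) (s, i) =
      ∑ t, hermPart T t s * (A s *ᵥ fun j ↦ x (t, j)) i := by
    simp only [mulVec, dotProduct, blockForm, of_apply, Fintype.sum_prod_type, Finset.mul_sum,
      mul_assoc]
  have h1 (s : K) (i : ι) : ‖(blockForm T A *ᵥ x) (s, i)‖ ^ 2 ≤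
      (∑ t, ‖hermPart T t s‖ ^ 2) * ∑ t, ‖(A s *ᵥ fun j ↦ x (t, j)) i‖ ^ 2 := by
    rw [e]
    refine le_trans (pow_le_pow_left₀ (norm_nonneg _) (norm_sum_le _ _) 2) ?_
    simp only [norm_mul]
    exact Finset.sum_mul_sq_le_sq_mul_sq _ _ _
  calc _ ≤ ∑ s, ∑ i, (∑ t, ‖hermPart T t s‖ ^ 2) * ∑ t, ‖(A s *ᵥ fun j ↦ x (t, j)) i‖ ^ 2 :=
        Finset.sum_le_sum fun s _ ↦ Finset.sum_le_sum fun i _ ↦ h1 s i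
    _ = ∑ s, (∑ t, ‖hermPart T t s‖ ^ 2) * ∑ t, ∑ i, ‖(A s *ᵥ fun j ↦ x (t, j)) i‖ ^ 2 := by
        refine Finset.sum_congr rfl fun s _ ↦ ?_
        rw [← Finset.mul_sum, Finset.sum_comm]
    _ ≤ ∑ s, (∑ t, ‖hermPart T t s‖ ^ 2) * ∑ t, C ^ 2 * ∑ i, ‖x (t, i)‖ ^ 2 := by
        refine Finset.sum_le_sum fun s _ ↦ mul_le_mul_of_nonneg_left
          (Finset.sum_le_sum fun t _ ↦ (hA s).2 _) (by positivity)
    _ = _ := by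
        rw [← Finset.sum_mul, ← Finset.mul_sum]
        ring

omit [Fintype K] [DecidableEq ι] in
lemma measurable_bil (A : Matrix ι ι 𝕜) (s t : K) : Measurable (bil A s t) := by
  unfold bil dotProduct mulVec dotProduct
  simp only [Pi.star_apply]
  fun_prop

/-- Second moment of the entries of the random matrix `(x_s* A x_t - δ_{st} tr A)`. -/
lemma GaussianMoments.integral_norm_sq_bil_le (h : GaussianMoments ν κ) {A : Matrix ι ι 𝕜}
    (hA : A.IsHermitian) (s t : K) :
    Integrable (fun x ↦ ‖bil A s t x‖ ^ 2) (Measure.pi fun _ : K × ι ↦ ν) ∧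
    ∫ x, ‖bil A s t x‖ ^ 2 ∂(Measure.pi fun _ : K × ι ↦ ν) ≤
      8 * κ * ∑ i, ∑ j, ‖A i j‖ ^ 2 := by
  have hκ := h.nonneg
  -- The choices `c = 1` and `c = I` recover the real and imaginary parts, each of them a quadratic
  -- form with a single-entry coefficient matrix. In the real case `I = 0` and the second choice
  -- contributes nothing.
  have key (c : 𝕜) (hc : ‖c‖ ≤ 1) :
      MemLp (fun x ↦ RCLike.re (star c * bil A s t x)) 2 (Measure.pi fun _ : K × ι ↦ ν) ∧
      ∫ x, RCLike.re (star c * bil A s t x) ^ 2 ∂(Measure.pi fun _ : K × ι ↦ ν) ≤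
        4 * κ * ∑ i, ∑ j, ‖A i j‖ ^ 2 := by
    have hq (x : K × ι → 𝕜) : quad (blockForm (Matrix.single s t c) fun _ ↦ A) x =
        RCLike.re (star c * bil A s t x) := by
      rw [quad_blockForm (fun _ ↦ hA) (fun _ _ _ ↦ rfl), Finset.sum_eq_single s, Finset.sum_eq_single t]
      · simp
      · intro t' _ ht'
        simp [ht'.symm]
      · simp
      · intro s' _ hs'
        refine Finset.sum_eq_zero fun t' _ ↦ ?_
        simp [hs'.symm]
      · simp
    have hH := blockForm_isHermitian (T := Matrix.single s t c) (A := fun _ ↦ A) (fun _ ↦ hA)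
      (fun _ _ _ ↦ rfl)
    have h1 := h.memLp_quad (blockForm (Matrix.single s t c) fun _ ↦ A)
    have h2 := h.integral_quad_sq hH
    simp only [hq] at h2
    rw [funext hq] at h1
    refine ⟨h1, ?_⟩
    rw [h2, sum_norm_sq_blockForm, ← Finset.sum_mul]
    have h3 : ∑ s', ∑ t', ‖hermPart (Matrix.single s t c) t' s'‖ ^ 2 ≤ 4 := by
      have h4 (s' t' : K) : ‖hermPart (Matrix.single s t c) t' s'‖ ^ 2 ≤
          2 * (if s = t' then if t = s' then 1 else 0 else 0) +
            2 * (if s = s' then if t = t' then 1 else 0 else 0) := by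
        have hn : ∀ a b : K, ‖Matrix.single s t c a b‖ ≤ if s = a then if t = b then 1 else 0 else 0 := by
          intro a b
          rw [Matrix.single_apply]
          split_ifs <;> simp_all
        have h01 : ∀ a b : K, (if s = a then if t = b then (1 : ℝ) else 0 else 0) ^ 2 =
            if s = a then if t = b then (1 : ℝ) else 0 else 0 := by
          intro a b; split_ifs <;> simp
        rw [hermPart_apply, norm_mul, RCLike.norm_ofReal]
        have h5 := norm_add_le (Matrix.single s t c t' s') (star (Matrix.single s t c s' t'))
        rw [norm_star] at h5
        have h6 := hn t' s'
        have h7 := hn s' t'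
        rw [← h01 t' s', ← h01 s' t']
        set α := if s = t' then if t = s' then (1 : ℝ) else 0 else 0
        set β := if s = s' then if t = t' then (1 : ℝ) else 0 else 0
        have h8 : ‖Matrix.single s t c t' s' + star (Matrix.single s t c s' t')‖ ≤ α + β := by linarith
        have h9 := pow_le_pow_left₀ (norm_nonneg _) h8 2
        rw [mul_pow, show |(1 / 2 : ℝ)| ^ 2 = 1 / 4 by norm_num [abs_of_pos]]
        nlinarith [sq_nonneg (α - β), sq_nonneg α, sq_nonneg β]
      refine (Finset.sum_le_sum fun s' _ ↦ Finset.sum_le_sum fun t' _ ↦ h4 s' t').trans ?_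
      simp only [Finset.sum_add_distrib, ← Finset.mul_sum, Finset.sum_ite_eq, Finset.mem_univ, if_true]
      simp
      norm_num
    have h5 : 0 ≤ ∑ i, ∑ j, ‖A i j‖ ^ 2 := by positivity
    calc κ * ((∑ s', ∑ t', ‖hermPart (Matrix.single s t c) t' s'‖ ^ 2) * ∑ i, ∑ j, ‖A i j‖ ^ 2)
        ≤ κ * (4 * ∑ i, ∑ j, ‖A i j‖ ^ 2) := by gcongr
      _ = _ := by ring
  obtain ⟨m1, b1⟩ := key 1 (by simp)
  obtain ⟨m2, b2⟩ := key RCLike.I (by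
    rcases RCLike.I_mul_I_ax (K := 𝕜) with h0 | h0
    · simp [h0]
    · exact (RCLike.norm_I_of_ne_zero (fun h1 ↦ by rw [h1] at h0; simp at h0)).le)
  have e (x : K × ι → 𝕜) : ‖bil A s t x‖ ^ 2 = RCLike.re (star 1 * bil A s t x) ^ 2 +
      RCLike.re (star (RCLike.I : 𝕜) * bil A s t x) ^ 2 := by
    rw [RCLike.norm_sq_eq_def]
    simp
    rcases RCLike.I_mul_I_ax (K := 𝕜) with h0 | h0
    · have h1 : RCLike.im (bil A s t x) = 0 := by
        have h2 := RCLike.mul_im_I_ax (bil A s t x)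
        rw [h0] at h2
        simpa using h2.symm
      simp [h1, sq]
    · have h1 := RCLike.mul_im_I_ax (bil A s t x)
      nlinarith [h1]
  simp only [e]
  refine ⟨m1.integrable_sq.add m2.integrable_sq, ?_⟩
  rw [integral_add m1.integrable_sq m2.integrable_sq]
  linarith

end BlockForms

/-! ### Linear statistics of the unperturbed spectrum. -/

section Spectral

variable {𝕜 : Type*} [RCLike 𝕜]

lemma integral_spectralMeasure {n : ℕ} {A : Matrix (Fin n) (Fin n) 𝕜} (hA : A.IsHermitian)
    (f : ℝ → ℝ) : ∫ x, f x ∂(spectralMeasure A) = (n : ℝ)⁻¹ * ∑ i, f (hA.eigenvalues i) := by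
  rw [spectralMeasure, integral_smul_measure, integral_finsetSum_measure]
  · simp [sum_eig hA f]
  · exact fun i _ ↦ integrable_dirac (by simp)

variable {μ : Measure ℝ}

lemma ae_mem_Icc (hc : IsCompact μ.support) :
    ∀ᵐ x ∂μ, x ∈ Set.Icc (lowerEdge μ) (upperEdge μ) := by
  filter_upwards [Measure.support_mem_ae (μ := μ)] with x hx
  exact ⟨csInf_le hc.bddBelow hx, le_csSup hc.bddAbove hx⟩

lemma lowerEdge_le_upperEdge [IsProbabilityMeasure μ] (hc : IsCompact μ.support) :
    lowerEdge μ ≤ upperEdge μ := by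
  obtain ⟨x, hx⟩ := (ae_mem_Icc hc).exists
  exact hx.1.trans hx.2

variable {X : (n : ℕ) → Matrix (Fin n) (Fin n) 𝕜} (hX : ∀ n, (X n).IsHermitian)
  (hspec : SpectralConvergence X μ)

include hspec in
lemma eventually_eigenvalues_mem {ε : ℝ} (hε : 0 < ε) : ∀ᶠ n in atTop, ∀ i,
    (hX n).eigenvalues i ∈ Set.Icc (lowerEdge μ - ε) (upperEdge μ + ε) := by
  filter_upwards [hspec.tendsto_smallest.eventually_const_lt (sub_lt_self _ hε),
    hspec.tendsto_largest.eventually_lt_const (lt_add_of_pos_right _ hε)] with n h1 h2 i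
  refine ⟨h1.le.trans (eig_zero_le_eigenvalues (hX n) i), ?_⟩
  have := eigenvalues_le_eig_last (hX n) i
  rw [Fintype.card_fin] at this
  exact this.trans h2.le

include hspec in
/-- Convergence of linear statistics, for functions continuous near the support. -/
lemma tendsto_sum_eigenvalues [IsProbabilityMeasure μ] {ε : ℝ} (hε : 0 < ε) {f : ℝ → ℝ}
    (hf : ContinuousOn f (Set.Icc (lowerEdge μ - ε) (upperEdge μ + ε))) :
    Tendsto (fun n : ℕ ↦ (n : ℝ)⁻¹ * ∑ i, f ((hX n).eigenvalues i)) atTop (𝓝 (∫ x, f x ∂μ)) := by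
  have hab : lowerEdge μ - ε ≤ upperEdge μ + ε := by
    linarith [lowerEdge_le_upperEdge hspec.compact_support]
  -- Projection onto the interval extends `f` to a bounded continuous test function, which agrees
  -- with `f` on the support and, for large `n`, at all eigenvalues.
  set g : BoundedContinuousFunction ℝ ℝ := (BoundedContinuousFunction.mkOfCompact
    ⟨_, continuousOn_iff_continuous_domRestrict.1 hf⟩).compContinuous
      ⟨Set.projIcc _ _ hab, continuous_projIcc⟩ with hg
  have hgf {x : ℝ} (hx : x ∈ Set.Icc (lowerEdge μ - ε) (upperEdge μ + ε)) : g x = f x := by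
    simp [hg, Set.projIcc_of_mem hab hx]
  have h1 := hspec.tendsto_spectralMeasure g
  have h2 : ∫ x, g x ∂μ = ∫ x, f x ∂μ := by
    refine integral_congr_ae ?_
    filter_upwards [ae_mem_Icc hspec.compact_support] with x hx
    exact hgf ⟨by linarith [hx.1], by linarith [hx.2]⟩
  rw [h2] at h1
  refine h1.congr' ?_
  filter_upwards [eventually_eigenvalues_mem hX hspec hε] with n hn
  rw [integral_spectralMeasure (hX n)]
  congr 1
  exact Finset.sum_congr rfl fun i _ ↦ hgf (hn i)

end Spectral

/-! ### The limits `ρ_θ` and the two thresholds. -/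

section Rho

/-- The abstract behaviour of `1 / G` to the right of the support: monotonicity and the lower bound
give the limit at `b`, while linear growth and the intermediate value theorem reach every value
above it. -/
lemma exists_limit_of_monotoneOn {F : ℝ → ℝ} {b : ℝ} (hm : MonotoneOn F (Set.Ioi b))
    (hc : ContinuousOn F (Set.Ioi b)) (h0 : ∀ z, b < z → 0 ≤ F z) (hF : ∀ z, b < z → z - b ≤ F z) :
    ∃ L, 0 ≤ L ∧ Tendsto F (𝓝[>] b) (𝓝 L) ∧ ∀ θ, L < θ → ∃ z, b < z ∧ F z = θ := by
  have hbdd : BddBelow (F '' Set.Ioi b) := ⟨0, by rintro _ ⟨z, hz, rfl⟩; exact h0 z hz⟩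
  have ht := hm.tendsto_nhdsGT hbdd
  refine ⟨_, Real.sInf_nonneg (by rintro _ ⟨z, hz, rfl⟩; exact h0 z hz), ht, fun θ hθ ↦ ?_⟩
  obtain ⟨z₁, hz₁, hbz₁⟩ := ((ht.eventually_lt_const hθ).and self_mem_nhdsWithin).exists
  replace hbz₁ : b < z₁ := hbz₁
  set z₂ := max z₁ (b + θ) with hz₂
  have hbz₂ : b < z₂ := hbz₁.trans_le (le_max_left _ _)
  have h2 : θ ≤ F z₂ := by
    have := hF z₂ hbz₂
    have h3 : b + θ ≤ z₂ := le_max_right _ _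
    linarith
  have hsub : Set.Icc z₁ z₂ ⊆ Set.Ioi b := fun z hz ↦ hbz₁.trans_le hz.1
  obtain ⟨z, hz, hFz⟩ := intermediate_value_Icc (le_max_left _ _ : z₁ ≤ z₂) (hc.mono hsub)
    ⟨hz₁.le, h2⟩
  exact ⟨z, hsub hz, hFz⟩

variable {μ : Measure ℝ} [IsProbabilityMeasure μ] {a b : ℝ}

omit [IsProbabilityMeasure μ] in
lemma aestronglyMeasurable_cauchy (z : ℝ) : AEStronglyMeasurable (fun x ↦ 1 / (z - x)) μ :=
  (measurable_const.div (measurable_const.sub measurable_id)).aestronglyMeasurable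

lemma integrable_cauchy (h : ∀ᵐ x ∂μ, x ∈ Set.Icc a b) {z : ℝ} (hz : b < z) :
    Integrable (fun x ↦ 1 / (z - x)) μ := by
  refine Integrable.of_bound (C := 1 / (z - b)) (aestronglyMeasurable_cauchy z) ?_
  filter_upwards [h] with x hx
  have h1 : 0 < z - b := by linarith
  have h2 : z - b ≤ z - x := by linarith [hx.2]
  rw [Real.norm_of_nonneg (one_div_nonneg.2 (h1.le.trans h2))]
  exact one_div_le_one_div_of_le h1 h2

lemma cauchyTransform_pos (h : ∀ᵐ x ∂μ, x ∈ Set.Icc a b) {z : ℝ} (hz : b < z) :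
    0 < cauchyTransform μ z := by
  have h1 : ∫ _, 1 / (z - a) ∂μ ≤ cauchyTransform μ z := by
    refine integral_mono_ae (integrable_const _) (integrable_cauchy h hz) ?_
    filter_upwards [h] with x hx
    exact one_div_le_one_div_of_le (by linarith [hx.2]) (by linarith [hx.1])
  obtain ⟨x, hx⟩ := h.exists
  refine lt_of_lt_of_le ?_ h1
  simp only [integral_const, probReal_univ, one_smul]
  exact one_div_pos.2 (by linarith [hx.1, hx.2])

lemma cauchyTransform_le (h : ∀ᵐ x ∂μ, x ∈ Set.Icc a b) {z : ℝ} (hz : b < z) :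
    cauchyTransform μ z ≤ 1 / (z - b) := by
  have h1 : cauchyTransform μ z ≤ ∫ _, 1 / (z - b) ∂μ := by
    refine integral_mono_ae (integrable_cauchy h hz) (integrable_const _) ?_
    filter_upwards [h] with x hx
    exact one_div_le_one_div_of_le (by linarith) (by linarith [hx.2])
  simpa using h1

lemma cauchyTransform_antitone (h : ∀ᵐ x ∂μ, x ∈ Set.Icc a b) {z w : ℝ} (hz : b < z) (hzw : z ≤ w) :
    cauchyTransform μ w ≤ cauchyTransform μ z := by
  refine integral_mono_ae (integrable_cauchy h (hz.trans_le hzw)) (integrable_cauchy h hz) ?_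
  filter_upwards [h] with x hx
  exact one_div_le_one_div_of_le (by linarith [hx.2]) (by linarith)

lemma continuousOn_cauchyTransform (h : ∀ᵐ x ∂μ, x ∈ Set.Icc a b) :
    ContinuousOn (cauchyTransform μ) (Set.Ioi b) := by
  intro z hz
  rw [Set.mem_Ioi] at hz
  refine ContinuousAt.continuousWithinAt ?_
  refine continuousAt_of_dominated (bound := fun _ ↦ 1 / ((z - b) / 2))
    (.of_forall aestronglyMeasurable_cauchy) ?_ (integrable_const _) ?_
  · filter_upwards [lt_mem_nhds (show (z + b) / 2 < z by linarith)] with w hw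
    filter_upwards [h] with x hx
    rw [Real.norm_of_nonneg (one_div_nonneg.2 (by linarith [hx.2]))]
    exact one_div_le_one_div_of_le (by linarith) (by linarith [hx.2])
  · filter_upwards [h] with x hx
    exact ContinuousAt.div continuousAt_const (by fun_prop) (by linarith [hx.2])

lemma exists_threshold (h : ∀ᵐ x ∂μ, x ∈ Set.Icc a b) :
    ∃ L, 0 ≤ L ∧ Tendsto (fun z ↦ 1 / cauchyTransform μ z) (𝓝[>] b) (𝓝 L) ∧
      ∀ θ, L < θ → ∃ z, b < z ∧ 1 / cauchyTransform μ z = θ := by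
  refine exists_limit_of_monotoneOn (fun z hz w hw hzw ↦ ?_) ?_ (fun z hz ↦ ?_) fun z hz ↦ ?_
  · exact one_div_le_one_div_of_le (cauchyTransform_pos h hw) (cauchyTransform_antitone h hz hzw)
  · exact continuousOn_const.div (continuousOn_cauchyTransform h) fun z hz ↦
      (cauchyTransform_pos h hz).ne'
  · exact one_div_nonneg.2 (cauchyTransform_pos h hz).le
  · have := one_div_le_one_div_of_le (cauchyTransform_pos h hz) (cauchyTransform_le h hz)
    rwa [one_div_one_div] at this

-- Reflection exchanges the two edges, so the left of the support is deduced from the right.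
omit [IsProbabilityMeasure μ] in
lemma cauchyTransform_map_neg (z : ℝ) :
    cauchyTransform (μ.map fun x ↦ -x) z = -cauchyTransform μ (-z) := by
  rw [cauchyTransform, integral_map (by fun_prop) (aestronglyMeasurable_cauchy z), cauchyTransform, ← integral_neg]
  congr 1
  ext x
  rw [← one_div_neg_eq_neg_one_div]
  congr 1
  ring

omit [IsProbabilityMeasure μ] in
lemma ae_map_neg (h : ∀ᵐ x ∂μ, x ∈ Set.Icc a b) :
    ∀ᵐ x ∂(μ.map fun x ↦ -x), x ∈ Set.Icc (-b) (-a) := by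
  refine (ae_map_iff measurable_neg.aemeasurable measurableSet_Icc).2 ?_
  filter_upwards [h] with x hx
  exact ⟨neg_le_neg hx.2, neg_le_neg hx.1⟩

lemma cauchyTransform_neg_of_lt (h : ∀ᵐ x ∂μ, x ∈ Set.Icc a b) {z : ℝ} (hz : z < a) :
    cauchyTransform μ z < 0 := by
  have : IsProbabilityMeasure (μ.map fun x ↦ -x) := Measure.isProbabilityMeasure_map (by fun_prop)
  have := cauchyTransform_pos (ae_map_neg h) (neg_lt_neg hz)
  rw [cauchyTransform_map_neg, neg_neg] at this
  linarith

lemma upperThreshold_spec (hc : IsCompact μ.support) : 0 ≤ upperThreshold μ ∧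
    ∀ θ, upperThreshold μ < θ → ∃ z, upperEdge μ < z ∧ cauchyTransform μ z = 1 / θ := by
  obtain ⟨L, h1, h2, h3⟩ := exists_threshold (ae_mem_Icc hc)
  rw [upperThreshold, h2.limUnder_eq]
  refine ⟨h1, fun θ hθ ↦ ?_⟩
  obtain ⟨z, hz, hzθ⟩ := h3 θ hθ
  exact ⟨z, hz, by rw [← hzθ, one_div_one_div]⟩

lemma lowerThreshold_spec (hc : IsCompact μ.support) : lowerThreshold μ ≤ 0 ∧
    ∀ θ, θ < lowerThreshold μ → ∃ z, z < lowerEdge μ ∧ cauchyTransform μ z = 1 / θ := by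
  have : IsProbabilityMeasure (μ.map fun x ↦ -x) := Measure.isProbabilityMeasure_map (by fun_prop)
  obtain ⟨L, h1, h2, h3⟩ := exists_threshold (ae_map_neg (ae_mem_Icc hc))
  have h4 : Tendsto (fun z ↦ 1 / cauchyTransform μ z) (𝓝[<] (lowerEdge μ)) (𝓝 (-L)) := by
    have h5 := (h2.comp (tendsto_neg_nhdsLT (a := lowerEdge μ))).neg
    refine h5.congr fun z ↦ ?_
    simp only [Function.comp_apply, cauchyTransform_map_neg, neg_neg]
    rw [one_div_neg_eq_neg_one_div, neg_neg]
  rw [lowerThreshold, h4.limUnder_eq]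
  refine ⟨by linarith, fun θ hθ ↦ ?_⟩
  obtain ⟨z, hz, hzθ⟩ := h3 (-θ) (by linarith)
  refine ⟨-z, by linarith, ?_⟩
  rw [cauchyTransform_map_neg, one_div_neg_eq_neg_one_div, neg_inj] at hzθ
  rw [← hzθ, one_div_one_div]

/-- The inverse function might a priori pick a preimage on either side of the support; the sign of
`G` decides. -/
lemma rho_of_upper_lt (hc : IsCompact μ.support) {θ : ℝ} (hθ : upperThreshold μ < θ) :
    upperEdge μ < rho μ θ ∧ cauchyTransform μ (rho μ θ) = 1 / θ := by
  obtain ⟨h0, h1⟩ := upperThreshold_spec hc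
  obtain ⟨z, hz, hzθ⟩ := h1 θ hθ
  have hex : ∃ z ∈ {z | z < lowerEdge μ ∨ upperEdge μ < z}, cauchyTransform μ z = 1 / θ :=
    ⟨z, Or.inr hz, hzθ⟩
  have h2 := Function.invFunOn_mem hex
  have h3 := Function.invFunOn_eq hex
  rw [rho, if_pos (Or.inr hθ)]
  refine ⟨?_, h3⟩
  rcases h2 with h2 | h2
  · have h4 := cauchyTransform_neg_of_lt (ae_mem_Icc hc) h2
    rw [h3] at h4
    have : 0 < 1 / θ := one_div_pos.2 (h0.trans_lt hθ)
    linarith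
  · exact h2

lemma rho_of_lt_lower (hc : IsCompact μ.support) {θ : ℝ} (hθ : θ < lowerThreshold μ) :
    rho μ θ < lowerEdge μ ∧ cauchyTransform μ (rho μ θ) = 1 / θ := by
  obtain ⟨h0, h1⟩ := lowerThreshold_spec hc
  obtain ⟨z, hz, hzθ⟩ := h1 θ hθ
  have hex : ∃ z ∈ {z | z < lowerEdge μ ∨ upperEdge μ < z}, cauchyTransform μ z = 1 / θ :=
    ⟨z, Or.inl hz, hzθ⟩
  have h2 := Function.invFunOn_mem hex
  have h3 := Function.invFunOn_eq hex
  rw [rho, if_pos (Or.inl hθ)]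
  refine ⟨?_, h3⟩
  rcases h2 with h2 | h2
  · exact h2
  · have h4 := cauchyTransform_pos (ae_mem_Icc hc) h2
    rw [h3] at h4
    have : 1 / θ < 0 := one_div_neg.2 (hθ.trans_le h0)
    linarith

omit [IsProbabilityMeasure μ] in
lemma rho_of_mem {θ : ℝ} (h1 : lowerThreshold μ ≤ θ) (h2 : θ ≤ upperThreshold μ) :
    rho μ θ = lowerEdge μ ∨ rho μ θ = upperEdge μ := by
  rw [rho, if_neg (not_or.2 ⟨not_lt.2 h1, not_lt.2 h2⟩)]
  split_ifs <;> simp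

lemma rho_lt_lowerEdge_iff (hc : IsCompact μ.support) {θ : ℝ} :
    rho μ θ < lowerEdge μ ↔ θ < lowerThreshold μ := by
  refine ⟨fun h ↦ ?_, fun h ↦ (rho_of_lt_lower hc h).1⟩
  have hab := lowerEdge_le_upperEdge hc
  by_contra h'
  rcases le_or_gt θ (upperThreshold μ) with h2 | h2
  · rcases rho_of_mem (not_lt.1 h') h2 with h3 | h3 <;> linarith
  · linarith [(rho_of_upper_lt hc h2).1]

lemma upperEdge_lt_rho_iff (hc : IsCompact μ.support) {θ : ℝ} :
    upperEdge μ < rho μ θ ↔ upperThreshold μ < θ := by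
  refine ⟨fun h ↦ ?_, fun h ↦ (rho_of_upper_lt hc h).1⟩
  have hab := lowerEdge_le_upperEdge hc
  by_contra h'
  rcases le_or_gt (lowerThreshold μ) θ with h2 | h2
  · rcases rho_of_mem h2 (not_lt.1 h') with h3 | h3 <;> linarith
  · linarith [(rho_of_lt_lower hc h2).1]

lemma rho_ne_iff (hc : IsCompact μ.support) {θ : ℝ} :
    (rho μ θ ≠ lowerEdge μ ∧ rho μ θ ≠ upperEdge μ) ↔
      (θ < lowerThreshold μ ∨ upperThreshold μ < θ) := by
  have hab := lowerEdge_le_upperEdge hc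
  constructor
  · rintro ⟨h1, h2⟩
    by_contra h
    rw [not_or, not_lt, not_lt] at h
    rcases rho_of_mem h.1 h.2 with h3 | h3
    · exact h1 h3
    · exact h2 h3
  · rintro (h | h)
    · have := (rho_of_lt_lower hc h).1
      exact ⟨by linarith, by linarith⟩
    · have := (rho_of_upper_lt hc h).1
      exact ⟨by linarith, by linarith⟩

end Rho

/-! ### Matching the indices of the outliers with inertia counts. -/

section Counting

/-- A downward closed set of indices is an initial segment, hence known from its cardinality. -/
lemma iff_lt_card_filter {r : ℕ} {p : Fin r → Prop} [DecidablePred p] (hp : ∀ a b, a ≤ b → p b → p a) (m : Fin r) :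
    p m ↔ (m : ℕ) < (Finset.univ.filter p).card := by
  constructor
  · intro h
    have : Finset.Iic m ⊆ Finset.univ.filter p := fun a ha ↦
      Finset.mem_filter.2 ⟨Finset.mem_univ _, hp a m (Finset.mem_Iic.1 ha) h⟩
    have := Finset.card_le_card this
    rw [Fin.card_Iic] at this
    omega
  · intro h
    by_contra h'
    have : Finset.univ.filter p ⊆ Finset.Iio m := fun a ha ↦
      Finset.mem_Iio.2 (lt_of_not_ge fun hma ↦ h' (hp m a hma (Finset.mem_filter.1 ha).2))
    have := Finset.card_le_card this
    rw [Fin.card_Iio] at this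
    omega

lemma card_filter_add_of_iff {ι : Type*} [Fintype ι] {p q s : ι → Prop} [DecidablePred p]
    [DecidablePred q] [DecidablePred s]
    (h : ∀ a, s a ↔ p a ∨ q a) (hd : ∀ a, p a → ¬ q a) :
    (Finset.univ.filter s).card = (Finset.univ.filter p).card + (Finset.univ.filter q).card := by
  classical
  rw [← Finset.card_union_of_disjoint]
  · congr 1
    ext a
    simp [h]
  · exact Finset.disjoint_filter.2 fun a _ ↦ hd a

open Classical in
lemma thetaAt_eq {r : ℕ} {θ : Fin r → ℝ} (hθ : Monotone θ) {α : ℝ} {i : ℕ}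
    (hi : i < (Finset.univ.filter fun a ↦ θ a = α).card) :
    thetaAt θ ((Finset.univ.filter fun a ↦ θ a < α).card + i) = α := by
  have h1 := card_filter_add_of_iff (p := fun a ↦ θ a < α) (q := fun a ↦ θ a = α)
    (s := fun a ↦ θ a ≤ α) (fun a ↦ le_iff_lt_or_eq) fun a h ↦ h.ne
  have h2 : (Finset.univ.filter fun a ↦ θ a ≤ α).card ≤ r := by
    simpa using Finset.card_filter_le Finset.univ fun a ↦ θ a ≤ α
  have h3 : (Finset.univ.filter fun a ↦ θ a < α).card + i < r := by omega
  rw [thetaAt, dif_pos h3]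
  apply le_antisymm
  · rw [iff_lt_card_filter (p := fun a ↦ θ a ≤ α) fun a b hab hb ↦ (hθ hab).trans hb]
    simp only
    omega
  · rw [← not_lt, iff_lt_card_filter (p := fun a ↦ θ a < α) fun a b hab hb ↦ (hθ hab).trans_lt hb]
    simp

variable {μ : Measure ℝ} [IsProbabilityMeasure μ] (hc : IsCompact μ.support) {r : ℕ}
  {θ : Fin r → ℝ}

include hc in
lemma mem_outlierValues_iff (a : Fin r) : θ a ∈ outlierValues μ θ ↔
    θ a < lowerThreshold μ ∨ upperThreshold μ < θ a := by
  rw [← rho_ne_iff hc]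
  simp only [outlierValues, Finset.mem_image, Finset.mem_filter, Finset.mem_univ, true_and]
  constructor
  · rintro ⟨b, hb, hba⟩
    rwa [← hba]
  · exact fun h ↦ ⟨a, h, rfl⟩

omit [IsProbabilityMeasure μ] in
lemma alpha_mem (j : Fin (numValues μ θ)) : alpha μ θ j ∈ outlierValues μ θ :=
  Finset.orderEmbOfFin_mem _ _ _

omit [IsProbabilityMeasure μ] in
lemma exists_alpha_eq {α : ℝ} (h : α ∈ outlierValues μ θ) : ∃ j, alpha μ θ j = α := by
  have : α ∈ Set.range ((outlierValues μ θ).orderEmbOfFin rfl) := by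
    rw [Finset.range_orderEmbOfFin]
    exact h
  exact this

omit [IsProbabilityMeasure μ] in
lemma exists_theta_eq_alpha (j : Fin (numValues μ θ)) : ∃ a, θ a = alpha μ θ j := by
  have := alpha_mem j
  simp only [outlierValues, Finset.mem_image] at this
  obtain ⟨a, _, ha⟩ := this
  exact ⟨a, ha⟩

include hc in
lemma alpha_lt_or_lt (j : Fin (numValues μ θ)) :
    alpha μ θ j < lowerThreshold μ ∨ upperThreshold μ < alpha μ θ j := by
  obtain ⟨a, ha⟩ := exists_theta_eq_alpha j
  rw [← ha, ← mem_outlierValues_iff hc, ha]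
  exact alpha_mem j

-- The groups preceding the `j`-th one are disjoint and exhaust the outlier indices with smaller
-- `θ`; the offset of the group thereby becomes a count of indices.
omit [IsProbabilityMeasure μ] in
open Classical in
lemma sum_mult_lt (j : Fin (numValues μ θ)) :
    ∑ l ∈ Finset.univ.filter (fun l ↦ l < j), mult μ θ l =
      (Finset.univ.filter fun a ↦ θ a ∈ outlierValues μ θ ∧ θ a < alpha μ θ j).card := by
  simp only [mult]
  rw [← Finset.card_biUnion]
  · congr 1
    ext a
    simp only [Finset.mem_biUnion, Finset.mem_filter, Finset.mem_univ, true_and]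
    constructor
    · rintro ⟨l, hl, ha⟩
      rw [ha]
      exact ⟨alpha_mem l, (OrderEmbedding.lt_iff_lt _).2 hl⟩
    · rintro ⟨h1, h2⟩
      obtain ⟨l, hl⟩ := exists_alpha_eq h1
      rw [← hl] at h2
      exact ⟨l, (OrderEmbedding.lt_iff_lt _).1 h2, hl.symm⟩
  · intro l _ l' _ hll'
    refine Finset.disjoint_filter.2 fun a _ h h' ↦ hll' ?_
    exact ((outlierValues μ θ).orderEmbOfFin rfl).injective (h.symm.trans h')

variable {𝕜 : Type*} [RCLike 𝕜] {n : ℕ}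

open Classical in
include hc in
/-- Reduction of the event that an outlier lies below a level to an inertia count. -/
lemma rescaledOutlier_lt_iff (hθ : Monotone θ) (hθ0 : ∀ a, θ a ≠ 0) (j : Fin (numValues μ θ))
    {i : ℕ} (hi : i < mult μ θ j) {A : Matrix (Fin n) (Fin n) 𝕜} (hA : A.IsHermitian)
    (hn : r ≤ n) {x : ℝ} {q : ℕ}
    (hq : npos (((rho μ (alpha μ θ j) + x / √(n : ℝ) : ℝ) : 𝕜) • 1 - A) +
      (Finset.univ.filter fun a ↦ 0 < θ a).card = (if alpha μ θ j < 0 then 0 else n) +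
        ((Finset.univ.filter fun a ↦ 1 / alpha μ θ j < 1 / θ a).card + q)) :
    rescaledOutlier μ θ A ((∑ l ∈ Finset.univ.filter (fun l ↦ l < j), mult μ θ l) + i) < x ↔
      i < q := by
  set α := alpha μ θ j with hα
  have hk : mult μ θ j = (Finset.univ.filter fun a ↦ θ a = α).card := rfl
  rw [hk] at hi
  have hle : (Finset.univ.filter fun a ↦ θ a ≤ α).card =
    (Finset.univ.filter fun a ↦ θ a < α).card + (Finset.univ.filter fun a ↦ θ a = α).card :=
    card_filter_add_of_iff (fun a ↦ le_iff_lt_or_eq) fun a h ↦ h.ne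
  have hler : (Finset.univ.filter fun a ↦ θ a ≤ α).card ≤ r := by
    simpa using Finset.card_filter_le Finset.univ fun a ↦ θ a ≤ α
  have hθat := thetaAt_eq hθ hi
  have hn0 : 0 < √(n : ℝ) := by
    rw [Real.sqrt_pos, Nat.cast_pos]
    omega
  have key {m : ℕ} (hm : m < n) : √(n : ℝ) * (eig A m - rho μ α) < x ↔
      m < npos (((rho μ α + x / √(n : ℝ) : ℝ) : 𝕜) • 1 - A) := by
    rw [← eig_lt_iff hA (by simpa using hm), ← lt_div_iff₀' hn0, sub_lt_iff_lt_add']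
  have hl0 := (lowerThreshold_spec hc).1
  have hu0 := (upperThreshold_spec hc).1
  have hmB : numBelow μ θ = (Finset.univ.filter fun a ↦ θ a < lowerThreshold μ).card := by
    simp only [numBelow, rho_lt_lowerEdge_iff hc]
  have hmA : numAbove μ θ = (Finset.univ.filter fun a ↦ upperThreshold μ < θ a).card := by
    simp only [numAbove, upperEdge_lt_rho_iff hc]
  have hsum := sum_mult_lt (μ := μ) j
  simp only [mem_outlierValues_iff hc] at hsum
  rw [← hα] at hsum
  rcases alpha_lt_or_lt hc j with h | h
  · rw [← hα] at h
    have hα0 : α < 0 := h.trans_le hl0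
    have h1 : (Finset.univ.filter fun a ↦
        (θ a < lowerThreshold μ ∨ upperThreshold μ < θ a) ∧ θ a < α) =
        Finset.univ.filter fun a ↦ θ a < α := by
      refine Finset.filter_congr fun a _ ↦ ⟨fun h ↦ h.2, fun h' ↦ ⟨Or.inl (h'.trans h), h'⟩⟩
    rw [h1] at hsum
    have h2 : (Finset.univ.filter fun a ↦ θ a ≤ α).card ≤ numBelow μ θ := by
      rw [hmB]
      exact Finset.card_le_card (Finset.monotone_filter_right _ fun a _ ha ↦
        lt_of_le_of_lt ha h)
    -- For `α < 0` the inequality `1 / α < 1 / θ` holds when `θ < α` and for all positive `θ`; the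
    -- latter cancel against the same count in `hq`.
    have h3 := card_filter_add_of_iff (p := fun a ↦ θ a < α) (q := fun a ↦ 0 < θ a)
      (s := fun a ↦ 1 / α < 1 / θ a) (fun a ↦ by
        rcases lt_or_gt_of_ne (hθ0 a) with ha | ha
        · rw [one_div_lt_one_div_of_neg hα0 ha]
          simp [ha.le.not_gt]
        · simp only [ha, or_true, iff_true]
          exact (one_div_neg.2 hα0).trans (one_div_pos.2 ha)) fun a ha ↦ by
        simp only [not_lt]; linarith
    rw [if_pos hα0] at hq
    rw [hsum, rescaledOutlier, if_pos (by omega), hθat, key (by omega)]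
    omega
  · rw [← hα] at h
    have hα0 : 0 < α := hu0.trans_lt h
    have h1 := card_filter_add_of_iff (p := fun a ↦ θ a < lowerThreshold μ)
      (q := fun a ↦ upperThreshold μ < θ a ∧ θ a < α)
      (s := fun a ↦ (θ a < lowerThreshold μ ∨ upperThreshold μ < θ a) ∧ θ a < α) (fun a ↦ by
        constructor
        · rintro ⟨h1 | h1, h2⟩
          · exact Or.inl h1
          · exact Or.inr ⟨h1, h2⟩
        · rintro (h1 | h1)
          · exact ⟨Or.inl h1, by linarith⟩
          · exact ⟨Or.inr h1.1, h1.2⟩) fun a ha ↦ by rintro ⟨h1, h2⟩; linarith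
    have h2 := card_filter_add_of_iff (p := fun a ↦ upperThreshold μ < θ a ∧ θ a < α)
      (q := fun a ↦ α ≤ θ a) (s := fun a ↦ upperThreshold μ < θ a) (fun a ↦ by
        constructor
        · intro h1
          rcases lt_or_ge (θ a) α with h2 | h2
          · exact Or.inl ⟨h1, h2⟩
          · exact Or.inr h2
        · rintro (h1 | h1)
          · exact h1.1
          · exact h.trans_le h1) fun a ha ↦ by simp [ha.2]
    -- For `α > 0` the inequality selects `0 < θ < α`. What remains of the positive `θ` is `α ≤ θ`,
    -- the number of positions by which the group lies below the top of the spectrum.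
    have h3 := card_filter_add_of_iff (p := fun a ↦ 1 / α < 1 / θ a) (q := fun a ↦ α ≤ θ a)
      (s := fun a ↦ 0 < θ a) (fun a ↦ by
        rcases lt_or_gt_of_ne (hθ0 a) with ha | ha
        · have := one_div_neg.2 ha
          have := one_div_pos.2 hα0
          constructor
          · intro; linarith
          · rintro (h1 | h1) <;> linarith
        · rw [one_div_lt_one_div hα0 ha]
          simp [ha, lt_or_ge]) fun a ha ha' ↦ by
            have := one_div_le_one_div_of_le hα0 ha'
            linarith
    have h4 := card_filter_add_of_iff (p := fun a ↦ θ a < α) (q := fun a ↦ α ≤ θ a)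
      (s := fun _ ↦ True) (fun a ↦ by simp [lt_or_ge]) fun a ha ↦ by simpa using ha
    have h5 : (Finset.univ.filter fun _ : Fin r ↦ True).card = r := by simp
    have h6 : (Finset.univ.filter fun a ↦ θ a < lowerThreshold μ).card ≤
        (Finset.univ.filter fun a ↦ θ a < α).card :=
      Finset.card_le_card (Finset.monotone_filter_right _ fun a _ ha ↦
        lt_of_lt_of_le ha (by linarith))
    have h7 : (Finset.univ.filter fun a ↦
        (θ a < lowerThreshold μ ∨ upperThreshold μ < θ a) ∧ θ a < α).card ≤
        (Finset.univ.filter fun a ↦ θ a < α).card :=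
      Finset.card_le_card (Finset.monotone_filter_right _ fun a _ ha ↦ ha.2)
    rw [if_neg hα0.not_gt] at hq
    rw [hsum, rescaledOutlier, if_neg (by omega)]
    have h8 : r - (numBelow μ θ + numAbove μ θ) + ((Finset.univ.filter fun a ↦
        (θ a < lowerThreshold μ ∨ upperThreshold μ < θ a) ∧ θ a < α).card + i) =
        (Finset.univ.filter fun a ↦ θ a < α).card + i := by omega
    rw [h8, hθat, key (by omega)]
    omega

end Counting

/-! ### Convergence in law on varying probability spaces. -/

section Convergence

variable {𝕜 : Type*} [RCLike 𝕜] {Ω : ℕ → Type*} [∀ n, MeasurableSpace (Ω n)]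
  {P : (n : ℕ) → Measure (Ω n)} [∀ n, IsProbabilityMeasure (P n)]
  {Ω' : Type*} [MeasurableSpace Ω'] {P' : Measure Ω'} [IsProbabilityMeasure P']

lemma charFun_map_toLp {α ι : Type*} [Fintype ι] [MeasurableSpace α] {Q : Measure α}
    {Y : α → ι → 𝕜} (hY : AEMeasurable Y Q) (t : PiLp 2 fun _ : ι ↦ 𝕜) :
    charFun (Q.map fun ω ↦ WithLp.toLp 2 (Y ω)) t =
      ∫ ω, eI (∑ i, RCLike.re (star (t i) * Y ω i)) ∂Q := by
  have h2 : AEMeasurable (fun ω ↦ WithLp.toLp 2 (Y ω)) Q :=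
    (PiLp.continuous_toLp 2 _).measurable.comp_aemeasurable hY
  rw [charFun_apply, integral_map h2]
  · congr 1
    ext ω
    rw [eI, PiLp.inner_apply]
    congr 4
    ext i
    rw [real_inner_eq_re_inner 𝕜, RCLike.inner_apply, ← RCLike.conj_re, map_mul, RCLike.conj_conj,
      mul_comm, RCLike.star_def]
    rw [mul_comm]
  · fun_prop

/-- Lévy's continuity theorem in the Euclidean norm, where the real inner product is the exponent
below; the identity map then transports the result to the product space. -/
lemma tendstoInDistribution_of_tendsto_integral_eI {ι : Type*} [Fintype ι]
    {Y : (n : ℕ) → Ω n → ι → 𝕜} {Z : Ω' → ι → 𝕜} (hY : ∀ n, AEMeasurable (Y n) (P n))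
    (hZ : AEMeasurable Z P')
    (h : ∀ t : ι → 𝕜, Tendsto (fun n ↦ ∫ ω, eI (∑ i, RCLike.re (star (t i) * Y n ω i)) ∂(P n)) atTop
      (𝓝 (∫ ω, eI (∑ i, RCLike.re (star (t i) * Z ω i)) ∂P'))) :
    TendstoInDistribution Y atTop Z P P' := by
  have key : TendstoInDistribution (fun n ω ↦ WithLp.toLp 2 (Y n ω)) atTop
      (fun ω ↦ WithLp.toLp 2 (Z ω)) P P' := by
    refine ⟨fun n ↦ (PiLp.continuous_toLp 2 _).measurable.comp_aemeasurable (hY n),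
      (PiLp.continuous_toLp 2 _).measurable.comp_aemeasurable hZ, ?_⟩
    refine ProbabilityMeasure.tendsto_iff_tendsto_charFun.2 fun t ↦ ?_
    simp only [ProbabilityMeasure.coe_mk]
    rw [charFun_map_toLp hZ]
    simp only [charFun_map_toLp (hY _)]
    exact h t
  exact key.continuous_comp (PiLp.continuous_ofLp 2 _)

/-- Slutsky's lemma for variables on varying probability spaces. -/
lemma tendstoInDistribution_of_dist {E : Type*} [PseudoMetricSpace E] [MeasurableSpace E]
    [BorelSpace E] {X Y : (n : ℕ) → Ω n → E} {Z : Ω' → E}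
    (h : TendstoInDistribution X atTop Z P P') (hY : ∀ n, AEMeasurable (Y n) (P n))
    (hXY : ∀ ε > 0, Tendsto (fun n ↦ P n {ω | ε ≤ dist (Y n ω) (X n ω)}) atTop (𝓝 0)) :
    TendstoInDistribution Y atTop Z P P' := by
  refine ⟨hY, h.aemeasurable_limit, ?_⟩
  have hX := h.forall_aemeasurable
  have hlim := h.tendsto
  refine tendsto_iff_forall_lipschitz_integral_tendsto.2 ?_
  rintro f ⟨C, hC⟩ ⟨L, hL⟩
  replace hlim := tendsto_iff_forall_lipschitz_integral_tendsto.1 hlim f ⟨C, hC⟩ ⟨L, hL⟩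
  simp only [ProbabilityMeasure.coe_mk] at hlim ⊢
  refine (tendsto_iff_of_dist ?_).1 hlim
  have hf : StronglyMeasurable f := hL.continuous.stronglyMeasurable
  have hint (n : ℕ) {W : Ω n → E} (hW : AEMeasurable W (P n)) :
      Integrable (fun ω ↦ f (W ω)) (P n) := by
    have : Nonempty E := by
      obtain ⟨ω⟩ := nonempty_of_isProbabilityMeasure (P n)
      exact ⟨W ω⟩
    obtain ⟨w⟩ := this
    refine Integrable.of_bound (C := |f w| + C) (hf.aestronglyMeasurable.comp_aemeasurable hW)
      (ae_of_all _ fun ω ↦ ?_)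
    have := hC (W ω) w
    rw [Real.dist_eq] at this
    rw [Real.norm_eq_abs]
    linarith [abs_sub_abs_le_abs_sub (f (W ω)) (f w)]
  rw [Metric.tendsto_nhds]
  intro ε hε
  -- With this `δ` the Lipschitz bound costs at most `ε / 4`; the exceptional set will cost less
  -- than `ε / 2`.
  set δ : ℝ := ε / (4 * (L + 1)) with hδ
  have hL0 : (0 : ℝ) ≤ L := L.2
  have hδ0 : 0 < δ := by positivity
  have hC0 (n : ℕ) : 0 ≤ C := by
    obtain ⟨ω⟩ := nonempty_of_isProbabilityMeasure (P n)
    exact dist_nonneg.trans (hC (X n ω) (X n ω))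
  have h1 : Tendsto (fun n ↦ C * (P n {ω | δ ≤ dist (Y n ω) (X n ω)}).toReal) atTop (𝓝 0) := by
    have := (ENNReal.tendsto_toReal ENNReal.zero_ne_top).comp (hXY δ hδ0)
    simpa using this.const_mul C
  filter_upwards [h1.eventually_lt_const (half_pos hε)] with n hn
  rw [Real.dist_0_eq_abs, abs_of_nonneg dist_nonneg, Real.dist_eq,
    integral_map (hX n) hf.aestronglyMeasurable, integral_map (hY n) hf.aestronglyMeasurable,
    ← integral_sub (hint n (hX n)) (hint n (hY n))]
  set S := {ω | δ ≤ dist (Y n ω) (X n ω)} with hS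
  -- The variables are only almost everywhere measurable, so `S` is replaced by a measurable hull of
  -- the same measure.
  set S' := toMeasurable (P n) S with hS'
  have hb (ω : Ω n) : ‖f (X n ω) - f (Y n ω)‖ ≤ L * δ + S'.indicator (fun _ ↦ C) ω := by
    rw [← dist_eq_norm]
    by_cases hω : ω ∈ S
    · rw [Set.indicator_of_mem (subset_toMeasurable _ _ hω), dist_comm]
      have := hC (Y n ω) (X n ω)
      nlinarith [mul_nonneg hL0 hδ0.le]
    · rw [hS, Set.mem_ofPred_eq, not_le] at hω
      have h2 : 0 ≤ S'.indicator (fun _ ↦ C) ω := Set.indicator_nonneg (fun _ _ ↦ hC0 n) ω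
      have h3 := hL.dist_le_mul (Y n ω) (X n ω)
      have h4 := mul_le_mul_of_nonneg_left hω.le hL0
      rw [dist_comm]
      linarith
  have hb2 : Integrable (fun ω ↦ L * δ + S'.indicator (fun _ ↦ C) ω) (P n) :=
    (integrable_const _).add ((integrable_const C).indicator (measurableSet_toMeasurable _ _))
  have h3 := norm_integral_le_of_norm_le hb2 (ae_of_all _ hb)
  rw [integral_add (integrable_const _)
    ((integrable_const C).indicator (measurableSet_toMeasurable _ _)),
    integral_indicator_const _ (measurableSet_toMeasurable _ _), integral_const, measureReal_def,
    measureReal_def, measure_toMeasurable, measure_univ] at h3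
  simp only [ENNReal.toReal_one, smul_eq_mul, one_mul] at h3
  have h4 : L * δ ≤ ε / 4 := by
    rw [hδ, mul_div_assoc', div_le_div_iff₀ (by positivity) (by positivity)]
    nlinarith
  rw [Real.norm_eq_abs] at h3
  linarith [mul_comm C (P n S).toReal]

end Convergence

/-! ### Characteristic function of the Gaussian ensembles. -/

section GaussianEnsemble

variable {𝕜 : Type*} [RCLike 𝕜]

lemma dysonIndex_pos : 0 < dysonIndex 𝕜 := by
  unfold dysonIndex
  split_ifs <;> norm_num

lemma re_star_mul_I (z : 𝕜) : RCLike.re (star z * RCLike.I) = RCLike.im z := by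
  rcases RCLike.I_eq_zero_or_im_I_eq_one (K := 𝕜) with h | h
  · rw [h, mul_zero, map_zero, RCLike.im_eq_zero h]
  · simp [RCLike.mul_re, h]

lemma re_star_mul_comb (z : 𝕜) (c x y : ℝ) :
    RCLike.re (star z * ((c : 𝕜) * ((x : 𝕜) + RCLike.I * (y : 𝕜)))) =
      c * (RCLike.re z * x + RCLike.im z * y) := by
  have : star z * ((c : 𝕜) * ((x : 𝕜) + RCLike.I * (y : 𝕜))) =
      (c : 𝕜) * ((x : 𝕜) * star z + (y : 𝕜) * (star z * RCLike.I)) := by ring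
  rw [this, RCLike.re_ofReal_mul, map_add, RCLike.re_ofReal_mul, RCLike.re_ofReal_mul,
    re_star_mul_I]
  simp [mul_comm]

/-- Coefficients of the linear form `∑ re (conj (T a b) g a b)` in the Gaussian variables. -/
def gaussianCoeff {k : ℕ} (T : Matrix (Fin k) (Fin k) 𝕜) (p : Fin k × Fin k) : ℝ :=
  if p.1 = p.2 then √(2 / dysonIndex 𝕜) * RCLike.re (T p.1 p.1)
  else if p.1 < p.2 then 1 / √(dysonIndex 𝕜) * (RCLike.re (T p.1 p.2) + RCLike.re (T p.2 p.1))
  else 1 / √(dysonIndex 𝕜) * (RCLike.im (T p.2 p.1) - RCLike.im (T p.1 p.2))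

lemma sum_re_star_mul_gaussianMatrix {k : ℕ} (T : Matrix (Fin k) (Fin k) 𝕜)
    (ξ : Fin k × Fin k → ℝ) :
    ∑ a, ∑ b, RCLike.re (star (T a b) * gaussianMatrix 𝕜 ξ a b) =
      ∑ p, gaussianCoeff T p * ξ p := by
  set c := 1 / √(dysonIndex 𝕜) with hc
  -- `p₁ a b` and `p₂ a b` are the contributions of the entry `(a, b)` to the coefficients of `ξ (a,
  -- b)` and `ξ (b, a)`. Two symmetric entries share the same two Gaussian variables.
  let p₁ : Fin k → Fin k → ℝ := fun a b ↦ if a = b then √(2 / dysonIndex 𝕜) * RCLike.re (T a a)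
    else if a < b then c * RCLike.re (T a b) else -(c * RCLike.im (T a b))
  let p₂ : Fin k → Fin k → ℝ := fun a b ↦ if a = b then 0
    else if a < b then c * RCLike.im (T a b) else c * RCLike.re (T a b)
  have h1 (a b : Fin k) : RCLike.re (star (T a b) * gaussianMatrix 𝕜 ξ a b) =
      p₁ a b * ξ (a, b) + p₂ a b * ξ (b, a) := by
    simp only [gaussianMatrix, Matrix.of_apply, p₁, p₂]
    split_ifs with hab hab'
    · subst hab
      rw [mul_comm (star _), RCLike.re_ofReal_mul]
      simp
      ring
    · rw [re_star_mul_comb]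
      ring
    · have := re_star_mul_comb (T a b) c (ξ (b, a)) (-ξ (a, b))
      rw [RCLike.ofReal_neg, mul_neg, ← sub_eq_add_neg] at this
      rw [this]
      ring
  have h2 (a b : Fin k) : gaussianCoeff T (a, b) = p₁ a b + p₂ b a := by
    simp only [gaussianCoeff, p₁, p₂]
    rcases lt_trichotomy a b with h | h | h
    · simp only [h.ne, h.ne', h, h.not_gt, if_true, if_false]
      ring
    · simp [h]
    · simp only [h.ne, h.ne', h, h.not_gt, if_true, if_false]
      ring
  rw [Fintype.sum_prod_type]
  simp only [h1, h2, add_mul, Finset.sum_add_distrib]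
  congr 1
  exact Finset.sum_comm

/-- A Hermitian matrix only tests the Hermitian part of `T`. The factor `2 / dysonIndex 𝕜` is the
`κ` of the quadratic forms, so the two limits have the same variance. -/
lemma sum_gaussianCoeff_sq {k : ℕ} (T : Matrix (Fin k) (Fin k) 𝕜) :
    ∑ p, gaussianCoeff T p ^ 2 = 2 / dysonIndex 𝕜 * ∑ a, ∑ b, ‖hermPart T a b‖ ^ 2 := by
  have hβ := dysonIndex_pos (𝕜 := 𝕜)
  have hd (a b : Fin k) : ‖hermPart T a b‖ ^ 2 = 1 / 4 *
      ((RCLike.re (T a b) + RCLike.re (T b a)) ^ 2 +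
        (RCLike.im (T a b) - RCLike.im (T b a)) ^ 2) := by
    rw [hermPart_apply, norm_mul, mul_pow, RCLike.norm_ofReal, RCLike.norm_sq_eq_def]
    simp [RCLike.star_def, ← sub_eq_add_neg]
    norm_num [sq]
  have h1 (a b : Fin k) : gaussianCoeff T (a, b) ^ 2 + gaussianCoeff T (b, a) ^ 2 =
      2 / dysonIndex 𝕜 * (‖hermPart T a b‖ ^ 2 + ‖hermPart T b a‖ ^ 2) := by
    simp only [gaussianCoeff, hd]
    rcases lt_trichotomy a b with h | h | h
    · simp only [h.ne, h.ne', h, h.not_gt, if_true, if_false, mul_pow, div_pow,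
        Real.sq_sqrt hβ.le]
      ring
    · subst h
      simp only [if_true, mul_pow, Real.sq_sqrt (div_pos two_pos hβ).le]
      ring
    · simp only [h.ne, h.ne', h, h.not_gt, if_true, if_false, mul_pow, div_pow,
        Real.sq_sqrt hβ.le]
      ring
  have h2 : ∑ a, ∑ b, (gaussianCoeff T (a, b) ^ 2 + gaussianCoeff T (b, a) ^ 2) =
      ∑ a, ∑ b, 2 / dysonIndex 𝕜 * (‖hermPart T a b‖ ^ 2 + ‖hermPart T b a‖ ^ 2) := by
    simp only [h1]
  simp only [mul_add, Finset.sum_add_distrib] at h2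
  rw [Finset.sum_comm (f := fun a b ↦ gaussianCoeff T (b, a) ^ 2),
    Finset.sum_comm (f := fun a b ↦ 2 / dysonIndex 𝕜 * ‖hermPart T b a‖ ^ 2)] at h2
  rw [Fintype.sum_prod_type]
  simp only [Finset.mul_sum]
  linarith

lemma integral_eI_mul_gaussianReal (t : ℝ) :
    ∫ x, eI (t * x) ∂(gaussianReal 0 1) = Complex.exp (-(t : ℂ) ^ 2 / 2) := by
  have := charFun_gaussianReal (μ := 0) (v := 1) t
  rw [charFun_apply_real] at this
  convert this using 2
  · ext x
    simp [eI]
  · push_cast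
    ring

lemma eI_sum {ι : Type*} (s : Finset ι) (f : ι → ℝ) : eI (∑ i ∈ s, f i) = ∏ i ∈ s, eI (f i) := by
  simp only [eI, Complex.ofReal_sum, Finset.sum_mul, Complex.exp_sum]

lemma measurable_gaussianMatrix {k : ℕ} : Measurable (gaussianMatrix 𝕜 (k := k)) := by
  refine measurable_pi_lambda _ fun a ↦ measurable_pi_lambda _ fun b ↦ ?_
  simp only [gaussianMatrix, Matrix.of_apply]
  split_ifs <;> fun_prop

lemma integral_eI_gaussianEnsemble {k : ℕ} (T : Matrix (Fin k) (Fin k) 𝕜) :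
    ∫ m, eI (∑ a, ∑ b, RCLike.re (star (T a b) * m a b)) ∂(gaussianEnsemble 𝕜 k) =
      Complex.exp (-((2 / dysonIndex 𝕜 * ∑ a, ∑ b, ‖hermPart T a b‖ ^ 2 : ℝ) : ℂ) / 2) := by
  rw [gaussianEnsemble, integral_map measurable_gaussianMatrix.aemeasurable]
  · simp only [sum_re_star_mul_gaussianMatrix, eI_sum]
    rw [integral_fintype_prod_eq_prod (f := fun p x ↦ eI (gaussianCoeff T p * x))]
    simp only [integral_eI_mul_gaussianReal, ← Complex.exp_sum, ← sum_gaussianCoeff_sq]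
    congr 1
    push_cast
    rw [← Finset.sum_div, Finset.sum_neg_distrib]
  · refine (continuous_eI.measurable.comp ?_).aestronglyMeasurable
    refine Finset.measurable_sum _ fun a _ ↦ Finset.measurable_sum _ fun b _ ↦ ?_
    have : Measurable fun m : Matrix (Fin k) (Fin k) 𝕜 ↦ m a b :=
      (measurable_pi_apply b).comp (measurable_pi_apply a)
    fun_prop

end GaussianEnsemble

/-! ### Joint central limit theorem for the groups of quadratic forms. -/

section CentralLimit

variable {𝕜 : Type*} [RCLike 𝕜]

section OpBound

variable {ι : Type*} [Fintype ι]

lemma OpBound.mono {A : Matrix ι ι 𝕜} {η η' : ℝ} (h : OpBound A η) (hη : η ≤ η') :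
    OpBound A η' := by
  refine ⟨h.1.trans hη, fun x ↦ (h.2 x).trans ?_⟩
  have := h.1
  gcongr

lemma OpBound.smul {A : Matrix ι ι 𝕜} {η : ℝ} (h : OpBound A η) {c : ℝ} (hc : 0 ≤ c) :
    OpBound ((c : 𝕜) • A) (c * η) := by
  refine ⟨mul_nonneg hc h.1, fun x ↦ ?_⟩
  simp only [Matrix.smul_mulVec, Pi.smul_apply, smul_eq_mul, norm_mul, mul_pow, RCLike.norm_ofReal,
    sq_abs, ← Finset.mul_sum]
  rw [mul_assoc]
  exact mul_le_mul_of_nonneg_left (h.2 x) (sq_nonneg _)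

omit [Fintype ι] in
lemma isHermitian_smul {A : Matrix ι ι 𝕜} (h : A.IsHermitian) (c : ℝ) :
    ((c : 𝕜) • A).IsHermitian := by
  rw [Matrix.IsHermitian, Matrix.conjTranspose_smul, h.eq]
  simp

lemma sum_norm_sq_smul (c : ℝ) (A : Matrix ι ι 𝕜) :
    ∑ i, ∑ j, ‖((c : 𝕜) • A) i j‖ ^ 2 = c ^ 2 * ∑ i, ∑ j, ‖A i j‖ ^ 2 := by
  simp only [Matrix.smul_apply, smul_eq_mul, norm_mul, mul_pow, RCLike.norm_ofReal, sq_abs,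
    Finset.mul_sum]

end OpBound

variable {J : Type*} [Fintype J] [DecidableEq J] {k : J → ℕ}

lemma sum_blockDiagonal' {M : Type*} [AddCommMonoid M] (T : (j : J) → Matrix (Fin (k j)) (Fin (k j)) 𝕜)
    (f : (s t : Σ j, Fin (k j)) → 𝕜 → M) (hf : ∀ s t, f s t 0 = 0) :
    ∑ s, ∑ t, f s t (Matrix.blockDiagonal' T s t) =
      ∑ j, ∑ a, ∑ b, f ⟨j, a⟩ ⟨j, b⟩ (T j a b) := by
  rw [Fintype.sum_sigma]
  refine Finset.sum_congr rfl fun j _ ↦ Finset.sum_congr rfl fun a _ ↦ ?_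
  rw [Fintype.sum_sigma, Finset.sum_eq_single j]
  · simp
  · intro j' _ hj'
    refine Finset.sum_eq_zero fun b _ ↦ ?_
    rw [Matrix.blockDiagonal'_apply_ne _ _ _ (Ne.symm hj'), hf]
  · simp

omit [Fintype J] in
lemma hermPart_blockDiagonal' (T : (j : J) → Matrix (Fin (k j)) (Fin (k j)) 𝕜) :
    hermPart (Matrix.blockDiagonal' T) = Matrix.blockDiagonal' fun j ↦ hermPart (T j) := by
  simp only [hermPart]
  rw [Matrix.blockDiagonal'_conjTranspose, ← Matrix.blockDiagonal'_add, ← Matrix.blockDiagonal'_smul]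
  rfl

variable {ν : Measure 𝕜} [IsProbabilityMeasure ν] {κ : ℝ}
  {B : J → (n : ℕ) → Matrix (Fin n) (Fin n) 𝕜} (hB : ∀ j n, (B j n).IsHermitian) {C : ℝ}
  (hBC : ∀ j, ∀ᶠ n in atTop, OpBound (B j n) C) {v : J → ℝ}
  (hv : ∀ j, Tendsto (fun n : ℕ ↦ (n : ℝ)⁻¹ * ∑ a, ∑ b, ‖B j n a b‖ ^ 2) atTop (𝓝 (v j)))

-- A block diagonal coefficient matrix couples only vectors of the same group, so `B j` may vary
-- with `j`. The Frobenius norms of the blocks add without cross terms, which is the asymptotic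
-- independence of the groups.
include hB hBC hv in
lemma GaussianMoments.tendsto_integral_eI_bil (h : GaussianMoments ν κ)
    (T : (j : J) → Matrix (Fin (k j)) (Fin (k j)) 𝕜) :
    Tendsto (fun n : ℕ ↦ ∫ x, eI (∑ j, ∑ a, ∑ b, RCLike.re (star (T j a b) *
      bil (((1 / √(n : ℝ) : ℝ) : 𝕜) • B j n) (⟨j, a⟩ : Σ j, Fin (k j)) ⟨j, b⟩ x))
        ∂(Measure.pi fun _ : (Σ j, Fin (k j)) × Fin n ↦ ν)) atTop
      (𝓝 (Complex.exp (-((κ * ∑ j, v j * ∑ a, ∑ b, ‖hermPart (T j) a b‖ ^ 2 : ℝ) : ℂ) / 2))) := by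
  classical
  set D := Matrix.blockDiagonal' T with hD
  have hD0 (s t : Σ j, Fin (k j)) (hst : D s t ≠ 0) : s.1 = t.1 := by
    by_contra h'
    exact hst (Matrix.blockDiagonal'_apply_ne T _ _ h')
  set A : (n : ℕ) → (Σ j, Fin (k j)) → Matrix (Fin n) (Fin n) 𝕜 :=
    fun n s ↦ ((1 / √(n : ℝ) : ℝ) : 𝕜) • B s.1 n with hA
  have hAH (n : ℕ) (s : Σ j, Fin (k j)) : (A n s).IsHermitian := isHermitian_smul (hB _ _) _
  have hAD (n : ℕ) (s t : Σ j, Fin (k j)) (hst : D s t ≠ 0) : A n s = A n t := by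
    simp only [hA, hD0 s t hst]
  set N := √(∑ s, ∑ t, ‖hermPart D t s‖ ^ 2) with hN
  -- The summand `1` makes the bounds `η n = L / √n` positive for `n > 0`; the dimension times `η n
  -- ^ 2` is then the constant required by `tendsto_charFun_quad`.
  set L := |C| * N + 1 with hL
  have hL0 : 0 < L := by positivity
  have hn0 : Tendsto (fun n : ℕ ↦ 1 / √(n : ℝ)) atTop (𝓝 0) := by
    simp only [one_div]
    exact (Real.tendsto_sqrt_atTop.comp tendsto_natCast_atTop_atTop).inv_tendsto_atTop
  have key := h.tendsto_charFun_quad (fun n ↦ blockForm D (A n))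
    (fun n ↦ blockForm_isHermitian (hAH n) (hAD n)) (η := fun n ↦ 1 / √(n : ℝ) * L) ?_ ?_ ?_
    (C := Fintype.card (Σ j, Fin (k j)) * L ^ 2) ?_
    (v := κ * ∑ j, v j * ∑ a, ∑ b, ‖hermPart (T j) a b‖ ^ 2) ?_
  · refine key.congr fun n ↦ ?_
    congr 1
    ext x
    rw [quad_blockForm (hAH n) (hAD n), sum_blockDiagonal' T
      (fun s t y ↦ RCLike.re (star y * bil (A n s) s t x)) (by simp)]
  · filter_upwards [eventually_gt_atTop 0] with n hn
    positivity
  · have : ∀ᶠ n in atTop, ∀ j, OpBound (B j n) C := eventually_all.2 hBC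
    filter_upwards [this] with n hn
    have h1 := opBound_blockForm (T := D) (A := A n) (C := 1 / √(n : ℝ) * |C|)
      (fun s ↦ ((hn s.1).mono (le_abs_self C)).smul (by positivity)) (by positivity)
    refine h1.mono ?_
    rw [mul_assoc]
    exact mul_le_mul_of_nonneg_left (by rw [hL]; linarith) (by positivity)
  · simpa using hn0.mul_const L
  · filter_upwards [eventually_gt_atTop 0] with n hn
    have : (0 : ℝ) < n := by exact_mod_cast hn
    rw [Fintype.card_prod, Fintype.card_fin, mul_pow, div_pow, Real.sq_sqrt this.le]
    push_cast
    apply le_of_eq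
    field_simp
  · refine Tendsto.const_mul κ ?_
    have h1 (n : ℕ) : ∑ b, ∑ c, ‖blockForm D (A n) b c‖ ^ 2 =
        ∑ j, ((1 / √(n : ℝ)) ^ 2 * ∑ a, ∑ b, ‖B j n a b‖ ^ 2) *
          ∑ a, ∑ b, ‖hermPart (T j) a b‖ ^ 2 := by
      rw [sum_norm_sq_blockForm]
      simp only [hA, sum_norm_sq_smul, Finset.sum_mul]
      rw [hD, hermPart_blockDiagonal']
      have := sum_blockDiagonal' (fun j ↦ hermPart (T j)) (fun (s t : Σ j, Fin (k j)) y ↦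
        ‖y‖ ^ 2 * ((1 / √(n : ℝ)) ^ 2 * ∑ a, ∑ b, ‖B t.1 n a b‖ ^ 2)) (by simp)
      rw [Finset.sum_comm, this]
      simp only [Finset.mul_sum]
      refine Finset.sum_congr rfl fun j _ ↦ Finset.sum_congr rfl fun a _ ↦ ?_
      refine Finset.sum_congr rfl fun b _ ↦ ?_
      rw [mul_comm]
      simp only [Finset.mul_sum]
    simp only [h1]
    refine tendsto_finsetSum _ fun j _ ↦ Tendsto.mul_const _ ?_
    refine (hv j).congr fun n ↦ ?_
    rw [div_pow, Real.sq_sqrt (Nat.cast_nonneg n), one_pow, one_div]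

variable {Ω : ℕ → Type*} [∀ n, MeasurableSpace (Ω n)]
  {P : (n : ℕ) → Measure (Ω n)} [∀ n, IsProbabilityMeasure (P n)]
  {Ω' : Type*} [MeasurableSpace Ω'] {P' : Measure Ω'} [IsProbabilityMeasure P']

instance instSecondCountableTopologyMatrix {m n α : Type*} [Countable m] [Countable n]
    [TopologicalSpace α] [SecondCountableTopology α] : SecondCountableTopology (Matrix m n α) :=
  inferInstanceAs (SecondCountableTopology (m → n → α))

lemma measurable_matrix_apply {m n α : Type*} [MeasurableSpace α] (a : m) (b : n) :
    Measurable fun M : Matrix m n α ↦ M a b :=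
  (measurable_pi_apply b).comp (measurable_pi_apply a)

include hB hBC hv in
/-- Joint convergence of the centred quadratic forms to independent Gaussian matrices. -/
lemma GaussianMoments.tendstoInDistribution_bil (h : GaussianMoments ν (2 / dysonIndex 𝕜))
    {G : (n : ℕ) → Ω n → (Σ j, Fin (k j)) × Fin n → 𝕜} (hG : ∀ n, AEMeasurable (G n) (P n))
    (hGP : ∀ n, (P n).map (G n) = Measure.pi fun _ ↦ ν)
    {M : (j : J) → Ω' → Matrix (Fin (k j)) (Fin (k j)) 𝕜}
    (hM_law : ∀ j, HasLaw (M j) (gaussianEnsemble 𝕜 (k j)) P') (hM_indep : iIndepFun M P')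
    {σ : J → ℝ} (hσ : ∀ j, σ j ^ 2 = v j) :
    TendstoInDistribution (fun (n : ℕ) (ω : Ω n) (j : J) ↦
      (Matrix.of fun a b ↦ bil (((1 / √(n : ℝ) : ℝ) : 𝕜) • B j n) (⟨j, a⟩ : Σ j, Fin (k j)) ⟨j, b⟩
        (G n ω) : Matrix (Fin (k j)) (Fin (k j)) 𝕜)) atTop
      (fun ω j ↦ ((σ j : ℝ) : 𝕜) • M j ω) P P' := by
  set I := Σ j, Fin (k j) × Fin (k j)
  let F : (I → 𝕜) → (j : J) → Matrix (Fin (k j)) (Fin (k j)) 𝕜 :=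
    fun y j ↦ Matrix.of fun a b ↦ y ⟨j, a, b⟩
  have hF : Continuous F := by
    refine continuous_pi fun j ↦ continuous_pi fun a ↦ continuous_pi fun b ↦ ?_
    exact continuous_apply _
  let Y : (n : ℕ) → Ω n → I → 𝕜 := fun n ω i ↦ bil (((1 / √(n : ℝ) : ℝ) : 𝕜) • B i.1 n)
    (⟨i.1, i.2.1⟩ : Σ j, Fin (k j)) ⟨i.1, i.2.2⟩ (G n ω)
  let Z : Ω' → I → 𝕜 := fun ω i ↦ ((σ i.1 : ℝ) : 𝕜) * M i.1 ω i.2.1 i.2.2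
  have hZF : (fun ω j ↦ ((σ j : ℝ) : 𝕜) • M j ω) = F ∘ Z := by
    ext ω j a b
    simp [F, Z]
  rw [hZF]
  refine TendstoInDistribution.continuous_comp (X := Y) hF ?_
  have hY (n : ℕ) : AEMeasurable (Y n) (P n) := by
    refine aemeasurable_pi_lambda _ fun i ↦ ?_
    exact (measurable_bil _ _ _).comp_aemeasurable (hG n)
  have hZ : AEMeasurable Z P' := by
    refine aemeasurable_pi_lambda _ fun i ↦ ?_
    have := (measurable_matrix_apply i.2.1 i.2.2).comp_aemeasurable (hM_law i.1).aemeasurable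
    exact this.const_mul _
  refine tendstoInDistribution_of_tendsto_integral_eI hY hZ fun t ↦ ?_
  have h1 := h.tendsto_integral_eI_bil hB hBC hv fun j ↦ Matrix.of fun a b ↦ t ⟨j, a, b⟩
  -- Independence of the `M j` factorises the characteristic function; each factor is that of a
  -- Gaussian ensemble at a coefficient matrix scaled by `σ j`.
  have h2 : ∫ ω, eI (∑ i, RCLike.re (star (t i) * Z ω i)) ∂P' =
      Complex.exp (-((2 / dysonIndex 𝕜 * ∑ j, v j * ∑ a, ∑ b,
        ‖hermPart (Matrix.of fun a b ↦ t ⟨j, a, b⟩) a b‖ ^ 2 : ℝ) : ℂ) / 2) := by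
    let T : (j : J) → Matrix (Fin (k j)) (Fin (k j)) 𝕜 :=
      fun j ↦ ((σ j : ℝ) : 𝕜) • Matrix.of fun a b ↦ t ⟨j, a, b⟩
    let f : (j : J) → Matrix (Fin (k j)) (Fin (k j)) 𝕜 → ℂ :=
      fun j m ↦ eI (∑ a, ∑ b, RCLike.re (star (T j a b) * m a b))
    have hf (j : J) : Measurable (f j) := by
      refine continuous_eI.measurable.comp ?_
      refine Finset.measurable_sum _ fun a _ ↦ Finset.measurable_sum _ fun b _ ↦ ?_
      have := measurable_matrix_apply (α := 𝕜) a b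
      fun_prop
    have h3 (ω : Ω') : eI (∑ i, RCLike.re (star (t i) * Z ω i)) = ∏ j, f j (M j ω) := by
      simp only [f]
      rw [← eI_sum, Fintype.sum_sigma]
      congr 1
      refine Finset.sum_congr rfl fun j _ ↦ ?_
      rw [Fintype.sum_prod_type]
      refine Finset.sum_congr rfl fun a _ ↦ Finset.sum_congr rfl fun b _ ↦ ?_
      simp only [Z, T, Matrix.smul_apply, Matrix.of_apply, smul_eq_mul, star_mul']
      rw [RCLike.star_def, RCLike.conj_ofReal]
      congr 1
      ring
    simp only [h3]
    rw [hM_indep.integral_fun_prod_comp (fun j ↦ (hM_law j).aemeasurable)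
      fun j ↦ (hf j).aestronglyMeasurable]
    have h4 (j : J) : ∫ ω, f j (M j ω) ∂P' = ∫ m, f j m ∂(gaussianEnsemble 𝕜 (k j)) := by
      rw [← (hM_law j).map_eq, integral_map (hM_law j).aemeasurable (hf j).aestronglyMeasurable]
    simp only [h4, f, integral_eI_gaussianEnsemble, ← Complex.exp_sum]
    congr 1
    rw [← Finset.sum_div, Finset.sum_neg_distrib, ← Complex.ofReal_sum, ← Finset.mul_sum]
    congr 5
    ext j
    have h5 : hermPart (T j) = ((σ j : ℝ) : 𝕜) • hermPart (Matrix.of fun a b ↦ t ⟨j, a, b⟩) := by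
      ext a b
      simp only [T, hermPart_apply, Matrix.smul_apply, Matrix.of_apply, smul_eq_mul, star_mul']
      rw [RCLike.star_def, RCLike.conj_ofReal]
      ring
    rw [h5, sum_norm_sq_smul, hσ]
  rw [h2]
  refine h1.congr fun n ↦ ?_
  rw [← hGP n, integral_map (hG n)]
  · congr 1
    ext ω
    rw [Fintype.sum_sigma]
    congr 1
    refine Finset.sum_congr rfl fun j _ ↦ ?_
    rw [Fintype.sum_prod_type]
    rfl
  · refine (continuous_eI.measurable.comp ?_).aestronglyMeasurable
    refine Finset.measurable_sum _ fun j _ ↦ Finset.measurable_sum _ fun a _ ↦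
      Finset.measurable_sum _ fun b _ ↦ ?_
    exact RCLike.continuous_re.measurable.comp ((measurable_bil _ _ _).const_mul _)

end CentralLimit

/-! ### Gram–Schmidt near an orthonormal family. -/

section Orthonormalisation

open Matrix

variable {𝕜 : Type*} [RCLike 𝕜]

/-- The sum of the moduli of the entries. -/
def entrySum {ι ι' : Type*} [Fintype ι] [Fintype ι'] (A : Matrix ι ι' 𝕜) : ℝ := ∑ i, ∑ j, ‖A i j‖

section EntrySum

variable {ι : Type*} [Fintype ι] (A B : Matrix ι ι 𝕜)

lemma entrySum_nonneg : 0 ≤ entrySum A := by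
  unfold entrySum; positivity

lemma norm_le_entrySum (i j : ι) : ‖A i j‖ ≤ entrySum A :=
  (Finset.single_le_sum (f := fun j ↦ ‖A i j‖) (fun _ _ ↦ norm_nonneg _) (Finset.mem_univ j)).trans
    (Finset.single_le_sum (f := fun i ↦ ∑ j, ‖A i j‖)
      (fun _ _ ↦ Finset.sum_nonneg fun _ _ ↦ norm_nonneg _) (Finset.mem_univ i))

lemma entrySum_add_le : entrySum (A + B) ≤ entrySum A + entrySum B := by
  unfold entrySum
  simp only [← Finset.sum_add_distrib]
  gcongr
  exact norm_add_le _ _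

lemma entrySum_conjTranspose : entrySum Aᴴ = entrySum A := by
  unfold entrySum
  rw [Finset.sum_comm]
  simp

lemma entrySum_mul_le : entrySum (A * B) ≤ entrySum A * entrySum B := by
  unfold entrySum
  calc ∑ i, ∑ j, ‖(A * B) i j‖ ≤ ∑ i, ∑ j, ∑ l, ‖A i l‖ * ‖B l j‖ := by
        gcongr with i _ j _
        rw [mul_apply]
        exact (norm_sum_le _ _).trans (by simp)
    _ = ∑ i, ∑ l, ‖A i l‖ * ∑ j, ‖B l j‖ := by
        refine Finset.sum_congr rfl fun i _ ↦ ?_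
        rw [Finset.sum_comm]
        simp only [Finset.mul_sum]
    _ ≤ ∑ i, ∑ l, ‖A i l‖ * ∑ l, ∑ j, ‖B l j‖ := by
        refine Finset.sum_le_sum fun i _ ↦ Finset.sum_le_sum fun l _ ↦ ?_
        exact mul_le_mul_of_nonneg_left (Finset.single_le_sum (f := fun l ↦ ∑ j, ‖B l j‖)
          (fun _ _ ↦ Finset.sum_nonneg fun _ _ ↦ norm_nonneg _) (Finset.mem_univ l))
          (norm_nonneg _)
    _ = _ := by simp only [Finset.sum_mul]

end EntrySum

variable {r : ℕ}

lemma isUnit_of_triangular {R : Matrix (Fin r) (Fin r) 𝕜} (h0 : ∀ s t, t < s → R s t = 0)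
    (hd : ∀ t, ∃ d : ℝ, 0 < d ∧ R t t = d) : IsUnit R := by
  rw [isUnit_iff_isUnit_det, det_of_isUpperTriangular (fun s t h ↦ h0 s t h), isUnit_iff_ne_zero,
    Finset.prod_ne_zero_iff]
  intro t _
  obtain ⟨d, hd0, hd⟩ := hd t
  rw [hd]
  exact_mod_cast hd0.ne'

/-- Stability of the Cholesky factorisation near the identity. -/
lemma entrySum_sub_one_le {R E : Matrix (Fin r) (Fin r) 𝕜} (h0 : ∀ s t, t < s → R s t = 0)
    (hd : ∀ t, ∃ d : ℝ, 0 < d ∧ R t t = d) (hE : Rᴴ * R = 1 + E) (hE1 : entrySum E ≤ 1 / 2) :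
    entrySum (R - 1) ≤ 2 * r ^ 2 * entrySum E := by
  have hu := isUnit_of_triangular h0 hd
  have hdet := (isUnit_iff_isUnit_det R).1 hu
  let : Invertible R := hu.invertible
  have hinv : R * R⁻¹ = 1 := mul_nonsing_inv R hdet
  have htri : BlockTriangular R⁻¹ id :=
    blockTriangular_inv_of_blockTriangular (fun s t h ↦ h0 s t h)
  set L := (R⁻¹)ᴴ with hL
  have hL0 {s t : Fin r} (h : s < t) : L s t = 0 := by
    rw [hL, conjTranspose_apply, htri h, star_zero]
  have hLR : L * Rᴴ = 1 := by rw [hL, ← conjTranspose_mul, hinv, conjTranspose_one]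
  -- `L` is lower triangular, so above the diagonal `R` coincides with `L * E`, which is small once
  -- `L` is bounded.
  have hR : R = L + L * E := by
    calc R = L * Rᴴ * R := by rw [hLR, one_mul]
      _ = L * (1 + E) := by rw [mul_assoc, hE]
      _ = _ := by rw [mul_add, mul_one]
  have hLL : L * (1 + E) * Lᴴ = 1 := by
    rw [← hE, ← mul_assoc, hLR, one_mul, hL, conjTranspose_conjTranspose, hinv]
  -- The conjugated rows of `L` are unit vectors for the form of `1 + E`, which is at least half the
  -- Euclidean one.
  have hLn (s t : Fin r) : ‖L s t‖ ≤ 2 := by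
    have h1 : hform (1 + E) (fun t ↦ star (L s t)) = 1 := by
      have h2 := congrFun (congrFun hLL s) s
      rw [one_apply_eq] at h2
      have h3 : (star fun t ↦ star (L s t)) ⬝ᵥ (1 + E) *ᵥ (fun t ↦ star (L s t)) =
          (L * (1 + E) * Lᴴ) s s := by
        rw [dotProduct_mulVec]
        simp only [mul_apply, dotProduct, vecMul, conjTranspose_apply, Pi.star_apply, star_star]
      rw [hform, h3, h2, RCLike.one_re]
    have h4 : hform (1 + E) (fun t ↦ star (L s t)) =
        ∑ t, ‖L s t‖ ^ 2 + hform E (fun t ↦ star (L s t)) := by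
      have := hform_sub (1 + E) E (fun t ↦ star (L s t))
      rw [add_sub_cancel_right, hform_one] at this
      simp only [norm_star] at this
      linarith
    have h5 := abs_hform_le E (fun t ↦ star (L s t))
    simp only [norm_star] at h5
    have h6 : 0 ≤ ∑ t, ‖L s t‖ ^ 2 := by positivity
    have h7 : ‖L s t‖ ^ 2 ≤ ∑ t, ‖L s t‖ ^ 2 :=
      Finset.single_le_sum (f := fun t ↦ ‖L s t‖ ^ 2) (fun _ _ ↦ by positivity) (Finset.mem_univ t)
    have h8 := mul_le_mul_of_nonneg_right hE1 h6
    have h9 := (abs_le.1 (h5.trans h8)).1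
    have : ‖L s t‖ ^ 2 ≤ 2 ^ 2 := by linarith
    exact le_of_sq_le_sq this two_pos.le
  have hLe : entrySum L ≤ 2 * r ^ 2 := by
    calc entrySum L ≤ ∑ _ : Fin r, ∑ _ : Fin r, 2 := by
          unfold entrySum
          gcongr with s _ t _
          exact hLn s t
      _ = _ := by simp; ring
  refine le_trans ?_ ((entrySum_mul_le L E).trans
    (mul_le_mul_of_nonneg_right hLe (entrySum_nonneg E)))
  unfold entrySum
  gcongr with s _ t _
  rcases lt_trichotomy s t with h | rfl | h
  · have h1 := congrFun (congrFun hR s) t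
    rw [Matrix.add_apply, hL0 h, zero_add] at h1
    rw [Matrix.sub_apply, one_apply_ne h.ne, sub_zero, h1]
  · obtain ⟨d, hd0, hd⟩ := hd s
    have h1 := congrFun (congrFun hR s) s
    have h2 : L s s * (d : 𝕜) = 1 := by
      have h3 := congrFun (congrFun hLR s) s
      rw [mul_apply, one_apply_eq, Finset.sum_eq_single s] at h3
      · rw [conjTranspose_apply, hd] at h3
        simpa using h3
      · intro l _ hl
        rcases lt_or_gt_of_ne hl with hl | hl
        · rw [conjTranspose_apply, h0 s l hl, star_zero, mul_zero]
        · rw [hL0 hl, zero_mul]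
      · simp
    have h3 : L s s = ((d⁻¹ : ℝ) : 𝕜) := by
      rw [RCLike.ofReal_inv]
      exact eq_inv_of_mul_eq_one_left h2
    rw [Matrix.add_apply, hd, h3, ← sub_eq_iff_eq_add', ← RCLike.ofReal_sub] at h1
    rw [Matrix.sub_apply, one_apply_eq, hd, ← h1, ← RCLike.ofReal_one, ← RCLike.ofReal_sub,
      RCLike.norm_ofReal, RCLike.norm_ofReal]
    -- On the diagonal `L s s = d⁻¹`, so the identity controls `d - d⁻¹`; this dominates `d - 1`.
    have h4 : d - d⁻¹ = (d - 1) * (1 + d⁻¹) := by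
      field_simp
      ring
    rw [h4, abs_mul]
    have : 0 < d⁻¹ := by positivity
    exact le_mul_of_one_le_right (abs_nonneg _) (by rw [abs_of_pos] <;> linarith)
  · rw [Matrix.sub_apply, h0 s t h, one_apply_ne h.ne', sub_zero, norm_zero]
    exact norm_nonneg _

variable {n : ℕ}

/-- The matrix with given columns. -/
def columns (v : Fin r → EuclideanSpace 𝕜 (Fin n)) : Matrix (Fin n) (Fin r) 𝕜 :=
  of fun i s ↦ v s i

lemma columns_conjTranspose_mul_apply (v w : Fin r → EuclideanSpace 𝕜 (Fin n)) (s t : Fin r) :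
    ((columns v)ᴴ * columns w) s t = inner 𝕜 (v s) (w t) := by
  simp only [mul_apply, columns, conjTranspose_apply, of_apply, PiLp.inner_apply,
    RCLike.inner_apply, RCLike.star_def]
  exact Finset.sum_congr rfl fun i _ ↦ mul_comm _ _

/-- The deviation of the Gram matrix from the identity. -/
def gramError (v : Fin r → EuclideanSpace 𝕜 (Fin n)) : Matrix (Fin r) (Fin r) 𝕜 :=
  (columns v)ᴴ * columns v - 1

/-- A vanishing combination with coefficients `c` gives the Gram error the value `-‖c‖²`, beyond
what its size permits unless `c = 0`. -/
lemma linearIndependent_of_gramError {v : Fin r → EuclideanSpace 𝕜 (Fin n)}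
    (h : entrySum (gramError v) ≤ 1 / 2) : LinearIndependent 𝕜 v := by
  rw [Fintype.linearIndependent_iff]
  intro c hc
  have h0 : columns v *ᵥ c = 0 := by
    ext i
    have := congrArg (fun w : EuclideanSpace 𝕜 (Fin n) ↦ w i) hc
    simpa [columns, mulVec, dotProduct, mul_comm] using this
  have h1 : hform (gramError v) c = -∑ s, ‖c s‖ ^ 2 := by
    rw [gramError, hform_sub, hform_one, hform, ← mulVec_mulVec, h0]
    simp
  have h2 := abs_hform_le (gramError v) c
  have h6 : 0 ≤ ∑ t, ‖c t‖ ^ 2 := by positivity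
  have h8 := mul_le_mul_of_nonneg_right h h6
  have h9 : |hform (gramError v) c| ≤ 1 / 2 * ∑ t, ‖c t‖ ^ 2 := h2.trans h8
  rw [h1, abs_neg, abs_of_nonneg h6] at h9
  intro s
  have h7 : ‖c s‖ ^ 2 ≤ ∑ t, ‖c t‖ ^ 2 :=
    Finset.single_le_sum (f := fun t ↦ ‖c t‖ ^ 2) (fun _ _ ↦ by positivity) (Finset.mem_univ s)
  have h10 : ‖c s‖ ^ 2 ≤ 0 := by linarith
  exact norm_eq_zero.1 (pow_eq_zero_iff two_ne_zero |>.1 (le_antisymm h10 (sq_nonneg _)))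

-- QR factorisation, where `R` records the inner products of the orthonormal vectors with the
-- original ones; its diagonal consists of the norms of the unnormalised Gram–Schmidt vectors, which
-- are nonzero by independence.
open InnerProductSpace in
lemma exists_triangular {v : Fin r → EuclideanSpace 𝕜 (Fin n)} (h : LinearIndependent 𝕜 v) :
    ∃ R : Matrix (Fin r) (Fin r) 𝕜, (∀ s t, t < s → R s t = 0) ∧
      (∀ t, ∃ d : ℝ, 0 < d ∧ R t t = d) ∧ columns v = columns (gramSchmidtNormed 𝕜 v) * R ∧
      (columns (gramSchmidtNormed 𝕜 v))ᴴ * columns (gramSchmidtNormed 𝕜 v) = 1 := by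
  have ho := gramSchmidtNormed_orthonormal h
  refine ⟨of fun s t ↦ inner 𝕜 (gramSchmidtNormed 𝕜 v s) (v t), fun s t hst ↦ ?_, fun t ↦ ?_, ?_, ?_⟩
  · rw [of_apply, gramSchmidtNormed, inner_smul_left, gramSchmidt_inv_triangular 𝕜 v hst, mul_zero]
  · have hne := gramSchmidt_ne_zero t h
    refine ⟨‖gramSchmidt 𝕜 v t‖, norm_pos_iff.2 hne, ?_⟩
    have h1 : inner 𝕜 (gramSchmidt 𝕜 v t) (v t) = (‖gramSchmidt 𝕜 v t‖ : 𝕜) ^ 2 := by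
      conv_lhs => rw [gramSchmidt_def'' 𝕜 v t]
      rw [inner_add_right, inner_self_eq_norm_sq_to_K, inner_sum, Finset.sum_eq_zero, add_zero]
      intro i hi
      rw [inner_smul_right, gramSchmidt_orthogonal 𝕜 v (Finset.mem_Iio.1 hi).ne', mul_zero]
    rw [of_apply, gramSchmidtNormed, inner_smul_left, h1, map_inv₀, RCLike.conj_ofReal]
    have : (‖gramSchmidt 𝕜 v t‖ : 𝕜) ≠ 0 := by exact_mod_cast (norm_pos_iff.2 hne).ne'
    field_simp
  · ext i t
    have hmem : v t ∈ Submodule.span 𝕜 (Set.range (gramSchmidtNormed 𝕜 v)) := by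
      rw [span_gramSchmidtNormed_range, span_gramSchmidt]
      exact Submodule.subset_span ⟨t, rfl⟩
    obtain ⟨c, hc⟩ := (Submodule.mem_span_range_iff_exists_fun 𝕜).1 hmem
    have hcs (s : Fin r) : inner 𝕜 (gramSchmidtNormed 𝕜 v s) (v t) = c s := by
      rw [← hc, ho.inner_right_fintype]
    have := congrArg (fun w : EuclideanSpace 𝕜 (Fin n) ↦ w i) hc
    simp only [mul_apply, columns, of_apply, hcs]
    simp only [WithLp.ofLp_sum, WithLp.ofLp_smul, Finset.sum_apply, Pi.smul_apply, smul_eq_mul] at this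
    rw [← this]
    exact Finset.sum_congr rfl fun s _ ↦ mul_comm _ _
  · ext s t
    rw [columns_conjTranspose_mul_apply, orthonormal_iff_ite.1 ho, one_apply]

/-- `1` in the orthonormalised model and `0` in the i.i.d. model. -/
def Model.indicator : Model → ℝ
  | .iid => 0
  | .orthonormalised => 1

/-- In both models, up to a congruence, the orthonormalisation adds an explicit correction to the
inertia count. -/
lemma exists_correction (θ : Fin r → ℝ) : ∃ C, 0 ≤ C ∧ ∀ (model : Model) (n : ℕ)
    (g : Fin r → Fin n → 𝕜), entrySum (gramError (rescaledVectors g)) ≤ 1 / 2 →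
    ∃ F : Matrix (Fin r) (Fin r) 𝕜,
      entrySum F ≤ C * entrySum (gramError (rescaledVectors g)) ∧
      (∀ a b, θ a = θ b → ‖F a b - ((model.indicator / θ a : ℝ) : 𝕜) *
        gramError (rescaledVectors g) a b‖ ≤ C * entrySum (gramError (rescaledVectors g)) ^ 2) ∧
      ∀ Q : Matrix (Fin n) (Fin n) 𝕜,
        npos (diagonal (fun a ↦ ((1 / θ a : ℝ) : 𝕜)) - (columns (perturbationVectors model g))ᴴ *
          Q * columns (perturbationVectors model g)) =
        npos (diagonal (fun a ↦ ((1 / θ a : ℝ) : 𝕜)) + F -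
          (columns (rescaledVectors g))ᴴ * Q * columns (rescaledVectors g)) := by
  set T : Matrix (Fin r) (Fin r) 𝕜 := diagonal (fun a ↦ ((1 / θ a : ℝ) : 𝕜)) with hT
  set c : ℝ := 2 * r ^ 2 with hc
  set τ := entrySum T with hτ
  have hτ0 : 0 ≤ τ := entrySum_nonneg T
  have hc0 : 0 ≤ c := by positivity
  -- `2 τ c` pays for the two terms linear in `R - 1`, and `2 τ c²` for the quadratic ones.
  refine ⟨2 * τ * c + 2 * τ * c ^ 2, by positivity, fun model n g hE ↦ ?_⟩
  set E := gramError (rescaledVectors g) with hEdef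
  have hE0 := entrySum_nonneg E
  cases model with
  | iid =>
    refine ⟨0, ?_, fun a b _ ↦ ?_, fun Q ↦ ?_⟩
    · simp only [entrySum, Matrix.zero_apply, norm_zero, Finset.sum_const_zero] at hE0 ⊢
      positivity
    · simp only [Matrix.zero_apply, Model.indicator, zero_div, map_zero, zero_mul, sub_zero,
        norm_zero]
      positivity
    · rw [add_zero]
      rfl
  | orthonormalised =>
    obtain ⟨R, h0, hd, hVR, hUU⟩ := exists_triangular (linearIndependent_of_gramError hE)
    set U := columns (InnerProductSpace.gramSchmidtNormed 𝕜 (rescaledVectors g)) with hU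
    have hRR : Rᴴ * R = 1 + E := by
      rw [hEdef, gramError, add_sub_cancel, hVR, conjTranspose_mul, Matrix.mul_assoc, ← Matrix.mul_assoc Uᴴ,
        hUU, Matrix.one_mul]
    have hu := isUnit_of_triangular h0 hd
    have hD := entrySum_sub_one_le h0 hd hRR hE
    set D := R - 1 with hDdef
    have hRD : R = 1 + D := by rw [hDdef, add_sub_cancel]
    have hD0 := entrySum_nonneg D
    have hDT := entrySum_conjTranspose D
    have e1 : Rᴴ * T * R - T = Dᴴ * T + (T * D + Dᴴ * T * D) := by
      rw [hRD, conjTranspose_add, conjTranspose_one]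
      noncomm_ring
    have e2 : entrySum (Dᴴ * T * D) ≤ τ * entrySum D ^ 2 := by
      refine (entrySum_mul_le _ _).trans ?_
      have := mul_le_mul_of_nonneg_right (entrySum_mul_le Dᴴ T) hD0
      rw [hDT] at this
      refine this.trans (le_of_eq ?_)
      ring
    have e3 : entrySum D ^ 2 ≤ c ^ 2 * entrySum E ^ 2 := by
      rw [← mul_pow]
      exact pow_le_pow_left₀ hD0 hD 2
    -- Congruence by `R` turns `U* Q U` into `V* Q V` because `V = U R`; the price is this change of
    -- the diagonal part.
    refine ⟨Rᴴ * T * R - T, ?_, fun a b hab ↦ ?_, fun Q ↦ ?_⟩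
    · rw [e1]
      have e4 := (entrySum_add_le (Dᴴ * T) (T * D + Dᴴ * T * D)).trans
        (add_le_add_right (entrySum_add_le _ _) _)
      have e5 := entrySum_mul_le Dᴴ T
      have e6 := entrySum_mul_le T D
      rw [hDT] at e5
      have e7 : entrySum E ^ 2 ≤ entrySum E := by nlinarith
      have e8 : τ * entrySum D ^ 2 ≤ τ * (c ^ 2 * entrySum E) :=
        mul_le_mul_of_nonneg_left (e3.trans (mul_le_mul_of_nonneg_left e7 (by positivity))) hτ0
      have e9 : τ * entrySum D ≤ τ * (c * entrySum E) := mul_le_mul_of_nonneg_left hD hτ0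
      have e10 : 0 ≤ τ * (c ^ 2 * entrySum E) := by positivity
      nlinarith
    -- Where `θ a = θ b`, the linear part of the correction is `1 / θ a` times `D + D*`, and the
    -- Gram identity replaces `D + D*` by `E` up to second order.
    · have f1 : D + Dᴴ = E - Dᴴ * D := by
        have : Rᴴ * R = 1 + (D + Dᴴ + Dᴴ * D) := by
          rw [hRD, conjTranspose_add, conjTranspose_one]
          noncomm_ring
        rw [hRR] at this
        rw [add_left_cancel this]
        simp
      have f2 : (Rᴴ * T * R - T) a b - ((1 / θ a : ℝ) : 𝕜) * E a b =
          (Dᴴ * T * D) a b - ((1 / θ a : ℝ) : 𝕜) * (Dᴴ * D) a b := by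
        have f3 : E = D + Dᴴ + Dᴴ * D := by rw [f1]; simp
        rw [e1, Matrix.add_apply, Matrix.add_apply, hT, mul_diagonal, diagonal_mul, f3, Matrix.add_apply, Matrix.add_apply, hab]
        ring
      have f4 : ‖((1 / θ a : ℝ) : 𝕜)‖ ≤ τ := by
        have := norm_le_entrySum T a a
        rwa [hT, diagonal_apply_eq] at this
      have f5 := (norm_le_entrySum (Dᴴ * D) a b).trans (entrySum_mul_le _ _)
      rw [hDT, ← sq] at f5
      simp only [Model.indicator]
      rw [f2]
      calc _ ≤ ‖(Dᴴ * T * D) a b‖ + ‖((1 / θ a : ℝ) : 𝕜)‖ * ‖(Dᴴ * D) a b‖ := by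
            rw [← norm_mul]
            exact norm_sub_le _ _
        _ ≤ τ * entrySum D ^ 2 + τ * entrySum D ^ 2 := by
            gcongr
            exact (norm_le_entrySum _ a b).trans e2
        _ ≤ 2 * τ * c ^ 2 * entrySum E ^ 2 := by
            nlinarith [mul_le_mul_of_nonneg_left e3 hτ0]
        _ ≤ _ := by
            gcongr
            have : 0 ≤ 2 * τ * c := by positivity
            linarith
    · rw [← npos_conj hu]
      congr 1
      have : columns (perturbationVectors .orthonormalised g) = U := rfl
      rw [mul_sub, sub_mul, add_sub_cancel, hVR, conjTranspose_mul, this]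
      simp only [Matrix.mul_assoc]

end Orthonormalisation

/-! ### Reduction of the perturbed count to an `r × r` matrix. -/

section Inertia

open Matrix

variable {𝕜 : Type*} [RCLike 𝕜]

lemma entrySum_sub_comm {ι : Type*} [Fintype ι] (A B : Matrix ι ι 𝕜) :
    entrySum (A - B) = entrySum (B - A) := by
  unfold entrySum
  simp only [Matrix.sub_apply, norm_sub_rev]

lemma npos_sub_smul_one_le {ι : Type*} [Fintype ι] [DecidableEq ι] {A B : Matrix ι ι 𝕜} {ε : ℝ}
    (h : entrySum (A - B) ≤ ε) : npos (A - (ε : 𝕜) • 1) ≤ npos B := by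
  refine npos_mono fun x ↦ ?_
  rw [hform_sub, hform_smul, hform_one]
  have h1 := (abs_le.1 (abs_hform_le (A - B) x)).2
  rw [hform_sub] at h1
  have h2 : entrySum (A - B) * ∑ i, ‖x i‖ ^ 2 ≤ ε * ∑ i, ‖x i‖ ^ 2 :=
    mul_le_mul_of_nonneg_right h (by positivity)
  unfold entrySum at h2
  linarith

/-- Stability of the inertia of a matrix close, after rescaling, to a block diagonal one. -/
lemma npos_block_bounds {k ι' ι : Type*} [Fintype k] [Fintype ι'] [Fintype ι] [DecidableEq k]
    [DecidableEq ι'] (e : k ⊕ ι' ≃ ι)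
    (H : Matrix ι ι 𝕜) {W : Matrix k k 𝕜} (hW : W.IsHermitian) {δ : ι' → ℝ} {t y ε : ℝ} (ht : 0 < t)
    (hδ : ∀ a, ε < |δ a|)
    (hM : entrySum ((diagonal (Sum.elim (fun _ ↦ (t : 𝕜)) fun _ ↦ 1)) * H.submatrix e e *
      (diagonal (Sum.elim (fun _ ↦ (t : 𝕜)) fun _ ↦ 1)) -
      fromBlocks ((y : 𝕜) • 1 - W) 0 0 (diagonal fun a ↦ ((δ a : ℝ) : 𝕜))) ≤ ε) :
    npos (((y - ε : ℝ) : 𝕜) • 1 - W) + (Finset.univ.filter fun a ↦ 0 < δ a).card ≤ npos H ∧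
    npos H ≤ npos (((y + ε : ℝ) : 𝕜) • 1 - W) + (Finset.univ.filter fun a ↦ 0 < δ a).card := by
  set D : Matrix (k ⊕ ι') (k ⊕ ι') 𝕜 := diagonal (Sum.elim (fun _ ↦ (t : 𝕜)) fun _ ↦ 1) with hD
  have hε : 0 ≤ ε := (entrySum_nonneg _).trans hM
  have hDu : IsUnit D := by
    rw [isUnit_iff_isUnit_det, det_diagonal, isUnit_iff_ne_zero, Finset.prod_ne_zero_iff]
    rintro (a | a) _
    · simpa using ht.ne'
    · simp
  have hDD : Dᴴ = D := by
    rw [hD, diagonal_conjTranspose]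
    congr 1
    ext (a | a) <;> simp
  have h1 : npos (D * H.submatrix e e * D) = npos H := by
    have := npos_conj hDu (H.submatrix e e)
    rw [hDD] at this
    rw [this]
    exact npos_reindex e.symm H
  have h2 (c : ℝ) : fromBlocks ((y : 𝕜) • 1 - W) 0 0 (diagonal fun a ↦ ((δ a : ℝ) : 𝕜)) -
      (c : 𝕜) • 1 = fromBlocks (((y - c : ℝ) : 𝕜) • 1 - W) 0 0
        (diagonal fun a ↦ ((δ a - c : ℝ) : 𝕜)) := by
    rw [← fromBlocks_one, fromBlocks_smul, sub_eq_add_neg, fromBlocks_neg, fromBlocks_add]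
    congr 1
    · rw [RCLike.ofReal_sub, sub_smul]
      abel
    · simp
    · simp
    · rw [← sub_eq_add_neg, smul_one_eq_diagonal, diagonal_sub]
      congr 1
      ext a
      simp
  -- A shift of size at most `ε` cannot change the sign of any `δ a`, so it only moves the level `y`
  -- of the block `W`.
  have h3 (c : ℝ) (hc : |c| ≤ ε) : npos (fromBlocks ((y : 𝕜) • 1 - W) 0 0
      (diagonal fun a ↦ ((δ a : ℝ) : 𝕜)) - (c : 𝕜) • 1) =
        npos (((y - c : ℝ) : 𝕜) • 1 - W) + (Finset.univ.filter fun a ↦ 0 < δ a).card := by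
    rw [h2, npos_fromBlocks, npos_diagonal fun a ↦ δ a - c]
    · congr 2
      refine Finset.filter_congr fun a _ ↦ ?_
      have := hδ a
      have := abs_le.1 hc
      rcases abs_cases (δ a) with ⟨h, h'⟩ | ⟨h, h'⟩
      · constructor <;> intro <;> linarith
      · constructor <;> intro <;> linarith
    · exact (isHermitian_smul isHermitian_one _).sub hW
    · rw [Matrix.IsHermitian, diagonal_conjTranspose]
      congr 1
      ext a
      simp
  constructor
  · rw [← h1, ← h3 ε (abs_of_nonneg hε).le]
    exact npos_sub_smul_one_le ((entrySum_sub_comm _ _).trans_le hM)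
  · have h4 := h3 (-ε) (by rw [abs_neg, abs_of_nonneg hε])
    rw [sub_neg_eq_add] at h4
    rw [← h1, ← h4]
    refine le_trans (le_of_eq ?_) (npos_sub_smul_one_le (ε := ε)
      (A := D * H.submatrix e e * D + (ε : 𝕜) • 1) ?_)
    · rw [add_sub_cancel_right]
    · rwa [RCLike.ofReal_neg, neg_smul, sub_neg_eq_add, add_sub_add_right_eq_sub]

variable {n r : ℕ}

lemma perturbedMatrix_eq (X : Matrix (Fin n) (Fin n) 𝕜) (θ : Fin r → ℝ)
    (u : Fin r → EuclideanSpace 𝕜 (Fin n)) : perturbedMatrix X θ u =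
      X + columns u * diagonal (fun a ↦ ((θ a : ℝ) : 𝕜)) * (columns u)ᴴ := by
  rw [perturbedMatrix]
  congr 1
  ext i j
  rw [mul_apply]
  simp only [Matrix.sum_apply, columns, mul_diagonal, of_apply, Matrix.smul_apply,
    vecMulVec_apply, conjTranspose_apply, Pi.star_apply, smul_eq_mul]
  exact Finset.sum_congr rfl fun a _ ↦ by ring

lemma isHermitian_diagonal_ofReal {ι : Type*} [DecidableEq ι] (d : ι → ℝ) :
    (diagonal fun a ↦ ((d a : ℝ) : 𝕜)).IsHermitian := by
  rw [Matrix.IsHermitian, diagonal_conjTranspose]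
  congr 1
  ext a
  simp

lemma perturbedMatrix_isHermitian {X : Matrix (Fin n) (Fin n) 𝕜} (hX : X.IsHermitian)
    (θ : Fin r → ℝ) (u : Fin r → EuclideanSpace 𝕜 (Fin n)) :
    (perturbedMatrix X θ u).IsHermitian := by
  rw [perturbedMatrix_eq]
  refine hX.add ?_
  rw [Matrix.IsHermitian, conjTranspose_mul, conjTranspose_mul, conjTranspose_conjTranspose,
    (isHermitian_diagonal_ofReal θ).eq, Matrix.mul_assoc]

/-- `npos_schur` for the diagonal blocks `z - X` and `Θ⁻¹`: eliminating `Θ⁻¹` leaves `z - X - UΘU*`,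
and eliminating `z - X` leaves the small matrix. -/
lemma npos_perturbedMatrix {X : Matrix (Fin n) (Fin n) 𝕜} (hX : X.IsHermitian)
    {θ : Fin r → ℝ} (hθ : ∀ a, θ a ≠ 0) (u : Fin r → EuclideanSpace 𝕜 (Fin n)) {z : ℝ}
    (hz : ∀ i, z - hX.eigenvalues i ≠ 0) :
    npos ((z : 𝕜) • 1 - perturbedMatrix X θ u) + (Finset.univ.filter fun a ↦ 0 < θ a).card =
      npos ((z : 𝕜) • 1 - X) + npos (diagonal (fun a ↦ ((1 / θ a : ℝ) : 𝕜)) -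
        (columns u)ᴴ * specFun hX (fun l ↦ 1 / (z - l)) * columns u) := by
  have h1 : ((z : 𝕜) • 1 - X) * specFun hX (fun l ↦ 1 / (z - l)) = 1 := by
    have h2 : (z : 𝕜) • 1 - X = specFun hX fun l ↦ z - l := by
      rw [specFun_sub, specFun_const, specFun_id]
    rw [h2, specFun_mul, specFun_congr hX (g := fun _ ↦ 1), specFun_const]
    · simp
    · intro i
      exact mul_one_div_cancel (hz i)
  have h3 : (diagonal fun a ↦ ((1 / θ a : ℝ) : 𝕜)) * (diagonal fun a ↦ ((θ a : ℝ) : 𝕜)) = 1 := by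
    rw [diagonal_mul_diagonal, ← diagonal_one]
    congr 1
    ext a
    rw [← RCLike.ofReal_mul, one_div_mul_cancel (hθ a), RCLike.ofReal_one]
  have h4 := npos_schur ((isHermitian_smul isHermitian_one z).sub hX)
    (isHermitian_diagonal_ofReal fun a ↦ 1 / θ a) h1 h3 (columns u)
  rw [h4, npos_diagonal fun a ↦ 1 / θ a, add_comm, perturbedMatrix_eq, sub_sub]
  congr 2
  exact Finset.filter_congr fun a _ ↦ one_div_pos.symm

section Bil

variable {K K' ι : Type*} [DecidableEq K] [DecidableEq K'] [Fintype ι]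

lemma bil_smul (c : ℝ) (A : Matrix ι ι 𝕜) (s t : K) (x : K × ι → 𝕜) :
    bil ((c : 𝕜) • A) s t x = c * bil A s t x := by
  simp only [bil, smul_mulVec, dotProduct_smul, trace_smul, smul_eq_mul]
  split_ifs <;> ring

lemma bil_sub (A B : Matrix ι ι 𝕜) (s t : K) (x : K × ι → 𝕜) :
    bil (A - B) s t x = bil A s t x - bil B s t x := by
  simp only [bil, sub_mulVec, dotProduct_sub, trace_sub]
  split_ifs <;> ring

lemma bil_comp {f : K' → K} (hf : Function.Injective f) (A : Matrix ι ι 𝕜) (s t : K')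
    (x : K × ι → 𝕜) : bil A s t (fun p ↦ x (f p.1, p.2)) = bil A (f s) (f t) x := by
  simp only [bil, hf.eq_iff]

lemma star_bil {A : Matrix ι ι 𝕜} (hA : A.IsHermitian) (s t : K) (x : K × ι → 𝕜) :
    star (bil A s t x) = bil A t s x := by
  have h1 : star A.trace = A.trace := by rw [← trace_conjTranspose, hA.eq]
  have h2 (y z : ι → 𝕜) : star (star y ⬝ᵥ A *ᵥ z) = star z ⬝ᵥ A *ᵥ y := by
    rw [star_dotProduct, star_star, star_mulVec, hA.eq, ← dotProduct_mulVec]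
  simp only [bil, star_sub, h2, eq_comm (a := s) (b := t)]
  split_ifs <;> simp [h1]

end Bil

lemma columns_conjTranspose_mul_mul_apply (Q : Matrix (Fin n) (Fin n) 𝕜) (g : Fin r → Fin n → 𝕜)
    (a b : Fin r) : ((columns (rescaledVectors g))ᴴ * Q * columns (rescaledVectors g)) a b =
      bil (((1 / (n : ℝ) : ℝ) : 𝕜) • Q) a b (fun p ↦ g p.1 p.2) +
        if a = b then ((1 / (n : ℝ) : ℝ) : 𝕜) * Q.trace else 0 := by
  set c : 𝕜 := ((1 / √(n : ℝ) : ℝ) : 𝕜) with hc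
  have h1 : c * c = ((1 / (n : ℝ) : ℝ) : 𝕜) := by
    rw [hc, ← RCLike.ofReal_mul, div_mul_div_comm, one_mul, Real.mul_self_sqrt (Nat.cast_nonneg n)]
  have h2 : star c = c := by rw [hc, RCLike.star_def, RCLike.conj_ofReal]
  have h3 : ((columns (rescaledVectors g))ᴴ * Q * columns (rescaledVectors g)) a b =
      (star (c • g a)) ⬝ᵥ Q *ᵥ (c • g b) := by
    rw [dotProduct_mulVec]
    simp only [mul_apply, dotProduct, vecMul, conjTranspose_apply, Pi.star_apply, columns, of_apply,
      rescaledVectors, Pi.smul_apply, smul_eq_mul]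
    rfl
  rw [h3, bil, smul_mulVec, mulVec_smul, star_smul, smul_dotProduct, dotProduct_smul,
    dotProduct_smul, trace_smul, h2, smul_smul, h1]
  simp

lemma gramError_apply (hn : 0 < n) (g : Fin r → Fin n → 𝕜) (a b : Fin r) :
    gramError (rescaledVectors g) a b =
      bil (((1 / (n : ℝ) : ℝ) : 𝕜) • (1 : Matrix (Fin n) (Fin n) 𝕜)) a b (fun p ↦ g p.1 p.2) := by
  have h := columns_conjTranspose_mul_mul_apply 1 g a b
  rw [Matrix.mul_one] at h
  rw [gramError, Matrix.sub_apply, h, trace_one, Fintype.card_fin, one_apply]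
  have : ((1 / (n : ℝ) : ℝ) : 𝕜) * (n : 𝕜) = 1 := by
    rw [RCLike.ofReal_div, RCLike.ofReal_one, RCLike.ofReal_natCast]
    exact one_div_mul_cancel (by exact_mod_cast hn.ne')
  rw [this, add_sub_cancel_right]

end Inertia

/-! ### The unperturbed resolvent near `ρ`. -/

section Resolvent

variable {𝕜 : Type*} [RCLike 𝕜] {μ : Measure ℝ} [IsProbabilityMeasure μ]
  {X : (n : ℕ) → Matrix (Fin n) (Fin n) 𝕜} (hX : ∀ n, (X n).IsHermitian)
  (hspec : SpectralConvergence X μ) {ρ : ℝ} (hρ : ρ < lowerEdge μ ∨ upperEdge μ < ρ)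

-- `c` is one third of the distance from `ρ` to the nearest edge: one third is spent on moving `ρ`,
-- one on moving the eigenvalues, and one remains.
include hspec hρ in
lemma exists_gap : ∃ c, 0 < c ∧ ∀ᶠ n in atTop, ∀ w, |w - ρ| ≤ c → ∀ i,
    c ≤ |w - (hX n).eigenvalues i| ∧ ((hX n).eigenvalues i < w ↔ upperEdge μ < ρ) := by
  have hab := lowerEdge_le_upperEdge hspec.compact_support
  rcases hρ with h | h
  · have hc : 0 < (lowerEdge μ - ρ) / 3 := by linarith
    refine ⟨_, hc, ?_⟩
    filter_upwards [eventually_eigenvalues_mem hX hspec hc] with n hn w hw i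
    have h1 := (hn i).1
    have h2 := (abs_le.1 hw).2
    refine ⟨?_, ?_⟩
    · rw [abs_sub_comm, le_abs]
      left
      linarith
    · constructor <;> intro <;> linarith
  · have hc : 0 < (ρ - upperEdge μ) / 3 := by linarith
    refine ⟨_, hc, ?_⟩
    filter_upwards [eventually_eigenvalues_mem hX hspec hc] with n hn w hw i
    have h1 := (hn i).2
    have h2 := (abs_le.1 hw).1
    refine ⟨?_, ?_⟩
    · rw [le_abs]
      left
      linarith
    · constructor <;> intro <;> linarith

omit [IsProbabilityMeasure μ] in
include hρ in
lemma exists_Icc_subset : ∃ ε, 0 < ε ∧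
    Set.Icc (lowerEdge μ - ε) (upperEdge μ + ε) ⊆ {x | ρ - x ≠ 0} := by
  rcases hρ with h | h
  · exact ⟨(lowerEdge μ - ρ) / 2, by linarith, fun x hx ↦ by
      have := hx.1; show ρ - x ≠ 0; intro h'; linarith⟩
  · exact ⟨(ρ - upperEdge μ) / 2, by linarith, fun x hx ↦ by
      have := hx.2; show ρ - x ≠ 0; intro h'; linarith⟩

include hspec hρ in
lemma tendsto_sum_of_continuousOn {f : ℝ → ℝ} (hf : ContinuousOn f {x | ρ - x ≠ 0}) :
    Tendsto (fun n : ℕ ↦ (n : ℝ)⁻¹ * ∑ i, f ((hX n).eigenvalues i)) atTop (𝓝 (∫ x, f x ∂μ)) := by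
  obtain ⟨ε, hε, hsub⟩ := exists_Icc_subset hρ
  exact tendsto_sum_eigenvalues hX hspec hε (hf.mono hsub)

include hρ in
lemma integrable_of_continuousOn (hc : IsCompact μ.support) {f : ℝ → ℝ}
    (hf : ContinuousOn f {x | ρ - x ≠ 0}) : Integrable f μ := by
  obtain ⟨ε, hε, hsub⟩ := exists_Icc_subset hρ
  have h1 : IntegrableOn f (Set.Icc (lowerEdge μ) (upperEdge μ)) μ :=
    (hf.mono ((Set.Icc_subset_Icc (by linarith) (by linarith)).trans hsub)).integrableOn_compact
      isCompact_Icc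
  rwa [IntegrableOn, Measure.restrict_eq_self_of_ae_mem (ae_mem_Icc hc)] at h1

lemma continuousOn_inv_sub (ρ : ℝ) : ContinuousOn (fun x ↦ 1 / (ρ - x)) {x | ρ - x ≠ 0} :=
  continuousOn_const.div (by fun_prop) fun _ hx ↦ hx

lemma continuousOn_inv_sub_sq (ρ : ℝ) : ContinuousOn (fun x ↦ 1 / (ρ - x) ^ 2) {x | ρ - x ≠ 0} :=
  continuousOn_const.div (by fun_prop) fun _ hx ↦ pow_ne_zero 2 hx

include hρ in
lemma integral_inv_sub_sub_sq (hc : IsCompact μ.support) (β : ℝ) :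
    ∫ x, (1 / (ρ - x) - β) ^ 2 ∂μ =
      ∫ x, 1 / (ρ - x) ^ 2 ∂μ - 2 * β * cauchyTransform μ ρ + β ^ 2 := by
  have h1 := integrable_of_continuousOn hρ hc (continuousOn_inv_sub_sq ρ)
  have h2 := integrable_of_continuousOn hρ hc (continuousOn_inv_sub ρ)
  have h3 (x : ℝ) : (1 / (ρ - x) - β) ^ 2 =
      1 / (ρ - x) ^ 2 - 2 * β * (1 / (ρ - x)) + β ^ 2 := by
    rw [← one_div_pow]; ring
  simp only [h3]
  rw [integral_add (f := fun x ↦ 1 / (ρ - x) ^ 2 - 2 * β * (1 / (ρ - x))) (g := fun _ ↦ β ^ 2)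
    (h1.sub (h2.const_mul _)) (integrable_const _),
    integral_sub h1 (h2.const_mul _), integral_const_mul]
  simp [cauchyTransform]

-- The nonnegative integral of `(1 / (ρ - x) - 1 / α)²` equals the integral in question minus `α⁻²`.
include hρ in
lemma integral_inv_sq_pos (hc : IsCompact μ.support) {α : ℝ} (hα : α ≠ 0)
    (hG : cauchyTransform μ ρ = 1 / α) : 0 < ∫ x, 1 / (ρ - x) ^ 2 ∂μ := by
  have h1 := integral_inv_sub_sub_sq hρ hc (1 / α)
  have h2 : 0 ≤ ∫ x, (1 / (ρ - x) - 1 / α) ^ 2 ∂μ := integral_nonneg fun x ↦ sq_nonneg _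
  rw [hG] at h1
  have h3 : 0 < (1 / α) ^ 2 := by positivity
  nlinarith

/-- The point `ρ + x / √n`. -/
def shifted (ρ x : ℝ) (n : ℕ) : ℝ := ρ + x / √(n : ℝ)

lemma tendsto_div_sqrt (x : ℝ) : Tendsto (fun n : ℕ ↦ x / √(n : ℝ)) atTop (𝓝 0) :=
  (Real.tendsto_sqrt_atTop.comp tendsto_natCast_atTop_atTop).const_div_atTop x

include hspec hρ in
lemma exists_gap_shifted (x : ℝ) : ∃ c, 0 < c ∧ ∀ᶠ n in atTop, 0 < n ∧ ∀ i,
    c ≤ |ρ - (hX n).eigenvalues i| ∧ c ≤ |shifted ρ x n - (hX n).eigenvalues i| ∧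
    ((hX n).eigenvalues i < shifted ρ x n ↔ upperEdge μ < ρ) := by
  obtain ⟨c, hc, h⟩ := exists_gap hX hspec hρ
  refine ⟨c, hc, ?_⟩
  have h1 := (tendsto_div_sqrt x).abs
  rw [abs_zero] at h1
  filter_upwards [h, h1.eventually_lt_const hc, eventually_gt_atTop 0] with n hn hx hn0
  refine ⟨hn0, fun i ↦ ⟨(hn ρ (by simpa using hc.le) i).1, hn _ ?_ i⟩⟩
  rw [shifted, add_sub_cancel_left]
  exact hx.le

lemma abs_mean_le {n : ℕ} {f : Fin n → ℝ} {C : ℝ} (hC : 0 ≤ C) (hf : ∀ i, |f i| ≤ C) :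
    |(n : ℝ)⁻¹ * ∑ i, f i| ≤ C := by
  rw [abs_mul, abs_of_nonneg (by positivity)]
  calc (n : ℝ)⁻¹ * |∑ i, f i| ≤ (n : ℝ)⁻¹ * ∑ _ : Fin n, C := by
        gcongr
        exact (Finset.abs_sum_le_sum_abs _ _).trans (Finset.sum_le_sum fun i _ ↦ hf i)
    _ = ((n : ℝ)⁻¹ * n) * C := by simp; ring
    _ ≤ 1 * C := by
        gcongr
        exact inv_mul_le_one
    _ = C := one_mul C

-- Second-order expansion of the resolvent at `ρ`, multiplied by `√n`: the fast convergence
-- hypothesis removes the constant term, the linear term gives the limit, and the remainder is of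
-- order `1 / √n`.
include hspec hρ in
lemma tendsto_resolvent {α : ℝ} (hG : cauchyTransform μ ρ = 1 / α)
    (hfast : Tendsto (fun n : ℕ ↦ √(n : ℝ) * (cauchyTransform (spectralMeasure (X n)) ρ -
      cauchyTransform μ ρ)) atTop (𝓝 0)) (x : ℝ) :
    Tendsto (fun n : ℕ ↦ √(n : ℝ) * (1 / α -
      (n : ℝ)⁻¹ * ∑ i, 1 / (shifted ρ x n - (hX n).eigenvalues i))) atTop
      (𝓝 (x * ∫ y, 1 / (ρ - y) ^ 2 ∂μ)) := by
  obtain ⟨c, hc, hgap⟩ := exists_gap_shifted hX hspec hρ x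
  have h1 := tendsto_sum_of_continuousOn hX hspec hρ (continuousOn_inv_sub_sq ρ)
  have h2 : Tendsto (fun n : ℕ ↦ x / √(n : ℝ) * ((n : ℝ)⁻¹ *
      ∑ i, 1 / ((ρ - (hX n).eigenvalues i) ^ 2 * (shifted ρ x n - (hX n).eigenvalues i))))
      atTop (𝓝 0) := by
    refine (tendsto_div_sqrt x).zero_mul_isBoundedUnder_le ?_
    refine isBoundedUnder_of_eventually_le (a := 1 / (c ^ 2 * c)) ?_
    filter_upwards [hgap] with n hn
    refine abs_mean_le (by positivity) fun i ↦ ?_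
    rw [abs_div, abs_one, abs_mul, abs_pow]
    obtain ⟨h3, h4, -⟩ := hn.2 i
    gcongr
  have h3 := (hfast.neg.add (h1.const_mul x)).sub (h2.const_mul x)
  rw [neg_zero, zero_add, mul_zero, sub_zero] at h3
  refine h3.congr' ?_
  filter_upwards [hgap] with n hn
  have hn0 : 0 < √(n : ℝ) := Real.sqrt_pos.2 (by exact_mod_cast hn.1)
  rw [cauchyTransform, integral_spectralMeasure (hX n), hG]
  have h4 : ∀ i, 1 / (shifted ρ x n - (hX n).eigenvalues i) = 1 / (ρ - (hX n).eigenvalues i) -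
      x / √(n : ℝ) * (1 / (ρ - (hX n).eigenvalues i) ^ 2) + (x / √(n : ℝ)) ^ 2 *
        (1 / ((ρ - (hX n).eigenvalues i) ^ 2 * (shifted ρ x n - (hX n).eigenvalues i))) := by
    intro i
    obtain ⟨h3, h4, -⟩ := hn.2 i
    have h5 : ρ - (hX n).eigenvalues i ≠ 0 := abs_pos.1 (hc.trans_le h3)
    have h6 : shifted ρ x n - (hX n).eigenvalues i ≠ 0 := abs_pos.1 (hc.trans_le h4)
    have h7 : x / √(n : ℝ) = (shifted ρ x n - (hX n).eigenvalues i) - (ρ - (hX n).eigenvalues i) := by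
      rw [shifted]; ring
    rw [h7]
    field_simp
    ring
  simp only [h4, Finset.sum_add_distrib, Finset.sum_sub_distrib, ← Finset.mul_sum]
  field_simp
  ring

lemma sum_norm_sq_smul_specFun {n : ℕ} {A : Matrix (Fin n) (Fin n) 𝕜} (hA : A.IsHermitian) (c : ℝ)
    (f : ℝ → ℝ) : ∑ i, ∑ j, ‖((c : 𝕜) • specFun hA f) i j‖ ^ 2 =
      n * c ^ 2 * ((n : ℝ)⁻¹ * ∑ i, f (hA.eigenvalues i) ^ 2) := by
  rw [sum_norm_sq_smul, sum_norm_sq_specFun]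
  rcases Nat.eq_zero_or_pos n with rfl | hn
  · simp
  · field_simp

-- The two resolvents differ by `O(1 / √n)` on the spectrum, so in the fluctuations `ρ + x / √n` may
-- be replaced by `ρ`.
include hspec hρ in
lemma tendsto_sum_norm_sq_resolvent_sub (x : ℝ) : Tendsto (fun n : ℕ ↦ ∑ i, ∑ j,
    ‖(((1 / √(n : ℝ) : ℝ) : 𝕜) • specFun (hX n) fun l ↦ 1 / (ρ - l) - 1 / (shifted ρ x n - l)) i j‖ ^ 2)
    atTop (𝓝 0) := by
  obtain ⟨c, hc, hgap⟩ := exists_gap_shifted hX hspec hρ x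
  have h1 : Tendsto (fun n : ℕ ↦ (x / √(n : ℝ)) ^ 2 * (1 / (c * c)) ^ 2) atTop (𝓝 0) := by
    simpa using ((tendsto_div_sqrt x).pow 2).mul_const ((1 / (c * c)) ^ 2)
  refine squeeze_zero' (.of_forall fun n ↦ by positivity) ?_ h1
  filter_upwards [hgap] with n hn
  have hn0 : (0 : ℝ) < n := by exact_mod_cast hn.1
  rw [sum_norm_sq_smul_specFun, div_pow, Real.sq_sqrt hn0.le, one_pow, mul_one_div_cancel hn0.ne',
    one_mul]
  refine (le_abs_self _).trans (abs_mean_le (by positivity) fun i ↦ ?_)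
  obtain ⟨h3, h4, -⟩ := hn.2 i
  have h5 : ρ - (hX n).eigenvalues i ≠ 0 := abs_pos.1 (hc.trans_le h3)
  have h6 : shifted ρ x n - (hX n).eigenvalues i ≠ 0 := abs_pos.1 (hc.trans_le h4)
  have h7 : 1 / (ρ - (hX n).eigenvalues i) - 1 / (shifted ρ x n - (hX n).eigenvalues i) =
      x / √(n : ℝ) * (1 / ((ρ - (hX n).eigenvalues i) * (shifted ρ x n - (hX n).eigenvalues i))) := by
    have h7 : x / √(n : ℝ) = (shifted ρ x n - (hX n).eigenvalues i) - (ρ - (hX n).eigenvalues i) := by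
      rw [shifted]; ring
    rw [h7]
    field_simp
  rw [h7, mul_pow, abs_mul, abs_of_nonneg (sq_nonneg (x / √(n : ℝ))), abs_pow, abs_div, abs_one,
    abs_mul]
  gcongr

lemma sqrt_sqrt_div_sq {n : ℕ} (hn : 0 < n) : (n : ℝ) * (√√(n : ℝ) / n) ^ 2 = 1 / √(n : ℝ) := by
  have hn0 : (0 : ℝ) < n := by exact_mod_cast hn
  rw [div_pow, Real.sq_sqrt (Real.sqrt_nonneg _)]
  have := Real.mul_self_sqrt hn0.le
  field_simp
  linarith

-- The factor `n^{1/4} / n` is the scale of the mixed entries, rescaled on one side only; their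
-- random part is negligible.
include hspec hρ in
lemma tendsto_sum_norm_sq_resolvent (x : ℝ) : Tendsto (fun n : ℕ ↦ ∑ i, ∑ j,
    ‖(((√√(n : ℝ) / n : ℝ) : 𝕜) • specFun (hX n) fun l ↦ 1 / (shifted ρ x n - l)) i j‖ ^ 2)
    atTop (𝓝 0) := by
  obtain ⟨c, hc, hgap⟩ := exists_gap_shifted hX hspec hρ x
  have h1 : Tendsto (fun n : ℕ ↦ 1 / √(n : ℝ) * (1 / c) ^ 2) atTop (𝓝 0) := by
    have := (tendsto_div_sqrt 1).mul_const ((1 / c) ^ 2)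
    rwa [zero_mul] at this
  refine squeeze_zero' (.of_forall fun n ↦ by positivity) ?_ h1
  filter_upwards [hgap] with n hn
  rw [sum_norm_sq_smul_specFun, sqrt_sqrt_div_sq hn.1]
  refine mul_le_mul_of_nonneg_left ?_ (by positivity)
  refine (le_abs_self _).trans (abs_mean_le (by positivity) fun i ↦ ?_)
  obtain ⟨-, h4, -⟩ := hn.2 i
  rw [abs_pow, abs_div, abs_one]
  gcongr

lemma tendsto_sum_norm_sq_one : Tendsto (fun n : ℕ ↦ ∑ i, ∑ j,
    ‖(((√√(n : ℝ) / n : ℝ) : 𝕜) • (1 : Matrix (Fin n) (Fin n) 𝕜)) i j‖ ^ 2) atTop (𝓝 0) := by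
  refine (tendsto_div_sqrt 1).congr' ?_
  filter_upwards [eventually_gt_atTop 0] with n hn
  rw [sum_norm_sq_smul, ← sqrt_sqrt_div_sq hn, mul_comm]
  congr 1
  simp [Matrix.one_apply, apply_ite]

/-- The matrix `(ρ - X)⁻¹ - β` entering the limit law. -/
def limitForm {n : ℕ} {A : Matrix (Fin n) (Fin n) 𝕜} (hA : A.IsHermitian) (ρ β : ℝ) :
    Matrix (Fin n) (Fin n) 𝕜 := specFun hA fun l ↦ 1 / (ρ - l) - β

include hspec hρ in
lemma exists_opBound_limitForm (β : ℝ) :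
    ∃ C, ∀ᶠ n in atTop, OpBound (limitForm (hX n) ρ β) C := by
  obtain ⟨c, hc, hgap⟩ := exists_gap_shifted hX hspec hρ 0
  refine ⟨1 / c + |β|, ?_⟩
  filter_upwards [hgap] with n hn
  refine ⟨by positivity, sum_norm_sq_specFun_mulVec_le _ fun i ↦ ?_⟩
  refine (abs_sub _ _).trans ?_
  obtain ⟨h3, -, -⟩ := hn.2 i
  rw [abs_div, abs_one]
  gcongr

include hspec hρ in
lemma tendsto_sum_norm_sq_limitForm (β : ℝ) : Tendsto (fun n : ℕ ↦ (n : ℝ)⁻¹ *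
    ∑ i, ∑ j, ‖limitForm (hX n) ρ β i j‖ ^ 2) atTop (𝓝 (∫ x, (1 / (ρ - x) - β) ^ 2 ∂μ)) := by
  simp only [limitForm, sum_norm_sq_specFun]
  exact tendsto_sum_of_continuousOn hX hspec hρ
    (f := fun x ↦ (1 / (ρ - x) - β) ^ 2) (((continuousOn_inv_sub ρ).sub continuousOn_const).pow 2)

end Resolvent

/-! ### Convergence to zero in probability. -/

section TendstoZero

variable {Ω : ℕ → Type*} [∀ n, MeasurableSpace (Ω n)] {P : (n : ℕ) → Measure (Ω n)}

/-- Convergence to zero in probability of nonnegative variables on varying spaces. -/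
def TendstoZero (P : (n : ℕ) → Measure (Ω n)) (Y : (n : ℕ) → Ω n → ℝ) : Prop :=
  ∀ ε > 0, Tendsto (fun n ↦ P n {ω | ε ≤ Y n ω}) atTop (𝓝 0)

lemma tendsto_measure_union {A B : (n : ℕ) → Set (Ω n)}
    (hA : Tendsto (fun n ↦ P n (A n)) atTop (𝓝 0)) (hB : Tendsto (fun n ↦ P n (B n)) atTop (𝓝 0)) :
    Tendsto (fun n ↦ P n (A n ∪ B n)) atTop (𝓝 0) := by
  have := hA.add hB
  rw [add_zero] at this
  exact tendsto_of_tendsto_of_tendsto_of_le_of_le tendsto_const_nhds this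
    (fun _ ↦ zero_le) fun n ↦ measure_union_le _ _

lemma tendsto_measure_mono {A B : (n : ℕ) → Set (Ω n)}
    (hB : Tendsto (fun n ↦ P n (B n)) atTop (𝓝 0)) (h : ∀ᶠ n in atTop, A n ⊆ B n) :
    Tendsto (fun n ↦ P n (A n)) atTop (𝓝 0) :=
  tendsto_of_tendsto_of_tendsto_of_le_of_le' tendsto_const_nhds hB
    (.of_forall fun _ ↦ zero_le) (h.mono fun _ hn ↦ measure_mono hn)

lemma TendstoZero.add {Y Z : (n : ℕ) → Ω n → ℝ} (hY : TendstoZero P Y) (hZ : TendstoZero P Z) :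
    TendstoZero P fun n ω ↦ Y n ω + Z n ω := fun ε hε ↦ by
  refine tendsto_measure_mono (tendsto_measure_union (hY (ε / 2) (half_pos hε))
    (hZ (ε / 2) (half_pos hε))) (.of_forall fun n ω hω ↦ ?_)
  by_contra h
  simp only [Set.mem_union, Set.mem_ofPred_eq, not_or, not_le] at h hω
  linarith [h.1, h.2]

lemma tendstoZero_of_tendsto {u : ℕ → ℝ} (hu : Tendsto u atTop (𝓝 0)) :
    TendstoZero P fun n _ ↦ u n := fun ε hε ↦ by
  refine tendsto_const_nhds.congr' ?_
  filter_upwards [hu.eventually_lt_const hε] with n hn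
  simp [hn.not_ge]

lemma TendstoZero.sum {ι : Type*} (s : Finset ι) {Y : ι → (n : ℕ) → Ω n → ℝ}
    (hY : ∀ i, TendstoZero P (Y i)) : TendstoZero P fun n ω ↦ ∑ i ∈ s, Y i n ω := by
  classical
  induction s using Finset.induction_on with
  | empty => simpa using tendstoZero_of_tendsto tendsto_const_nhds
  | insert i s hi ih =>
    simp only [Finset.sum_insert hi]
    exact (hY i).add ih

lemma TendstoZero.const_mul {Y : (n : ℕ) → Ω n → ℝ} (hY : TendstoZero P Y) {c : ℝ} (hc : 0 ≤ c) :
    TendstoZero P fun n ω ↦ c * Y n ω := fun ε hε ↦ by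
  refine tendsto_measure_mono (hY (ε / (c + 1)) (by positivity)) (.of_forall fun n ω hω ↦ ?_)
  simp only [Set.mem_ofPred_eq] at hω ⊢
  rw [div_le_iff₀ (by positivity)]
  nlinarith

lemma TendstoZero.sq {Y : (n : ℕ) → Ω n → ℝ} (hY : TendstoZero P Y) (h0 : ∀ n ω, 0 ≤ Y n ω) :
    TendstoZero P fun n ω ↦ Y n ω ^ 2 := fun ε hε ↦ by
  refine tendsto_measure_mono (hY (√ε) (Real.sqrt_pos.2 hε)) (.of_forall fun n ω hω ↦ ?_)
  simp only [Set.mem_ofPred_eq] at hω ⊢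
  exact (Real.sqrt_le_left (h0 n ω)).2 hω

/-- Comparison of two sequences through their level sets. -/
lemma tendstoZero_abs_sub_of_levels {γ Λ : (n : ℕ) → Ω n → ℝ}
    (hlev : ∀ x δ : ℝ, 0 < δ → Tendsto (fun n ↦ P n {ω | (γ n ω < x ∧ x + δ ≤ Λ n ω) ∨
      (x ≤ γ n ω ∧ Λ n ω < x - δ)}) atTop (𝓝 0))
    (htight : ∀ η : ENNReal, 0 < η → ∃ K, ∀ᶠ n in atTop, P n {ω | K ≤ |Λ n ω|} ≤ η) :
    TendstoZero P fun n ω ↦ |γ n ω - Λ n ω| := by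
  intro ε hε
  set δ := ε / 3 with hδ
  have hδ0 : 0 < δ := by positivity
  rw [ENNReal.tendsto_nhds_zero]
  intro η hη
  have hη2 : 0 < η / 2 := ENNReal.half_pos hη.ne'
  obtain ⟨K, hK⟩ := htight (η / 2) hη2
  -- When `|Λ|` is below `K`, finitely many multiples of `δ = ε / 3` suffice to separate two values
  -- at distance `ε`, with a margin `δ` to spare. With `m` the index of the cell of `Λ`, the
  -- separating levels are `m + 2` and `m - 1`; the added `3` keeps them on the grid.
  set N : ℤ := ⌈K / δ⌉ + 3 with hN
  let A : ℤ → (n : ℕ) → Set (Ω n) := fun m n ↦ {ω | (γ n ω < δ * m ∧ δ * m + δ ≤ Λ n ω) ∨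
      (δ * m ≤ γ n ω ∧ Λ n ω < δ * m - δ)}
  have h1 : Tendsto (fun n ↦ ∑ m ∈ Finset.Icc (-N) N, P n (A m n)) atTop (𝓝 0) := by
    have := tendsto_finsetSum (Finset.Icc (-N) N) fun m _ ↦ hlev (δ * m) δ hδ0
    simpa only [Finset.sum_const_zero] using this
  filter_upwards [hK, (ENNReal.tendsto_nhds_zero.1 h1) (η / 2) hη2] with n hn1 hn2
  have hsub : {ω | ε ≤ |γ n ω - Λ n ω|} ⊆
      {ω | K ≤ |Λ n ω|} ∪ ⋃ m ∈ Finset.Icc (-N) N, A m n := by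
    intro ω hω
    by_contra h
    simp only [Set.mem_union, Set.mem_ofPred_eq, Set.mem_iUnion, not_or, not_le, not_exists] at h hω
    obtain ⟨hK1, h2⟩ := h
    have h3 := Int.floor_le (Λ n ω / δ)
    have h4 := Int.lt_floor_add_one (Λ n ω / δ)
    rw [le_div_iff₀ hδ0] at h3
    rw [div_lt_iff₀ hδ0] at h4
    have h5 := Int.le_ceil (K / δ)
    rw [div_le_iff₀ hδ0] at h5
    set m := ⌊Λ n ω / δ⌋ with hm
    have h6 := abs_lt.1 hK1
    have h7 : m < ⌈K / δ⌉ + 1 := by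
      have : (m : ℝ) < ⌈K / δ⌉ + 1 := by
        refine lt_of_mul_lt_mul_right ?_ hδ0.le
        linarith [h6.2]
      exact_mod_cast this
    have h8 : -⌈K / δ⌉ - 1 ≤ m := by
      have : (-⌈K / δ⌉ - 1 : ℝ) < m := by
        refine lt_of_mul_lt_mul_right ?_ hδ0.le
        linarith [h6.1]
      exact_mod_cast this.le
    rcases le_abs.1 hω with h | h
    · refine h2 (m + 2) (Finset.mem_Icc.2 ⟨by omega, by omega⟩) (Or.inr ⟨?_, ?_⟩)
      · push_cast; linarith
      · push_cast; linarith
    · refine h2 (m - 1) (Finset.mem_Icc.2 ⟨by omega, by omega⟩) (Or.inl ⟨?_, ?_⟩)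
      · push_cast; linarith
      · push_cast; linarith
  calc P n {ω | ε ≤ |γ n ω - Λ n ω|} ≤ P n {ω | K ≤ |Λ n ω|} + ∑ m ∈ Finset.Icc (-N) N, P n (A m n) :=
        (measure_mono hsub).trans ((measure_union_le _ _).trans
          (add_le_add le_rfl (measure_biUnion_finset_le _ _)))
    _ ≤ η / 2 + η / 2 := add_le_add hn1 hn2
    _ = η := ENNReal.add_halves η

end TendstoZero

/-! ### Chebyshev bounds for the sesquilinear forms. -/

section Bil

variable {𝕜 : Type*} [RCLike 𝕜] {ν : Measure 𝕜} [IsProbabilityMeasure ν] {κ : ℝ}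
  {K : Type*} [Fintype K] [DecidableEq K]

lemma GaussianMoments.measure_bil_le (h : GaussianMoments ν κ) {ι Ω : Type*} [Fintype ι]
    [DecidableEq ι] [MeasurableSpace Ω] {P : Measure Ω} [IsProbabilityMeasure P] {G : Ω → K × ι → 𝕜}
    (hG : AEMeasurable G P) (hGP : P.map G = Measure.pi fun _ ↦ ν) {A : Matrix ι ι 𝕜}
    (hA : A.IsHermitian) (s t : K) {ε : ℝ} (hε : 0 < ε) :
    P {ω | ε ≤ ‖bil A s t (G ω)‖} ≤
      ENNReal.ofReal (8 * κ * (∑ i, ∑ j, ‖A i j‖ ^ 2) / ε ^ 2) := by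
  set Q : Measure (K × ι → 𝕜) := Measure.pi fun _ ↦ ν with hQ
  have hm : MeasurableSet {x : K × ι → 𝕜 | ε ≤ ‖bil A s t x‖} :=
    measurableSet_le measurable_const (measurable_bil A s t).norm
  have h1 : P {ω | ε ≤ ‖bil A s t (G ω)‖} = Q {x | ε ≤ ‖bil A s t x‖} := by
    rw [← hGP, Measure.map_apply_of_aemeasurable hG hm]
    rfl
  obtain ⟨hi, hb⟩ := h.integral_norm_sq_bil_le hA s t
  have h2 := mul_meas_ge_le_integral_of_nonneg (ae_of_all _ fun x ↦ sq_nonneg ‖bil A s t x‖) hi (ε ^ 2)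
  have h3 : {x : K × ι → 𝕜 | ε ^ 2 ≤ ‖bil A s t x‖ ^ 2} = {x | ε ≤ ‖bil A s t x‖} := by
    ext x
    exact pow_le_pow_iff_left₀ hε.le (norm_nonneg _) two_ne_zero
  rw [h3] at h2
  rw [h1, ← ofReal_measureReal]
  refine ENNReal.ofReal_le_ofReal ?_
  rw [le_div_iff₀ (by positivity), mul_comm]
  exact h2.trans hb

variable {Ω : ℕ → Type*} [∀ n, MeasurableSpace (Ω n)] {P : (n : ℕ) → Measure (Ω n)}
  [∀ n, IsProbabilityMeasure (P n)]

lemma GaussianMoments.tendstoZero_bil (h : GaussianMoments ν κ) {G : (n : ℕ) → Ω n → K × Fin n → 𝕜}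
    (hG : ∀ n, AEMeasurable (G n) (P n)) (hGP : ∀ n, (P n).map (G n) = Measure.pi fun _ ↦ ν)
    {A : (n : ℕ) → Matrix (Fin n) (Fin n) 𝕜} (hA : ∀ n, (A n).IsHermitian)
    (hA0 : Tendsto (fun n ↦ ∑ i, ∑ j, ‖A n i j‖ ^ 2) atTop (𝓝 0)) (s t : K) :
    TendstoZero P fun n ω ↦ ‖bil (A n) s t (G n ω)‖ := fun ε hε ↦ by
  have h1 : Tendsto (fun n ↦ ENNReal.ofReal (8 * κ * (∑ i, ∑ j, ‖A n i j‖ ^ 2) / ε ^ 2)) atTop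
      (𝓝 0) := by
    have := ENNReal.tendsto_ofReal ((hA0.const_mul (8 * κ)).div_const (ε ^ 2))
    simpa using this
  exact tendsto_of_tendsto_of_tendsto_of_le_of_le tendsto_const_nhds h1 (fun _ ↦ zero_le)
    fun n ↦ h.measure_bil_le (hG n) (hGP n) (hA n) s t hε

end Bil

/-! ### Entrywise limit of the rescaled `r × r` matrix. -/

section Entries

open Matrix

variable {𝕜 : Type*} [RCLike 𝕜] {n r : ℕ}

/-- The error made on an entry of the rescaled matrix when it is replaced by its limit. -/
def entryError {X : Matrix (Fin n) (Fin n) 𝕜} (hX : X.IsHermitian) (ρ α s x C : ℝ)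
    (G : Fin r × Fin n → 𝕜) (a b : Fin r) : ℝ :=
  |√(n : ℝ) * (1 / α - (n : ℝ)⁻¹ * ∑ i, 1 / (shifted ρ x n - hX.eigenvalues i)) - x * s| +
  |1 / α - (n : ℝ)⁻¹ * ∑ i, 1 / (shifted ρ x n - hX.eigenvalues i)| +
  C * ((∑ a, ∑ b, ‖bil (((√√(n : ℝ) / n : ℝ) : 𝕜) • (1 : Matrix (Fin n) (Fin n) 𝕜)) a b G‖) ^ 2 +
    ∑ a, ∑ b, ‖bil (((√√(n : ℝ) / n : ℝ) : 𝕜) • (1 : Matrix (Fin n) (Fin n) 𝕜)) a b G‖) +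
  ‖bil (((1 / √(n : ℝ) : ℝ) : 𝕜) • specFun hX fun l ↦ 1 / (ρ - l) - 1 / (shifted ρ x n - l)) a b G‖ +
  ‖bil (((√√(n : ℝ) / n : ℝ) : 𝕜) • specFun hX fun l ↦ 1 / (shifted ρ x n - l)) a b G‖

lemma sqrt_sqrt_mul_entrySum_gramError (hn : 0 < n) (g : Fin r → Fin n → 𝕜) :
    √√(n : ℝ) * entrySum (gramError (rescaledVectors g)) = ∑ a, ∑ b,
      ‖bil (((√√(n : ℝ) / n : ℝ) : 𝕜) • (1 : Matrix (Fin n) (Fin n) 𝕜)) a b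
        (fun p ↦ g p.1 p.2)‖ := by
  simp only [entrySum, gramError_apply hn, bil_smul, norm_mul, RCLike.norm_ofReal, Finset.mul_sum,
    abs_div, abs_of_nonneg (Real.sqrt_nonneg √(n : ℝ)), abs_one, Nat.abs_cast]
  refine Finset.sum_congr rfl fun a _ ↦ Finset.sum_congr rfl fun b _ ↦ ?_
  ring

/-- Entrywise comparison of the rescaled matrix with its block diagonal limit. -/
lemma norm_rescaled_sub_le {X : Matrix (Fin n) (Fin n) 𝕜} (hX : X.IsHermitian) (hn : 0 < n)
    {k : ℕ} {θ : Fin r → ℝ} {α ρ s x C ι : ℝ} (hC : 0 ≤ C)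
    (e : Fin k ⊕ {a // θ a ≠ α} ≃ Fin r) (he : ∀ i, θ (e (.inl i)) = α) (he' : ∀ a, e (.inr a) = a)
    (g : Fin r → Fin n → 𝕜) {F : Matrix (Fin r) (Fin r) 𝕜}
    (hF1 : entrySum F ≤ C * entrySum (gramError (rescaledVectors g)))
    (hF2 : ∀ a b, θ a = θ b → ‖F a b - ((ι / θ a : ℝ) : 𝕜) * gramError (rescaledVectors g) a b‖ ≤
      C * entrySum (gramError (rescaledVectors g)) ^ 2) (p q : Fin k ⊕ {a // θ a ≠ α}) :
    ‖((diagonal (Sum.elim (fun _ ↦ ((√√(n : ℝ) : ℝ) : 𝕜)) fun _ ↦ 1)) *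
      (diagonal (fun a ↦ ((1 / θ a : ℝ) : 𝕜)) + F - (columns (rescaledVectors g))ᴴ *
        specFun hX (fun l ↦ 1 / (shifted ρ x n - l)) * columns (rescaledVectors g)).submatrix e e *
      (diagonal (Sum.elim (fun _ ↦ ((√√(n : ℝ) : ℝ) : 𝕜)) fun _ ↦ 1)) -
      fromBlocks (((x * s : ℝ) : 𝕜) • 1 - of fun i j ↦ bil (((1 / √(n : ℝ) : ℝ) : 𝕜) •
        limitForm hX ρ (ι / α)) (e (.inl i)) (e (.inl j)) fun p ↦ g p.1 p.2) 0 0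
        (diagonal fun a : {a // θ a ≠ α} ↦ ((1 / θ a - 1 / α : ℝ) : 𝕜)) :
        Matrix (Fin k ⊕ {a // θ a ≠ α}) (Fin k ⊕ {a // θ a ≠ α}) 𝕜) p q‖ ≤
      entryError hX ρ α s x C (fun p ↦ g p.1 p.2) (e p) (e q) := by
  set E := gramError (rescaledVectors g) with hE
  set G : Fin r × Fin n → 𝕜 := fun p ↦ g p.1 p.2 with hG
  -- `t = n^{1/4}` acts on each side, so the `α` block is multiplied by `√n`, the mixed blocks by
  -- `t`, and the rest is left alone.
  set t := √√(n : ℝ) with ht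
  have hn0 : (0 : ℝ) < n := by exact_mod_cast hn
  have ht1 : 1 ≤ t := by
    rw [ht, Real.one_le_sqrt, Real.one_le_sqrt]
    exact_mod_cast hn
  have htt : t * t = √(n : ℝ) := Real.mul_self_sqrt (Real.sqrt_nonneg _)
  have htn : t * t * (1 / (n : ℝ)) = 1 / √(n : ℝ) := by
    rw [htt]
    have := Real.mul_self_sqrt hn0.le
    have h0 : √(n : ℝ) ≠ 0 := (Real.sqrt_pos.2 hn0).ne'
    field_simp
    linarith
  set Q := specFun hX (fun l ↦ 1 / (shifted ρ x n - l)) with hQ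
  set m : ℝ := (n : ℝ)⁻¹ * ∑ i, 1 / (shifted ρ x n - hX.eigenvalues i) with hm
  have hE0 : 0 ≤ entrySum E := entrySum_nonneg E
  have hCE : 0 ≤ C * entrySum E := by positivity
  have hF (a b : Fin r) : ‖F a b‖ ≤ C * entrySum E := (norm_le_entrySum F a b).trans hF1
  have htE := sqrt_sqrt_mul_entrySum_gramError hn g
  rw [← hE, ← ht, ← hG] at htE
  -- The forms are split into their centred parts and the normalised trace `m` of the resolvent.
  have hH (a b : Fin r) : (diagonal (fun a ↦ ((1 / θ a : ℝ) : 𝕜)) + F -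
      (columns (rescaledVectors g))ᴴ * Q * columns (rescaledVectors g)) a b =
      (if a = b then ((1 / θ a - m : ℝ) : 𝕜) else 0) + F a b -
        ((1 / (n : ℝ) : ℝ) : 𝕜) * bil Q a b G := by
    rw [Matrix.sub_apply, Matrix.add_apply, columns_conjTranspose_mul_mul_apply, bil_smul,
      trace_specFun, ← RCLike.ofReal_mul, one_div (n : ℝ), ← hm, diagonal_apply]
    split_ifs
    · rw [RCLike.ofReal_sub]
      ring
    · ring
  have hEa (a b : Fin r) : E a b = ((1 / (n : ℝ) : ℝ) : 𝕜) * bil 1 a b G := by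
    rw [hE, gramError_apply hn, bil_smul]
  set S1 := ‖bil (((1 / √(n : ℝ) : ℝ) : 𝕜) • specFun hX fun l ↦
    1 / (ρ - l) - 1 / (shifted ρ x n - l)) (e p) (e q) G‖ with hS1
  set S2 := ‖bil (((t / n : ℝ) : 𝕜) • Q) (e p) (e q) G‖ with hS2
  have hS1' : 0 ≤ S1 := norm_nonneg _
  have hS2' : t * ‖((1 / (n : ℝ) : ℝ) : 𝕜) * bil Q (e p) (e q) G‖ = S2 := by
    rw [hS2, bil_smul, norm_mul, norm_mul, RCLike.norm_ofReal, RCLike.norm_ofReal, abs_div, abs_div,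
      abs_one, abs_of_nonneg (zero_le_one.trans ht1)]
    ring
  have hS20 : 0 ≤ S2 := norm_nonneg _
  rw [entryError, ← htE, ← hm, ← hQ, ← ht, ← hS1, ← hS2]
  have hD1 := abs_nonneg (√(n : ℝ) * (1 / α - m) - x * s)
  have hD2 := abs_nonneg (1 / α - m)
  have hCt : 0 ≤ C * (t * entrySum E) := by positivity
  have hCt2 : 0 ≤ C * (t * entrySum E) ^ 2 := by positivity
  -- Common bound outside the `α` block, where at most one factor `t` occurs; the first-order size
  -- of `F` is enough there.
  have hoff {y : 𝕜} (hy : ‖y‖ ≤ t * ‖F (e p) (e q) -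
      ((1 / (n : ℝ) : ℝ) : 𝕜) * bil Q (e p) (e q) G‖) : ‖y‖ ≤ C * (t * entrySum E) + S2 := by
    refine hy.trans ?_
    have h1 := mul_le_mul_of_nonneg_left (norm_sub_le (F (e p) (e q))
      (((1 / (n : ℝ) : ℝ) : 𝕜) * bil Q (e p) (e q) G)) (zero_le_one.trans ht1)
    have h2 := mul_le_mul_of_nonneg_left (hF (e p) (e q)) (zero_le_one.trans ht1)
    rw [mul_add, hS2'] at h1
    linarith [mul_left_comm t C (entrySum E)]
  have hnt : ‖((t : ℝ) : 𝕜)‖ = t := by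
    rw [RCLike.norm_ofReal, abs_of_nonneg (zero_le_one.trans ht1)]
  rw [Matrix.sub_apply, mul_diagonal, diagonal_mul, submatrix_apply, hH]
  rcases p with i | a <;> rcases q with j | b
  · simp only [Sum.elim_inl, fromBlocks_apply₁₁, Matrix.sub_apply, of_apply, Matrix.smul_apply,
      one_apply, smul_eq_mul, e.injective.eq_iff, Sum.inl.injEq, he]
    have hF3 := hF2 (e (.inl i)) (e (.inl j)) (by rw [he, he])
    rw [he, hEa] at hF3
    have hbil : bil (((1 / √(n : ℝ) : ℝ) : 𝕜) • limitForm hX ρ (ι / α)) (e (.inl i)) (e (.inl j)) G =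
        ((t * t * (1 / (n : ℝ)) : ℝ) : 𝕜) * (bil (specFun hX fun l ↦ 1 / (ρ - l)) (e (.inl i))
          (e (.inl j)) G - ((ι / α : ℝ) : 𝕜) * bil 1 (e (.inl i)) (e (.inl j)) G) := by
      rw [htn, bil_smul, limitForm, specFun_sub, specFun_const, bil_sub, bil_smul]
    have hS : bil (((1 / √(n : ℝ) : ℝ) : 𝕜) • specFun hX fun l ↦
        1 / (ρ - l) - 1 / (shifted ρ x n - l)) (e (.inl i)) (e (.inl j)) G =
        ((t * t * (1 / (n : ℝ)) : ℝ) : 𝕜) * (bil (specFun hX fun l ↦ 1 / (ρ - l)) (e (.inl i))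
          (e (.inl j)) G - bil Q (e (.inl i)) (e (.inl j)) G) := by
      rw [htn, bil_smul, specFun_sub, bil_sub]
    -- Inside the `α` block `F` is `ι / α` times the Gram error, that is, the centred form of a
    -- multiple of the identity; it merges with the resolvent to give `limitForm` with `β = ι / α`.
    have key : (t : 𝕜) * ((if i = j then ((1 / α - m : ℝ) : 𝕜) else 0) + F (e (.inl i)) (e (.inl j)) -
        ((1 / (n : ℝ) : ℝ) : 𝕜) * bil Q (e (.inl i)) (e (.inl j)) G) * (t : 𝕜) -
        (((x * s : ℝ) : 𝕜) * (if i = j then 1 else 0) - bil (((1 / √(n : ℝ) : ℝ) : 𝕜) •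
          limitForm hX ρ (ι / α)) (e (.inl i)) (e (.inl j)) G) =
        (if i = j then ((√(n : ℝ) * (1 / α - m) - x * s : ℝ) : 𝕜) else 0) +
        (((t * t : ℝ) : 𝕜) * (F (e (.inl i)) (e (.inl j)) - ((ι / α : ℝ) : 𝕜) *
          (((1 / (n : ℝ) : ℝ) : 𝕜) * bil 1 (e (.inl i)) (e (.inl j)) G)) +
        bil (((1 / √(n : ℝ) : ℝ) : 𝕜) • specFun hX fun l ↦
          1 / (ρ - l) - 1 / (shifted ρ x n - l)) (e (.inl i)) (e (.inl j)) G) := by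
      rw [hbil, hS, ← htt]
      split_ifs
      · simp only [RCLike.ofReal_sub, RCLike.ofReal_mul]
        ring
      · simp only [RCLike.ofReal_mul]
        ring
    rw [key]
    refine (norm_add_le _ _).trans ?_
    have h1 : ‖(if i = j then ((√(n : ℝ) * (1 / α - m) - x * s : ℝ) : 𝕜) else 0)‖ ≤
        |√(n : ℝ) * (1 / α - m) - x * s| := by
      split_ifs
      · rw [RCLike.norm_ofReal]
      · rw [norm_zero]; exact hD1
    have h2 := norm_add_le (((t * t : ℝ) : 𝕜) * (F (e (.inl i)) (e (.inl j)) - ((ι / α : ℝ) : 𝕜) *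
          (((1 / (n : ℝ) : ℝ) : 𝕜) * bil 1 (e (.inl i)) (e (.inl j)) G)))
        (bil (((1 / √(n : ℝ) : ℝ) : 𝕜) • specFun hX fun l ↦
          1 / (ρ - l) - 1 / (shifted ρ x n - l)) (e (.inl i)) (e (.inl j)) G)
    rw [norm_mul, RCLike.norm_ofReal, abs_of_nonneg (mul_self_nonneg t), ← hS1] at h2
    have h3 := mul_le_mul_of_nonneg_left hF3 (mul_self_nonneg t)
    have h4 : t * t * (C * entrySum E ^ 2) = C * (t * entrySum E) ^ 2 := by ring
    linarith
  · simp only [Sum.elim_inl, Sum.elim_inr, fromBlocks_apply₁₂, Matrix.zero_apply,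
      e.injective.eq_iff, reduceCtorEq, if_false, zero_add, mul_one, sub_zero]
    have := hoff (y := (t : 𝕜) * (F (e (.inl i)) (e (.inr b)) - ((1 / (n : ℝ) : ℝ) : 𝕜) *
      bil Q (e (.inl i)) (e (.inr b)) G)) (by rw [norm_mul, hnt])
    linarith
  · simp only [Sum.elim_inl, Sum.elim_inr, fromBlocks_apply₂₁, Matrix.zero_apply,
      e.injective.eq_iff, reduceCtorEq, if_false, zero_add, one_mul, sub_zero]
    have := hoff (y := (F (e (.inr a)) (e (.inl j)) - ((1 / (n : ℝ) : ℝ) : 𝕜) *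
      bil Q (e (.inr a)) (e (.inl j)) G) * (t : 𝕜)) (by rw [norm_mul, hnt, mul_comm])
    linarith
  · simp only [Sum.elim_inr, fromBlocks_apply₂₂, e.injective.eq_iff, Sum.inr.injEq, one_mul,
      mul_one, diagonal_apply]
    have h1 := hoff (y := F (e (.inr a)) (e (.inr b)) - ((1 / (n : ℝ) : ℝ) : 𝕜) *
      bil Q (e (.inr a)) (e (.inr b)) G) (le_mul_of_one_le_left (norm_nonneg _) ht1)
    have key : (if a = b then ((1 / θ (e (.inr a)) - m : ℝ) : 𝕜) else 0) +
        F (e (.inr a)) (e (.inr b)) - ((1 / (n : ℝ) : ℝ) : 𝕜) * bil Q (e (.inr a)) (e (.inr b)) G -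
        (if a = b then ((1 / θ a - 1 / α : ℝ) : 𝕜) else 0) =
        (if a = b then ((1 / α - m : ℝ) : 𝕜) else 0) + (F (e (.inr a)) (e (.inr b)) -
          ((1 / (n : ℝ) : ℝ) : 𝕜) * bil Q (e (.inr a)) (e (.inr b)) G) := by
      rw [he' a]
      split_ifs
      · simp only [RCLike.ofReal_sub]
        ring
      · ring
    rw [key]
    have h2 : ‖(if a = b then ((1 / α - m : ℝ) : 𝕜) else 0)‖ ≤ |1 / α - m| := by
      split_ifs
      · rw [RCLike.norm_ofReal]
      · rw [norm_zero]; exact hD2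
    have h3 := norm_add_le (if a = b then ((1 / α - m : ℝ) : 𝕜) else 0) (F (e (.inr a)) (e (.inr b)) -
          ((1 / (n : ℝ) : ℝ) : 𝕜) * bil Q (e (.inr a)) (e (.inr b)) G)
    linarith

end Entries

/-! ### Comparison of outliers and fluctuation matrices at one level. -/

section Levels

open Matrix

variable {𝕜 : Type*} [RCLike 𝕜] {μ : Measure ℝ} [IsProbabilityMeasure μ]
  {X : (n : ℕ) → Matrix (Fin n) (Fin n) 𝕜} (hX : ∀ n, (X n).IsHermitian)
  (hspec : SpectralConvergence X μ)

section EntryError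

variable {ν : Measure 𝕜} [IsProbabilityMeasure ν] {κ : ℝ} {r : ℕ}
  {Ω : ℕ → Type*} [∀ n, MeasurableSpace (Ω n)] {P : (n : ℕ) → Measure (Ω n)}
  [∀ n, IsProbabilityMeasure (P n)]

include hspec in
lemma GaussianMoments.tendstoZero_entryError (h : GaussianMoments ν κ)
    {G : (n : ℕ) → Ω n → Fin r × Fin n → 𝕜} (hG : ∀ n, AEMeasurable (G n) (P n))
    (hGP : ∀ n, (P n).map (G n) = Measure.pi fun _ ↦ ν) {ρ α : ℝ}
    (hρ : ρ < lowerEdge μ ∨ upperEdge μ < ρ) (hGα : cauchyTransform μ ρ = 1 / α)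
    (hfast : Tendsto (fun n : ℕ ↦ √(n : ℝ) * (cauchyTransform (spectralMeasure (X n)) ρ -
      cauchyTransform μ ρ)) atTop (𝓝 0)) {C : ℝ} (hC : 0 ≤ C) (x : ℝ) (a b : Fin r) :
    TendstoZero P fun n ω ↦ entryError (hX n) ρ α (∫ y, 1 / (ρ - y) ^ 2 ∂μ) x C (G n ω) a b := by
  have h1 := tendsto_resolvent hX hspec hρ hGα hfast x
  have hE := TendstoZero.sum Finset.univ fun a : Fin r ↦ TendstoZero.sum Finset.univ fun b : Fin r ↦
    h.tendstoZero_bil hG hGP (fun n ↦ isHermitian_smul Matrix.isHermitian_one _)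
      tendsto_sum_norm_sq_one a b
  refine ((((?_ : TendstoZero P _).add ?_).add ?_).add ?_).add ?_
  · refine tendstoZero_of_tendsto ?_
    have := (h1.sub_const (x * ∫ y, 1 / (ρ - y) ^ 2 ∂μ)).abs
    rwa [sub_self, abs_zero] at this
  · refine tendstoZero_of_tendsto ?_
    have h2 := ((tendsto_div_sqrt 1).mul h1).abs
    rw [zero_mul, abs_zero] at h2
    refine h2.congr' ?_
    filter_upwards [eventually_gt_atTop 0] with n hn
    have : 0 < √(n : ℝ) := Real.sqrt_pos.2 (by exact_mod_cast hn)
    rw [← mul_assoc, one_div_mul_cancel this.ne', one_mul]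
  · exact ((hE.sq fun n ω ↦ by positivity).add hE).const_mul hC
  · exact h.tendstoZero_bil hG hGP (fun n ↦ isHermitian_smul (specFun_isHermitian _ _) _)
      (tendsto_sum_norm_sq_resolvent_sub hX hspec hρ x) a b
  · exact h.tendstoZero_bil hG hGP (fun n ↦ isHermitian_smul (specFun_isHermitian _ _) _)
      (tendsto_sum_norm_sq_resolvent hX hspec hρ x) a b

end EntryError

variable {r : ℕ} {θ : Fin r → ℝ}

section Outlier

variable (μ θ)

/-- An enumeration of the indices with `θ a = α_j`, completed by the other indices. -/
def blockEquiv (j : Fin (numValues μ θ)) :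
    Fin (mult μ θ j) ⊕ {a // θ a ≠ alpha μ θ j} ≃ Fin r := by
  classical
  exact ((Fintype.equivOfCardEq (by rw [Fintype.card_fin, mult, Fintype.card_subtype]) :
    Fin (mult μ θ j) ≃ {a // θ a = alpha μ θ j}).sumCongr (Equiv.refl _)).trans
      (Equiv.sumCompl fun a ↦ θ a = alpha μ θ j)

/-- The index of the `a`-th copy of `α_j`. -/
def blockIndex (p : Σ j, Fin (mult μ θ j)) : Fin r := blockEquiv μ θ p.1 (.inl p.2)

omit [IsProbabilityMeasure μ]

variable {μ θ}

lemma theta_blockIndex (p : Σ j, Fin (mult μ θ j)) : θ (blockIndex μ θ p) = alpha μ θ p.1 := by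
  simp only [blockIndex, blockEquiv, Equiv.trans_apply, Equiv.sumCongr_apply, Sum.map_inl,
    Equiv.sumCompl_apply_inl]
  exact ((Fintype.equivOfCardEq _ : Fin (mult μ θ p.1) ≃ {a // θ a = alpha μ θ p.1}) p.2).prop

lemma blockEquiv_inr (j : Fin (numValues μ θ)) (a : {a // θ a ≠ alpha μ θ j}) :
    blockEquiv μ θ j (.inr a) = a := rfl

/-- Injectivity ensures that the vectors of all groups together form a subfamily of the i.i.d.
entries. -/
lemma blockIndex_injective : Function.Injective (blockIndex μ θ) := by
  rintro ⟨j, a⟩ ⟨j', a'⟩ h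
  have h1 := theta_blockIndex (μ := μ) (θ := θ) ⟨j, a⟩
  rw [h, theta_blockIndex (μ := μ) (θ := θ) ⟨j', a'⟩] at h1
  obtain rfl : j' = j := ((outlierValues μ θ).orderEmbOfFin rfl).injective h1
  have h2 := (blockEquiv μ θ j').injective h
  exact congrArg (Sigma.mk j') (Sum.inl.inj h2)

end Outlier

lemma rho_alpha_spec (hc : IsCompact μ.support) (j : Fin (numValues μ θ)) :
    (rho μ (alpha μ θ j) < lowerEdge μ ∨ upperEdge μ < rho μ (alpha μ θ j)) ∧
    cauchyTransform μ (rho μ (alpha μ θ j)) = 1 / alpha μ θ j ∧ alpha μ θ j ≠ 0 ∧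
    (upperEdge μ < rho μ (alpha μ θ j) ↔ ¬ alpha μ θ j < 0) := by
  have hab := lowerEdge_le_upperEdge hc
  have hl := (lowerThreshold_spec hc).1
  have hu := (upperThreshold_spec hc).1
  rcases alpha_lt_or_lt hc j with h | h
  · obtain ⟨h1, h2⟩ := rho_of_lt_lower hc h
    have h3 : alpha μ θ j < 0 := h.trans_le hl
    exact ⟨Or.inl h1, h2, h3.ne, ⟨fun h' ↦ by linarith, fun h' ↦ absurd h3 h'⟩⟩
  · obtain ⟨h1, h2⟩ := rho_of_upper_lt hc h
    have h3 : 0 < alpha μ θ j := hu.trans_lt h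
    exact ⟨Or.inr h1, h2, h3.ne', ⟨fun _ ↦ h3.not_gt, fun _ ↦ h1⟩⟩

variable (θ) in
/-- The centred quadratic forms that govern the fluctuations of the `j`-th group of outliers. -/
def fluctuationMatrix (model : Model) (j : Fin (numValues μ θ)) (n : ℕ) (g : Fin r → Fin n → 𝕜) :
    Matrix (Fin (mult μ θ j)) (Fin (mult μ θ j)) 𝕜 :=
  of fun a b ↦ bil (((1 / √(n : ℝ) : ℝ) : 𝕜) • limitForm (hX n) (rho μ (alpha μ θ j))
    (model.indicator / alpha μ θ j)) (blockIndex μ θ ⟨j, a⟩) (blockIndex μ θ ⟨j, b⟩)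
      fun p ↦ g p.1 p.2

omit [IsProbabilityMeasure μ] in
lemma fluctuationMatrix_isHermitian (model : Model) (j : Fin (numValues μ θ)) (n : ℕ)
    (g : Fin r → Fin n → 𝕜) : (fluctuationMatrix hX θ model j n g).IsHermitian := by
  ext a b
  exact star_bil (isHermitian_smul (specFun_isHermitian (hX n) _) _) (blockIndex μ θ ⟨j, b⟩)
    (blockIndex μ θ ⟨j, a⟩) fun p ↦ g p.1 p.2

open Classical in
lemma card_filter_subtype_ne (α : ℝ) :
    (Finset.univ.filter fun a : {a // θ a ≠ α} ↦ 0 < 1 / θ a - 1 / α).card =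
      (Finset.univ.filter fun a ↦ 1 / α < 1 / θ a).card := by
  refine Finset.card_bij (fun a _ ↦ a.1) (fun a ha ↦ ?_) (fun a _ b _ hab ↦ Subtype.ext hab)
    fun a ha ↦ ?_
  · simpa using ha
  · have h1 : 1 / α < 1 / θ a := by simpa using ha
    exact ⟨⟨a, fun h ↦ by rw [h] at h1; exact lt_irrefl _ h1⟩, by simpa using ha, rfl⟩

include hspec in
open Classical in
/-- Comparison of the rescaled outliers with the eigenvalues of the fluctuation matrix. -/
lemma rescaledOutlier_lt_bounds (hθ : Monotone θ) (hθ0 : ∀ a, θ a ≠ 0) (j : Fin (numValues μ θ))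
    (x : ℝ) : ∃ C ε₀, 0 ≤ C ∧ 0 < ε₀ ∧ ∀ᶠ n in atTop, ∀ (model : Model) (g : Fin r → Fin n → 𝕜)
      (ε : ℝ), ε ≤ ε₀ →
      ∑ a, ∑ b, ‖bil (((√√(n : ℝ) / n : ℝ) : 𝕜) • (1 : Matrix (Fin n) (Fin n) 𝕜)) a b
        (fun p ↦ g p.1 p.2)‖ + ∑ a, ∑ b, entryError (hX n) (rho μ (alpha μ θ j)) (alpha μ θ j)
          (∫ y, 1 / (rho μ (alpha μ θ j) - y) ^ 2 ∂μ) x C (fun p ↦ g p.1 p.2) a b ≤ ε →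
      ∀ i : Fin (mult μ θ j), (rescaledOutlier μ θ
          (perturbedMatrix (X n) θ (perturbationVectors model g))
          ((∑ l ∈ Finset.univ.filter (fun l ↦ l < j), mult μ θ l) + i) < x →
        eig (fluctuationMatrix hX θ model j n g) i <
          x * (∫ y, 1 / (rho μ (alpha μ θ j) - y) ^ 2 ∂μ) + ε) ∧
        (eig (fluctuationMatrix hX θ model j n g) i <
          x * (∫ y, 1 / (rho μ (alpha μ θ j) - y) ^ 2 ∂μ) - ε →
        rescaledOutlier μ θ
          (perturbedMatrix (X n) θ (perturbationVectors model g))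
          ((∑ l ∈ Finset.univ.filter (fun l ↦ l < j), mult μ θ l) + i) < x) := by
  set α := alpha μ θ j with hα
  set ρ := rho μ α with hρdef
  set s := ∫ y, 1 / (ρ - y) ^ 2 ∂μ with hs
  have hc := hspec.compact_support
  obtain ⟨hρ, hGα, hα0, hsign⟩ := rho_alpha_spec hc j
  obtain ⟨c, hc0, hgap⟩ := exists_gap_shifted hX hspec hρ x
  obtain ⟨C, hC0, hcorr⟩ := exists_correction (𝕜 := 𝕜) θ
  -- Below this threshold the perturbation cannot change the signs in the complementary block. The
  -- second bound `1 / 2` on `ε` is the condition on the Gram error for the correction lemma.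
  obtain ⟨ε₁, hε₁, hε₁'⟩ : ∃ ε₁ > 0, ∀ a : {a // θ a ≠ α}, ε₁ < |1 / θ a - 1 / α| := by
    have h1 : ∀ᶠ ε : ℝ in 𝓝[>] 0, ∀ a : {a // θ a ≠ α}, ε < |1 / θ a - 1 / α| := by
      refine eventually_all.2 fun a ↦ nhdsWithin_le_nhds (gt_mem_nhds (abs_pos.2 ?_))
      rw [sub_ne_zero, Ne, one_div, one_div, _root_.inv_inj]
      exact a.2
    obtain ⟨ε, h2, h3⟩ := (h1.and self_mem_nhdsWithin).exists
    exact ⟨ε, h3, h2⟩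
  refine ⟨C, min ε₁ (1 / 2), hC0, by positivity, ?_⟩
  filter_upwards [hgap, eventually_ge_atTop r] with n hn hrn model g ε hεε₀ hZ i
  obtain ⟨hn0, hn⟩ := hn
  have hn1 : (1 : ℝ) ≤ √√(n : ℝ) := by
    rw [Real.one_le_sqrt, Real.one_le_sqrt]
    exact_mod_cast hn0
  have hentry0 (a b : Fin r) : 0 ≤ entryError (hX n) ρ α s x C (fun p ↦ g p.1 p.2) a b := by
    unfold entryError; positivity
  have hsum0 : 0 ≤ ∑ a, ∑ b, entryError (hX n) ρ α s x C (fun p ↦ g p.1 p.2) a b :=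
    Finset.sum_nonneg fun a _ ↦ Finset.sum_nonneg fun b _ ↦ hentry0 a b
  have htE := sqrt_sqrt_mul_entrySum_gramError hn0 g
  have hE0 : 0 ≤ entrySum (gramError (rescaledVectors g)) := entrySum_nonneg _
  have hε2 : ε ≤ 1 / 2 := hεε₀.trans (min_le_right _ _)
  have hE1 : entrySum (gramError (rescaledVectors g)) ≤ 1 / 2 := by
    have := le_mul_of_one_le_left hE0 hn1
    linarith
  obtain ⟨F, hF1, hF2, hF3⟩ := hcorr model n g hE1
  set W := fluctuationMatrix hX θ model j n g with hWdef
  have hW : W.IsHermitian := fluctuationMatrix_isHermitian hX model j n g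
  set Q := specFun (hX n) fun l ↦ 1 / (shifted ρ x n - l) with hQ
  set H := diagonal (fun a ↦ ((1 / θ a : ℝ) : 𝕜)) + F -
    (columns (rescaledVectors g))ᴴ * Q * columns (rescaledVectors g) with hH
  have hentry := norm_rescaled_sub_le (hX n) hn0 (θ := θ) (α := α) (ρ := ρ) (s := s) (x := x) hC0
    (blockEquiv μ θ j) (fun i ↦ theta_blockIndex ⟨j, i⟩) (blockEquiv_inr j) g hF1 hF2
  obtain ⟨hlow, hup⟩ := npos_block_bounds (blockEquiv μ θ j) H hW
    (δ := fun a : {a // θ a ≠ α} ↦ 1 / θ a - 1 / α) (t := √√(n : ℝ)) (y := x * s) (ε := ε)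
    (by linarith) (fun a ↦ (hεε₀.trans (min_le_left _ _)).trans_lt (hε₁' a)) (by
      refine le_trans (Finset.sum_le_sum fun p _ ↦ Finset.sum_le_sum fun q _ ↦ hentry p q) ?_
      have h1 : ∑ p, ∑ q, entryError (hX n) ρ α s x C (fun p ↦ g p.1 p.2) (blockEquiv μ θ j p)
          (blockEquiv μ θ j q) =
          ∑ a, ∑ b, entryError (hX n) ρ α s x C (fun p ↦ g p.1 p.2) a b := by
        rw [← Equiv.sum_comp (blockEquiv μ θ j)]
        refine Finset.sum_congr rfl fun p _ ↦ ?_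
        rw [← Equiv.sum_comp (blockEquiv μ θ j)]
      rw [h1]
      have : 0 ≤ √√(n : ℝ) * entrySum (gramError (rescaledVectors g)) := by positivity
      linarith)
  rw [card_filter_subtype_ne, ← hα] at hlow hup
  have hz (i : Fin n) : shifted ρ x n - (hX n).eigenvalues i ≠ 0 :=
    abs_pos.1 (hc0.trans_le (hn i).2.1)
  have hin := npos_perturbedMatrix (hX n) hθ0 (perturbationVectors model g) hz
  rw [hF3 Q, ← hH, npos_smul_one_sub (hX n)] at hin
  -- The level lies outside the unperturbed spectrum, so it has none of the eigenvalues below it or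
  -- all `n` of them, according to the sign of `α`.
  have hcard : (Finset.univ.filter fun i ↦ (hX n).eigenvalues i < shifted ρ x n).card =
      if α < 0 then 0 else n := by
    rw [Finset.filter_congr fun i _ ↦ (hn i).2.2]
    split_ifs with h
    · simp [mt hsign.1 (not_not.2 h)]
    · simp [hsign.2 h]
  rw [hcard] at hin
  have hk : (i : ℕ) < Fintype.card (Fin (mult μ θ j)) := by simp
  -- The natural-number difference chosen for `q` is a true one: by `hlow` the inertia of `H` is at
  -- least the count contributed by the complementary block.
  have hiff := rescaledOutlier_lt_iff hc hθ hθ0 j i.2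
    (perturbedMatrix_isHermitian (hX n) θ (perturbationVectors model g)) hrn (x := x)
    (q := npos H - (Finset.univ.filter fun a ↦ 1 / α < 1 / θ a).card) (by
      refine hin.trans ?_
      rw [← hα]
      omega)
  rw [hiff, eig_lt_iff hW hk, eig_lt_iff hW hk]
  constructor
  · intro h
    omega
  · intro h
    omega

end Levels

/-! ### Moments of an admissible law. -/

section Moments

variable {𝕜 : Type*} [RCLike 𝕜] {ν : Measure 𝕜} [IsProbabilityMeasure ν]

open Classical in
lemma one_add_two_div_dysonIndex :
    1 + 2 / dysonIndex 𝕜 = if (RCLike.I : 𝕜) = 0 then 3 else 2 := by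
  unfold dysonIndex
  split_ifs <;> norm_num

lemma AdmissibleLaw.gaussianMoments (hν : AdmissibleLaw ν) (hκ : fourthCumulant ν = 0) :
    GaussianMoments ν (2 / dysonIndex 𝕜) := by
  classical
  have h4 : ∫ x, ‖x‖ ^ 4 ∂ν = 1 + 2 / dysonIndex 𝕜 := by
    rw [one_add_two_div_dysonIndex]
    exact sub_eq_zero.1 hκ
  have hpos : 0 < 1 + 2 / dysonIndex 𝕜 := by
    have := dysonIndex_pos (𝕜 := 𝕜)
    positivity
  -- The integral of a nonintegrable function is `0` by convention, whereas `h4` gives a positive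
  -- value.
  have hi4 : Integrable (fun x : 𝕜 ↦ ‖x‖ ^ 4) ν := by
    by_contra h
    rw [integral_undef h] at h4
    linarith
  have hL4 : MemLp (fun x : 𝕜 ↦ x) 4 ν := by
    rw [← integrable_norm_rpow_iff (by fun_prop) (by norm_num) (by norm_num)]
    refine hi4.congr (ae_of_all _ fun x ↦ ?_)
    simp only
    rw [← Real.rpow_natCast]
    norm_num
  have hL2 : MemLp (fun x : 𝕜 ↦ x) 2 ν := hL4.mono_exponent (by norm_num)
  refine ⟨hL4, hν.centred, hν.variance_one, h4, fun y ↦ ?_⟩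
  by_cases hI : (RCLike.I : 𝕜) = 0
  · have hd : dysonIndex 𝕜 = 1 := by rw [dysonIndex, if_pos hI]
    have h1 (x : 𝕜) : RCLike.re (star x * y) ^ 2 = ‖x‖ ^ 2 * ‖y‖ ^ 2 := by
      have h2 (z : 𝕜) : ‖z‖ ^ 2 = RCLike.re z ^ 2 := by
        rw [RCLike.norm_sq_eq_def, RCLike.im_eq_zero hI z]
        ring
      rw [← h2, norm_mul, norm_star, mul_pow]
    simp only [h1]
    rw [integral_mul_const, hν.variance_one, hd]
    norm_num
  -- The real and imaginary parts are uncorrelated with the same variance `1 / 2`, so projections in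
  -- all directions have the same second moment.
  · have hd : dysonIndex 𝕜 = 2 := by rw [dysonIndex, if_neg hI]
    obtain ⟨hind, hid⟩ := hν.re_im hI
    have hre : MemLp (fun x : 𝕜 ↦ RCLike.re x) 2 ν := hL2.re
    have him : MemLp (fun x : 𝕜 ↦ RCLike.im x) 2 ν := hL2.im
    have hre2 := hre.integrable_sq
    have him2 := him.integrable_sq
    have e1 : ∫ x : 𝕜, RCLike.re x ^ 2 ∂ν = ∫ x : 𝕜, RCLike.im x ^ 2 ∂ν :=
      (hid.comp (measurable_id.pow_const 2)).integral_eq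
    have e2 : ∫ x : 𝕜, RCLike.re x ^ 2 ∂ν + ∫ x : 𝕜, RCLike.im x ^ 2 ∂ν = 1 := by
      rw [← integral_add hre2 him2, ← hν.variance_one]
      congr 1
      ext x
      rw [RCLike.norm_sq_eq_def]
      ring
    have e3 : ∫ x : 𝕜, RCLike.re x * RCLike.im x ∂ν = 0 := by
      have h1 := hind.integral_fun_mul_eq_mul_integral hre.1 him.1
      rw [h1]
      have h2 : ∫ x : 𝕜, RCLike.re x ∂ν = 0 := by
        have := integral_re (hL2.integrable (by norm_num))
        rw [this, hν.centred, map_zero]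
      rw [h2, zero_mul]
    have e4 : Integrable (fun x : 𝕜 ↦ RCLike.re x * RCLike.im x) ν := hre.integrable_mul him
    have h1 (x : 𝕜) : RCLike.re (star x * y) ^ 2 = RCLike.re y ^ 2 * RCLike.re x ^ 2 +
        (RCLike.im y ^ 2 * RCLike.im x ^ 2 +
          2 * RCLike.re y * RCLike.im y * (RCLike.re x * RCLike.im x)) := by
      rw [RCLike.mul_re, RCLike.star_def, RCLike.conj_re, RCLike.conj_im]
      ring
    simp only [h1]
    rw [integral_add (g := fun x : 𝕜 ↦ RCLike.im y ^ 2 * RCLike.im x ^ 2 +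
          2 * RCLike.re y * RCLike.im y * (RCLike.re x * RCLike.im x))
        (hre2.const_mul _) ((him2.const_mul _).add (e4.const_mul _)),
      integral_add (him2.const_mul _) (e4.const_mul _), integral_const_mul, integral_const_mul,
      integral_const_mul, e3, hd, RCLike.norm_sq_eq_def]
    have e5 : ∫ x : 𝕜, RCLike.im x ^ 2 ∂ν = 1 / 2 := by linarith
    rw [e1, e5]
    ring

end Moments

/-! ### Measurability of the outliers in the entries. -/

section Measurability

variable {𝕜 : Type*} [RCLike 𝕜] {n r : ℕ} {α : Type*} [MeasurableSpace α]

lemma measurable_gramSchmidt {v : α → Fin r → EuclideanSpace 𝕜 (Fin n)}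
    (hv : ∀ s, Measurable fun ω ↦ v ω s) (s : Fin r) :
    Measurable fun ω ↦ InnerProductSpace.gramSchmidt 𝕜 (v ω) s := by
  induction s using WellFoundedLT.induction with
  | ind s ih =>
    have h (ω : α) : InnerProductSpace.gramSchmidt 𝕜 (v ω) s = v ω s - ∑ i ∈ Finset.Iio s,
        (inner 𝕜 (InnerProductSpace.gramSchmidt 𝕜 (v ω) i) (v ω s) /
          (‖InnerProductSpace.gramSchmidt 𝕜 (v ω) i‖ : 𝕜) ^ 2) •
            InnerProductSpace.gramSchmidt 𝕜 (v ω) i :=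
      eq_sub_of_add_eq (InnerProductSpace.gramSchmidt_def'' 𝕜 (v ω) s).symm
    simp only [h]
    refine (hv s).sub (Finset.measurable_sum _ fun i hi ↦ ?_)
    have hi := ih i (Finset.mem_Iio.1 hi)
    refine Measurable.smul (Measurable.div (Measurable.inner (𝕜 := 𝕜) hi (hv s)) ?_) hi
    exact ((RCLike.measurable_ofReal (𝕜 := 𝕜)).comp hi.norm).pow_const 2

lemma measurable_perturbationVectors (model : Model) {g : α → Fin r → Fin n → 𝕜}
    (hg : ∀ s i, Measurable fun ω ↦ g ω s i) (s : Fin r) :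
    Measurable fun ω ↦ perturbationVectors model (g ω) s := by
  have hv (s : Fin r) : Measurable fun ω ↦ rescaledVectors (g ω) s := by
    refine (PiLp.continuous_toLp 2 _).measurable.comp (measurable_pi_lambda _ fun i ↦ ?_)
    exact (hg s i).const_mul _
  cases model with
  | iid => exact hv s
  | orthonormalised =>
    have := measurable_gramSchmidt hv s
    exact Measurable.smul ((RCLike.measurable_ofReal (𝕜 := 𝕜)).comp this.norm).inv this

lemma measurable_perturbedMatrix (X : Matrix (Fin n) (Fin n) 𝕜) (θ : Fin r → ℝ)
    {u : α → Fin r → EuclideanSpace 𝕜 (Fin n)} (hu : ∀ s, Measurable fun ω ↦ u ω s) :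
    Measurable fun ω ↦ perturbedMatrix X θ (u ω) := by
  refine measurable_pi_lambda _ fun i ↦ measurable_pi_lambda _ fun j ↦ ?_
  have h (s : Fin r) (i : Fin n) : Measurable fun ω ↦ (u ω s).ofLp i :=
    (measurable_pi_apply i).comp ((PiLp.continuous_ofLp 2 _).measurable.comp (hu s))
  simp only [perturbedMatrix, Matrix.add_apply, Matrix.sum_apply, Matrix.smul_apply,
    Matrix.vecMulVec_apply, Pi.star_apply, smul_eq_mul]
  refine measurable_const.add (Finset.measurable_sum _ fun s _ ↦ ?_)
  exact ((h s i).mul (continuous_star.measurable.comp (h s j))).const_mul _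

lemma measurable_eig {ι : Type*} [Fintype ι] [DecidableEq ι] {A : α → Matrix ι ι 𝕜}
    (hA : Measurable A) (hAH : ∀ ω, (A ω).IsHermitian) (i : ℕ) :
    Measurable fun ω ↦ eig (A ω) i := by
  have := (measurable_eig_hermPart (𝕜 := 𝕜) (ι := ι) i).comp hA
  simpa only [Function.comp_def, hermPart_of_isHermitian (hAH _)] using this

lemma measurable_rescaledOutlier (μ : Measure ℝ) {X : Matrix (Fin n) (Fin n) 𝕜}
    (hX : X.IsHermitian) (θ : Fin r → ℝ) (model : Model) (m : ℕ) :
    Measurable fun g : Fin r × Fin n → 𝕜 ↦ rescaledOutlier μ θ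
      (perturbedMatrix X θ (perturbationVectors model fun s t ↦ g (s, t))) m := by
  have h := measurable_perturbedMatrix X θ (measurable_perturbationVectors model
    (g := fun (g : Fin r × Fin n → 𝕜) s t ↦ g (s, t)) fun s i ↦ measurable_pi_apply (s, i))
  have h2 (m : ℕ) := measurable_eig h (fun _ ↦ perturbedMatrix_isHermitian hX θ _) m
  unfold rescaledOutlier
  split_ifs
  · exact ((h2 _).sub_const _).const_mul _
  · exact ((h2 _).sub_const _).const_mul _

end Measurability

/-! ### Scaling and size of the eigenvalues. -/

section Eigenvalues

variable {𝕜 : Type*} [RCLike 𝕜] {ι : Type*} [Fintype ι] [DecidableEq ι]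

lemma eig_smul_lt_iff {A : Matrix ι ι 𝕜} (hA : A.IsHermitian) {s : ℝ} (hs : 0 < s) {i : ℕ}
    (hi : i < Fintype.card ι) (w : ℝ) :
    eig (((1 / s : ℝ) : 𝕜) • A) i < w ↔ eig A i < w * s := by
  rw [eig_lt_iff (isHermitian_smul hA _) hi, eig_lt_iff hA hi, ← npos_smul hs, smul_sub, smul_smul,
    smul_smul, ← RCLike.ofReal_mul, ← RCLike.ofReal_mul, mul_one_div_cancel hs.ne',
    RCLike.ofReal_one, one_smul, mul_comm s w]

lemma eig_zero {i : ℕ} (hi : i < Fintype.card ι) : eig (0 : Matrix ι ι 𝕜) i = 0 := by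
  have h (z : ℝ) : eig (0 : Matrix ι ι 𝕜) i < z ↔ 0 < z := by
    rw [eig_lt_iff Matrix.isHermitian_zero hi, sub_zero, Matrix.smul_one_eq_diagonal,
      npos_diagonal fun _ ↦ z]
    by_cases hz : 0 < z
    · simpa [hz] using hi
    · simp [hz]
  refine le_antisymm (le_of_forall_gt fun z hz ↦ (h z).2 hz) ?_
  exact le_of_forall_gt fun z hz ↦ (h z).1 hz

lemma abs_eig_le {A : Matrix ι ι 𝕜} (hA : A.IsHermitian) {i : ℕ} (hi : i < Fintype.card ι) :
    |eig A i| ≤ entrySum A := by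
  have := abs_eig_sub_le hA Matrix.isHermitian_zero i
  rwa [eig_zero hi, sub_zero, sub_zero] at this

end Eigenvalues

/-! ### Asymptotic equality of outliers and fluctuation eigenvalues. -/

section Convergence

variable {𝕜 : Type*} [RCLike 𝕜] {μ : Measure ℝ} [IsProbabilityMeasure μ]
  {X : (n : ℕ) → Matrix (Fin n) (Fin n) 𝕜} (hX : ∀ n, (X n).IsHermitian)
  (hspec : SpectralConvergence X μ) {r : ℕ} {θ : Fin r → ℝ}
  {ν : Measure 𝕜} [IsProbabilityMeasure ν] {κ : ℝ}
  {Ω : ℕ → Type*} [∀ n, MeasurableSpace (Ω n)] {P : (n : ℕ) → Measure (Ω n)}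
  [∀ n, IsProbabilityMeasure (P n)]
  {g : (n : ℕ) → Ω n → Fin r → Fin n → 𝕜}
  (hG : ∀ n, AEMeasurable (fun ω (p : Fin r × Fin n) ↦ g n ω p.1 p.2) (P n))
  (hGP : ∀ n, (P n).map (fun ω (p : Fin r × Fin n) ↦ g n ω p.1 p.2) = Measure.pi fun _ ↦ ν)

-- The entries have bounded second moments, because the normalised Frobenius norms of the limit
-- forms converge; the eigenvalues are dominated by the sum of the moduli of the entries.
include hspec hG hGP in
lemma GaussianMoments.tight_eig_fluctuationMatrix (h : GaussianMoments ν κ) (model : Model)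
    (j : Fin (numValues μ θ)) (i : Fin (mult μ θ j)) {η : ENNReal} (hη : 0 < η) :
    ∃ K, ∀ᶠ n in atTop, P n {ω | K ≤ |eig (fluctuationMatrix hX θ model j n (g n ω)) i|} ≤ η := by
  have hc := hspec.compact_support
  have hρ := (rho_alpha_spec hc j).1
  set A : (n : ℕ) → Matrix (Fin n) (Fin n) 𝕜 := fun n ↦ ((1 / √(n : ℝ) : ℝ) : 𝕜) •
    limitForm (hX n) (rho μ (alpha μ θ j)) (model.indicator / alpha μ θ j) with hA
  obtain ⟨D, hD⟩ := (tendsto_sum_norm_sq_limitForm hX hspec hρ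
    (model.indicator / alpha μ θ j)).isBoundedUnder_le
  have hS : ∀ᶠ n in atTop, ∑ a, ∑ b, ‖A n a b‖ ^ 2 ≤ |D| := by
    filter_upwards [eventually_map.1 hD] with n hn
    rw [sum_norm_sq_smul, div_pow, one_pow, Real.sq_sqrt (Nat.cast_nonneg n), one_div]
    exact hn.trans (le_abs_self D)
  have hAH (n : ℕ) : (A n).IsHermitian := isHermitian_smul (specFun_isHermitian (hX n) _) _
  have hlim : Tendsto (fun t : ℝ ↦ ∑ _a : Fin (mult μ θ j), ∑ _b : Fin (mult μ θ j),
      ENNReal.ofReal (8 * |κ| * |D| / t ^ 2)) atTop (𝓝 0) := by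
    have h1 : Tendsto (fun t : ℝ ↦ 8 * |κ| * |D| / t ^ 2) atTop (𝓝 0) :=
      tendsto_const_nhds.div_atTop (tendsto_pow_atTop two_ne_zero)
    have h2 := ENNReal.tendsto_ofReal h1
    rw [ENNReal.ofReal_zero] at h2
    have := tendsto_finsetSum Finset.univ fun (_ : Fin (mult μ θ j)) _ ↦
      tendsto_finsetSum Finset.univ fun (_ : Fin (mult μ θ j)) _ ↦ h2
    simpa using this
  obtain ⟨t, ht, ht0⟩ := ((hlim.eventually_le_const hη).and (eventually_gt_atTop 0)).exists
  refine ⟨∑ _a : Fin (mult μ θ j), ∑ _b : Fin (mult μ θ j), t, ?_⟩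
  filter_upwards [hS] with n hn
  refine le_trans ?_ ht
  have hsub : {ω | ∑ _a : Fin (mult μ θ j), ∑ _b : Fin (mult μ θ j), t ≤
      |eig (fluctuationMatrix hX θ model j n (g n ω)) i|} ⊆
      ⋃ a : Fin (mult μ θ j), ⋃ b : Fin (mult μ θ j), {ω | t ≤ ‖bil (A n) (blockIndex μ θ ⟨j, a⟩) (blockIndex μ θ ⟨j, b⟩)
        (fun p ↦ g n ω p.1 p.2)‖} := by
    intro ω hω
    by_contra hcon
    simp only [Set.mem_iUnion, Set.mem_ofPred_eq, not_exists, not_le] at hcon hω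
    have h1 := abs_eig_le (fluctuationMatrix_isHermitian hX model j n (g n ω))
      (i := (i : ℕ)) (by simp)
    have h2 : entrySum (fluctuationMatrix hX θ model j n (g n ω)) < ∑ _a : Fin (mult μ θ j), ∑ _b : Fin (mult μ θ j), t :=
      Finset.sum_lt_sum_of_nonempty ⟨i, Finset.mem_univ i⟩ fun a _ ↦
        Finset.sum_lt_sum_of_nonempty ⟨i, Finset.mem_univ i⟩ fun b _ ↦ hcon a b
    linarith
  refine (measure_mono hsub).trans ((measure_iUnion_fintype_le _ _).trans
    (Finset.sum_le_sum fun a _ ↦ (measure_iUnion_fintype_le _ _).trans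
      (Finset.sum_le_sum fun b _ ↦ ?_)))
  refine (h.measure_bil_le (hG n) (hGP n) (hAH n) _ _ ht0).trans (ENNReal.ofReal_le_ofReal ?_)
  gcongr
  exact le_abs_self κ

include hspec hG hGP in
/-- The rescaled outliers are asymptotic to the eigenvalues of the fluctuation matrices. -/
lemma GaussianMoments.tendstoZero_rescaledOutlier_sub (h : GaussianMoments ν κ) (hθ : Monotone θ)
    (hθ0 : ∀ a, θ a ≠ 0) (hfast : FastStieltjesConvergence X μ θ) (model : Model)
    (j : Fin (numValues μ θ)) (i : Fin (mult μ θ j)) :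
    TendstoZero P fun n ω ↦ |rescaledOutlier μ θ
        (perturbedMatrix (X n) θ (perturbationVectors model (g n ω)))
        ((∑ l ∈ Finset.univ.filter (fun l ↦ l < j), mult μ θ l) + i) -
      eig (((1 / ∫ y, 1 / (rho μ (alpha μ θ j) - y) ^ 2 ∂μ : ℝ) : 𝕜) •
        fluctuationMatrix hX θ model j n (g n ω)) i| := by
  have hc := hspec.compact_support
  obtain ⟨hρ, hGα, hα0, -⟩ := rho_alpha_spec hc j
  have hs := integral_inv_sq_pos hρ hc hα0 hGα
  set s := ∫ y, 1 / (rho μ (alpha μ θ j) - y) ^ 2 ∂μ with hsdef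
  have hi : (i : ℕ) < Fintype.card (Fin (mult μ θ j)) := by simp
  have hscale (n : ℕ) (ω : Ω n) (w : ℝ) := eig_smul_lt_iff
    (fluctuationMatrix_isHermitian hX model j n (g n ω)) hs hi w
  refine tendstoZero_abs_sub_of_levels (fun x δ hδ ↦ ?_) fun η hη ↦ ?_
  · obtain ⟨C, ε₀, hC, hε₀, hbound⟩ := rescaledOutlier_lt_bounds hX hspec hθ hθ0 j x
    have hZ := (TendstoZero.sum Finset.univ fun a : Fin r ↦
      TendstoZero.sum Finset.univ fun b : Fin r ↦ h.tendstoZero_bil hG hGP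
        (fun n ↦ isHermitian_smul Matrix.isHermitian_one _) tendsto_sum_norm_sq_one a b).add
      (TendstoZero.sum Finset.univ fun a : Fin r ↦ TendstoZero.sum Finset.univ fun b : Fin r ↦
        h.tendstoZero_entryError hX hspec hG hGP hρ hGα (hfast j) hC x a b)
    -- `ε₀` keeps the comparison valid, and `s * δ` converts an error in the level `x * s` into an
    -- error `δ` in `x`.
    refine tendsto_measure_mono (hZ (min ε₀ (s * δ)) (by positivity)) ?_
    filter_upwards [hbound] with n hn ω hω
    by_contra hcon
    simp only [Set.mem_ofPred_eq, not_le] at hcon hω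
    obtain ⟨h1, h2⟩ := hn model (g n ω) (min ε₀ (s * δ)) (min_le_left _ _) hcon.le i
    have hmin : min ε₀ (s * δ) ≤ s * δ := min_le_right _ _
    rcases hω with ⟨h3, h4⟩ | ⟨h3, h4⟩
    · rw [← not_lt, hscale, not_lt] at h4
      have := h1 h3
      rw [← hsdef] at this
      linarith
    · rw [hscale] at h4
      refine absurd (h2 ?_) h3.not_gt
      rw [← hsdef]
      linarith
  · obtain ⟨K, hK⟩ := h.tight_eig_fluctuationMatrix hX hspec hG hGP model j i hη
    -- Division by `s` matches the scaled matrix; the extra `1` provides strict inequalities.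
    refine ⟨(|K| + 1) / s, hK.mono fun n hn ↦ (measure_mono fun ω hω ↦ ?_).trans hn⟩
    simp only [Set.mem_ofPred_eq] at hω ⊢
    by_contra hcon
    rw [not_le, abs_lt] at hcon
    refine absurd hω (not_le.2 (abs_lt.2 ⟨?_, ?_⟩))
    · have h5 : -(|K| / s) ≤ eig (((1 / s : ℝ) : 𝕜) •
          fluctuationMatrix hX θ model j n (g n ω)) i := by
        rw [← not_lt, hscale, neg_mul, div_mul_cancel₀ _ hs.ne', not_lt]
        linarith [le_abs_self K]
      have h6 : |K| / s < (|K| + 1) / s := by gcongr; linarith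
      linarith
    · rw [hscale, div_mul_cancel₀ _ hs.ne']
      linarith [le_abs_self K]

end Convergence

/-! ### Identification of the limit law. -/

section Limit

variable {𝕜 : Type*} [RCLike 𝕜]

lemma gaussianMatrix_isHermitian {k : ℕ} (ξ : Fin k × Fin k → ℝ) :
    (gaussianMatrix 𝕜 ξ).IsHermitian := by
  ext a b
  rcases lt_trichotomy a b with h | rfl | h
  · simp [gaussianMatrix, h, h.ne, h.ne', h.not_gt, sub_eq_add_neg]
  · simp [gaussianMatrix]
  · simp [gaussianMatrix, h, h.ne, h.ne', h.not_gt, sub_eq_add_neg]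

lemma ae_isHermitian_of_hasLaw {k : ℕ} {Ω : Type*} [MeasurableSpace Ω] {P : Measure Ω}
    {M : Ω → Matrix (Fin k) (Fin k) 𝕜} (hM : HasLaw M (gaussianEnsemble 𝕜 k) P) :
    ∀ᵐ ω ∂P, (M ω).IsHermitian := by
  have hm : MeasurableSet {A : Matrix (Fin k) (Fin k) 𝕜 | A.IsHermitian} := by
    have : {A : Matrix (Fin k) (Fin k) 𝕜 | A.IsHermitian} =
        ⋂ a, ⋂ b, {A | star (A b a) = A a b} := by
      ext A
      simp only [Set.mem_ofPred_eq, Set.mem_iInter, Matrix.IsHermitian, ← Matrix.ext_iff,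
        Matrix.conjTranspose_apply]
    rw [this]
    exact MeasurableSet.iInter fun a ↦ MeasurableSet.iInter fun b ↦ measurableSet_eq_fun
      (continuous_star.measurable.comp (measurable_matrix_apply b a)) (measurable_matrix_apply a b)
  have h1 : ∀ᵐ A ∂(P.map M), A.IsHermitian := by
    rw [hM.map_eq, gaussianEnsemble, ae_map_iff measurable_gaussianMatrix.aemeasurable hm]
    exact ae_of_all _ gaussianMatrix_isHermitian
  exact (ae_map_iff hM.aemeasurable hm).1 h1

/-- With `β = indicator / α` and `G(ρ) = 1 / α`, the variance expands to `s - 2β/α + β²`: it is `s`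
for `β = 0` and `s - α⁻²` for `β = 1/α`. The constant is its square root divided by `s`. -/
lemma fluctuationConstant_eq {μ : Measure ℝ} [IsProbabilityMeasure μ] (hc : IsCompact μ.support)
    {α : ℝ} (hρ : rho μ α < lowerEdge μ ∨ upperEdge μ < rho μ α)
    (hG : cauchyTransform μ (rho μ α) = 1 / α) (hα : α ≠ 0) (model : Model) :
    fluctuationConstant model μ α =
      1 / (∫ x, 1 / (rho μ α - x) ^ 2 ∂μ) *
        √(∫ x, (1 / (rho μ α - x) - model.indicator / α) ^ 2 ∂μ) := by
  have hs := integral_inv_sq_pos hρ hc hα hG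
  rw [integral_inv_sub_sub_sq hρ hc, hG]
  set s := ∫ x, 1 / (rho μ α - x) ^ 2 ∂μ with hsdef
  cases model with
  | iid =>
    simp only [fluctuationConstant, Model.indicator, ← hsdef]
    rw [zero_div, mul_zero, zero_mul, sub_zero, zero_pow two_ne_zero, add_zero,
      Real.sqrt_div zero_le_one, Real.sqrt_one, one_div_mul_eq_div, Real.sqrt_div_self']
  | orthonormalised =>
    simp only [fluctuationConstant, Model.indicator, ← hsdef]
    have h1 : s - 2 * (1 / α) * (1 / α) + (1 / α) ^ 2 = s - 1 / α ^ 2 := by ring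
    rw [h1, Real.sqrt_div' _ (sq_nonneg s), Real.sqrt_sq hs.le, one_div_mul_eq_div]

lemma dist_le_sum_sum {J : Type*} [Fintype J] {I : J → Type*} [∀ j, Fintype (I j)]
    (x y : (j : J) → I j → ℝ) : dist x y ≤ ∑ j, ∑ i, |x j i - y j i| := by
  have h0 (j : J) : 0 ≤ ∑ i, |x j i - y j i| := Finset.sum_nonneg fun i _ ↦ abs_nonneg _
  refine (dist_pi_le_iff (Finset.sum_nonneg fun j _ ↦ h0 j)).2 fun j ↦ ?_
  refine le_trans ?_ (Finset.single_le_sum (fun l _ ↦ h0 l) (Finset.mem_univ j))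
  refine (dist_pi_le_iff (h0 j)).2 fun i ↦ ?_
  rw [Real.dist_eq]
  exact Finset.single_le_sum (f := fun i ↦ |x j i - y j i|) (fun _ _ ↦ abs_nonneg _)
    (Finset.mem_univ i)

end Limit

end FiniteRankDeformation

end

/-! ### Assembly of the theorem. -/

open FiniteRankDeformation in
theorem theorem3p2 {𝕜 : Type*} [RCLike 𝕜]
    -- the deterministic self-adjoint matrices and their limiting spectral measure
    (X : (n : ℕ) → Matrix (Fin n) (Fin n) 𝕜) (hX : ∀ n, (X n).IsHermitian)
    (μX : Measure ℝ) [IsProbabilityMeasure μX] (hspec : SpectralConvergence X μX)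
    -- the deterministic coefficients of the perturbation
    {r : ℕ} (θ : Fin r → ℝ) (hθ : Monotone θ) (hθ0 : ∀ i, θ i ≠ 0)
    (hfast : FastStieltjesConvergence X μX θ)
    -- the law of the entries
    (ν : Measure 𝕜) [IsProbabilityMeasure ν] (hν : AdmissibleLaw ν) (hκ : fourthCumulant ν = 0)
    -- for each `n`, the `r * n` i.i.d. entries with law `ν`
    {Ω : ℕ → Type*} [∀ n, MeasurableSpace (Ω n)] (P : (n : ℕ) → Measure (Ω n))
    [∀ n, IsProbabilityMeasure (P n)]
    (g : (n : ℕ) → Fin r → Fin n → Ω n → 𝕜)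
    (hg_law : ∀ n s i, HasLaw (g n s i) ν (P n))
    (hg_indep : ∀ n, iIndepFun (fun p : Fin r × Fin n ↦ g n p.1 p.2) (P n))
    -- the i.i.d. or the orthonormalised model
    (model : Model)
    -- the independent matrices `M_1, …, M_q` of the limit
    {Ω' : Type*} [MeasurableSpace Ω'] (P' : Measure Ω') [IsProbabilityMeasure P']
    (M : (j : Fin (numValues μX θ)) → Ω' → Matrix (Fin (mult μX θ j)) (Fin (mult μX θ j)) 𝕜)
    (hM_law : ∀ j, HasLaw (M j) (gaussianEnsemble 𝕜 (mult μX θ j)) P')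
    (hM_indep : iIndepFun M P') :
    TendstoInDistribution
      (fun (n : ℕ) (ω : Ω n) (j : Fin (numValues μX θ)) (i : Fin (mult μX θ j)) ↦
        rescaledOutlier μX θ
          (perturbedMatrix (X n) θ (perturbationVectors model fun s t ↦ g n s t ω))
          ((∑ l ∈ Finset.univ.filter (fun l ↦ l < j), mult μX θ l) + i))
      atTop
      (fun (ω : Ω') (j : Fin (numValues μX θ)) (i : Fin (mult μX θ j)) ↦
        eig ((fluctuationConstant model μX (alpha μX θ j) : 𝕜) • M j ω) i)
      P P' := by
  classical
  have hc := hspec.compact_support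
  have hmom := hν.gaussianMoments hκ
  have hmeas (n : ℕ) (p : Fin r × Fin n) : AEMeasurable (g n p.1 p.2) (P n) :=
    (hg_law n p.1 p.2).aemeasurable
  have hG (n : ℕ) : AEMeasurable (fun ω (p : Fin r × Fin n) ↦ g n p.1 p.2 ω) (P n) :=
    aemeasurable_pi_lambda _ fun p ↦ hmeas n p
  have hGP (n : ℕ) : (P n).map (fun ω (p : Fin r × Fin n) ↦ g n p.1 p.2 ω) =
      Measure.pi fun _ ↦ ν := by
    rw [(iIndepFun_iff_map_fun_eq_pi_map (hmeas n)).1 (hg_indep n)]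
    exact congrArg Measure.pi (funext fun p ↦ (hg_law n p.1 p.2).map_eq)
  -- Only the vectors whose `θ` produces an outlier enter the limit; `f` extracts them, and by
  -- injectivity they keep the product law.
  let f (n : ℕ) (p : (Σ j, Fin (mult μX θ j)) × Fin n) : Fin r × Fin n := (blockIndex μX θ p.1, p.2)
  have hf (n : ℕ) : Function.Injective (f n) := fun p q hpq ↦
    Prod.ext (blockIndex_injective (Prod.ext_iff.1 hpq).1) (Prod.ext_iff.1 hpq).2
  have hG' (n : ℕ) : AEMeasurable (fun ω p ↦ g n (f n p).1 (f n p).2 ω) (P n) :=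
    aemeasurable_pi_lambda _ fun p ↦ hmeas n (f n p)
  have hGP' (n : ℕ) : (P n).map (fun ω p ↦ g n (f n p).1 (f n p).2 ω) = Measure.pi fun _ ↦ ν := by
    rw [(iIndepFun_iff_map_fun_eq_pi_map fun p ↦ hmeas n (f n p)).1 ((hg_indep n).precomp (hf n))]
    exact congrArg Measure.pi (funext fun p ↦ (hg_law n (f n p).1 (f n p).2).map_eq)
  have hα (j : Fin (numValues μX θ)) := rho_alpha_spec hc j
  let β (j : Fin (numValues μX θ)) : ℝ := model.indicator / alpha μX θ j
  let s (j : Fin (numValues μX θ)) : ℝ := ∫ y, 1 / (rho μX (alpha μX θ j) - y) ^ 2 ∂μX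
  let v (j : Fin (numValues μX θ)) : ℝ := ∫ y, (1 / (rho μX (alpha μX θ j) - y) - β j) ^ 2 ∂μX
  have hv0 (j : Fin (numValues μX θ)) : 0 ≤ v j := integral_nonneg fun _ ↦ sq_nonneg _
  choose C hC using fun j ↦ exists_opBound_limitForm hX hspec (hα j).1 (β j)
  have hCj (j : Fin (numValues μX θ)) : C j ≤ ∑ l, |C l| :=
    (le_abs_self _).trans (Finset.single_le_sum (f := fun l ↦ |C l|) (fun l _ ↦ abs_nonneg _)
      (Finset.mem_univ j))
  have hW := hmom.tendstoInDistribution_bil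
    (B := fun j n ↦ limitForm (hX n) (rho μX (alpha μX θ j)) (β j))
    (fun j n ↦ specFun_isHermitian (hX n) _) (fun j ↦ (hC j).mono fun n hn ↦ hn.mono (hCj j))
    (fun j ↦ tendsto_sum_norm_sq_limitForm hX hspec (hα j).1 (β j)) hG' hGP' hM_law hM_indep
    (σ := fun j ↦ √(v j)) fun j ↦ Real.sq_sqrt (hv0 j)
  -- The Hermitian part makes `Ψ` continuous everywhere. It changes nothing on the fluctuation
  -- matrices, nor on the Gaussian matrices, which are Hermitian almost surely.
  let Ψ (A : (j : Fin (numValues μX θ)) → Matrix (Fin (mult μX θ j)) (Fin (mult μX θ j)) 𝕜)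
      (j : Fin (numValues μX θ)) (i : Fin (mult μX θ j)) : ℝ :=
    eig (hermPart (((1 / s j : ℝ) : 𝕜) • A j)) i
  have hΨ : Continuous Ψ := continuous_pi fun j ↦ continuous_pi fun i ↦
    (continuous_eig_hermPart (𝕜 := 𝕜) i).comp (by fun_prop)
  have hΛ : TendstoInDistribution (fun (n : ℕ) (ω : Ω n) (j : Fin (numValues μX θ))
      (i : Fin (mult μX θ j)) ↦ eig (((1 / s j : ℝ) : 𝕜) •
        fluctuationMatrix hX θ model j n fun s t ↦ g n s t ω) i) atTop
      (fun (ω : Ω') (j : Fin (numValues μX θ)) (i : Fin (mult μX θ j)) ↦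
        eig ((fluctuationConstant model μX (alpha μX θ j) : 𝕜) • M j ω) i) P P' := by
    refine (hW.continuous_comp hΨ).congr (fun n ↦ ae_of_all _ fun ω ↦ ?_) ?_
    · funext j i
      simp only [Function.comp_apply, Ψ]
      rw [← hermPart_of_isHermitian (isHermitian_smul
        (fluctuationMatrix_isHermitian hX model j n fun s t ↦ g n s t ω) (1 / s j))]
      congr 3
      ext a b
      exact bil_comp blockIndex_injective _ _ _ fun p ↦ g n p.1 p.2 ω
    · filter_upwards [ae_all_iff.2 fun j ↦ ae_isHermitian_of_hasLaw (hM_law j)] with ω hω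
      funext j i
      simp only [Function.comp_apply, Ψ]
      rw [smul_smul, ← RCLike.ofReal_mul, ← fluctuationConstant_eq hc (hα j).1 (hα j).2.1
        (hα j).2.2.1, hermPart_of_isHermitian (isHermitian_smul (hω j) _)]
  -- Slutsky's lemma: the outliers share the limit of the fluctuation eigenvalues, the distance
  -- being at most a finite sum of differences tending to zero in probability.
  refine tendstoInDistribution_of_dist hΛ (fun n ↦ ?_) fun ε hε ↦ ?_
  · refine aemeasurable_pi_lambda _ fun j ↦ aemeasurable_pi_lambda _ fun i ↦ ?_
    have h1 := (measurable_rescaledOutlier μX (hX n) θ model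
      ((∑ l ∈ Finset.univ.filter (fun l ↦ l < j), mult μX θ l) + i)).comp_aemeasurable (hG n)
    simp only [Function.comp_def] at h1
    exact h1
  · have hZ := TendstoZero.sum Finset.univ fun j ↦ TendstoZero.sum Finset.univ fun i ↦
      hmom.tendstoZero_rescaledOutlier_sub hX hspec (g := fun n ω s t ↦ g n s t ω) hG hGP hθ hθ0
        hfast model j i
    exact tendsto_measure_mono (hZ ε hε) (.of_forall fun n ω hω ↦ hω.trans (dist_le_sum_sum _ _))
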